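/- Let $(M^2,g)$ and $(N^n,h)$ be smooth Riemannian manifolds of dimensions $2$ and $n$, and let $\varphi:(M,g)\to(N,h)$ be a smooth isometric immersion. Let $B$ be its second fundamental form, $H=\tfrac12\operatorname{trace}B$ its mean curvature vector field and $A_H$ its shape operator in the direction of $H$, i.e. $\langle A_H(X),Y\rangle=\langle B(X,Y),H\rangle$. Assume that $\varphi$ is CMC, i.e. $|H|$ is constant, and biconservative, i.e. $\operatorname{div}S_2=0$, where, with $\tau(\varphi)=\operatorname{trace}\nabla d\varphi$, $$\langle S_2(X),Y\rangle=\tfrac12|\tau(\varphi)|^2\langle X,Y\rangle+\langle d\varphi,\nabla\tau(\varphi)\rangle\langle X,Y\rangle-\langle d\varphi(X),\nabla_Y\tau(\varphi)\rangle-\langle d\varphi(Y),\nabla_X\tau(\varphi)\rangle .$$ Let $\lambda_1\ge\lambda_2$ be the principal curvatures, i.e. the eigenvalue functions of $A_H$, and let $\mu=\lambda_1-\lambda_2$. Let $p\in M$ be a non-pseudoumbilical point, i.e. $A_H\ne|H|^2 I$ at $p$. Then there is a local chart $(U;x,y)$ around $p$ which is both isothermal and a line of curvature coordinate system for $A_H$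 (the coordinate vectors $\partial_x,\partial_y$ are orthogonal eigenvectors of $A_H$), such that on $U$ the function $\mu$ is positive and smooth, $$g=\frac1\mu\,(dx^2+dy^2),\qquad \langle A_H(\cdot),\cdot\rangle=\Bigl(\frac{|H|^2}{\mu}+\frac12\Bigr)dx^2+\Bigl(\frac{|H|^2}{\mu}-\frac12\Bigr)dy^2,$$ or, equivalently for the last formula, as a tensor of type $(1,1)$, $$A_H=\Bigl(|H|^2+\frac{\mu}{2}\Bigr)dx\otimes\partial_x+\Bigl(|H|^2-\frac{\mu}{2}\Bigr)dy\otimes\partial_y .$$ If moreover $n=3$, then on $U$ $$\mu\,\Delta\mu+|\nabla\mu|_0^2+2\mu\Bigl(K^N+|H|^2-\frac{\mu^2}{4|H|^2}\Bigr)=0,$$ where $\Delta\mu=-(\mu_{xx}+\mu_{yy})$, $|\nabla\mu|_0^2=\mu_x^2+\mu_y^2$, and $K^N$ is the sectional curvature of $N$ on the tangent planes $d\varphi(T_qM)$, $q\in U$ (and $|H|\neq0$ because there is a non-pseudoumbilical point). -/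

import Mathlib

open Bundle Manifold
open scoped ContDiff

noncomputable section

namespace RiemSub

/-- The model space `ℝⁿ` with its Euclidean norm. -/
abbrev Eu (n : ℕ) : Type := EuclideanSpace ℝ (Fin n)

/-- The tangent space at `p` of a manifold modelled on `ℝⁿ`. -/
abbrev Tan (n : ℕ) {M : Type*} [TopologicalSpace M] [ChartedSpace (Eu n) M] (p : M) : Type :=
  TangentSpace 𝓘(ℝ, Eu n) p

/-- Smooth Riemannian metrics on a smooth manifold modelled on `ℝⁿ`. -/
abbrev Metric (n : ℕ) (M : Type*) [TopologicalSpace M] [ChartedSpace (Eu n) M]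
    [IsManifold 𝓘(ℝ, Eu n) ∞ M] : Type _ :=
  ContMDiffRiemannianMetric 𝓘(ℝ, Eu n) ∞ (Eu n) (fun p : M => TangentSpace 𝓘(ℝ, Eu n) p)

/-- The `i`-th standard basis vector of `ℝⁿ`. -/
def stdVec {n : ℕ} (i : Fin n) : Eu n := EuclideanSpace.single i 1

section OneManifold

variable {n : ℕ} {N : Type*} [TopologicalSpace N] [ChartedSpace (Eu n) N]

/-- The differential `T_q N → ℝⁿ` of a chart `e` at a point `q` (of the domain of `e`). -/
def dChart (e : OpenPartialHomeomorph N (Eu n)) (q : N) : Tan n q →L[ℝ] Eu n :=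
  mfderiv 𝓘(ℝ, Eu n) 𝓘(ℝ, Eu n) e q

/-- The inverse `ℝⁿ → T_q N` of the differential of a chart `e` at `q`; applied to the `i`-th
standard basis vector it gives the coordinate vector `∂_i` of `e` at `q`. -/
def dChartInv (e : OpenPartialHomeomorph N (Eu n)) (q : N) : Eu n →L[ℝ] Tan n q :=
  (dChart e q).inverse

/-- The vector field which extends `w ∈ T_p N` and has constant components in the preferred chart
at `p` (this is smooth near `p`). -/
def localExt (p : N) (w : Tan n p) (q : N) : Tan n q :=
  dChartInv (chartAt (Eu n) p) q (dChart (chartAt (Eu n) p) p w)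

variable [IsManifold 𝓘(ℝ, Eu n) ∞ N]

/-- The metric `h` read in the chart `f`, at `x ∈ ℝⁿ`. -/
def metricInChart (h : Metric n N) (f : OpenPartialHomeomorph N (Eu n)) (x v w : Eu n) : ℝ :=
  h.inner (f.symm x) (dChartInv f (f.symm x) v) (dChartInv f (f.symm x) w)

/-- The matrix `(h_{ij})` of the metric in the chart `f`. -/
def gramInChart (h : Metric n N) (f : OpenPartialHomeomorph N (Eu n)) (x : Eu n) :
    Matrix (Fin n) (Fin n) ℝ :=
  Matrix.of fun i j => metricInChart h f x (stdVec i) (stdVec j)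

/-- The Christoffel symbols of `h` in the chart `f`, as the vector-valued bilinear map
`Γ(u, v) = ∑ Γ^k_{ij} u^i v^j e_k`, where
`Γ^k_{ij} = 1/2 ∑_l h^{kl} (∂_i h_{jl} + ∂_j h_{il} - ∂_l h_{ij})`. -/
def christoffel (h : Metric n N) (f : OpenPartialHomeomorph N (Eu n)) (x u v : Eu n) : Eu n :=
  ∑ k : Fin n, ∑ l : Fin n,
    ((gramInChart h f x)⁻¹ k l * ((1 / 2 : ℝ) *
      (fderiv ℝ (fun y => metricInChart h f y v (stdVec l)) x u
        + fderiv ℝ (fun y => metricInChart h f y u (stdVec l)) x v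
        - fderiv ℝ (fun y => metricInChart h f y u v) x (stdVec l)))) • stdVec k

/-- The curvature tensor `R(U,V)W = ∇_U ∇_V W - ∇_V ∇_U W - ∇_{[U,V]} W` in the chart `f`, in
terms of Christoffel symbols. -/
def curvatureInChart (h : Metric n N) (f : OpenPartialHomeomorph N (Eu n)) (x u v w : Eu n) :
    Eu n :=
  fderiv ℝ (fun y => christoffel h f y v w) x u - fderiv ℝ (fun y => christoffel h f y u w) x v
    + christoffel h f x u (christoffel h f x v w) - christoffel h f x v (christoffel h f x u w)

/-- The Riemann curvature tensor `R(u, v) w` of `(N, h)` at `y`. -/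
def riemann (h : Metric n N) (y : N) (u v w : Tan n y) : Tan n y :=
  let f := chartAt (Eu n) y
  dChartInv f y (curvatureInChart h f (f y) (dChart f y u) (dChart f y v) (dChart f y w))

/-- The sectional curvature of `(N, h)` at `y`, of the plane spanned by `u` and `v`. -/
def sectionalCurvature (h : Metric n N) (y : N) (u v : Tan n y) : ℝ :=
  h.inner y (riemann h y u v v) u /
    (h.inner y u u * h.inner y v v - h.inner y u v ^ 2)

/-- The basis of `T_p N` formed by the coordinate vectors of the preferred chart at `p`. -/
def frame (p : N) (i : Fin n) : Tan n p := dChartInv (chartAt (Eu n) p) p (stdVec i)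

/-- The matrix of the metric at `p` in the basis `frame p`. -/
def gram (h : Metric n N) (p : N) : Matrix (Fin n) (Fin n) ℝ :=
  Matrix.of fun i j => h.inner p (frame p i) (frame p j)

/-- The trace `∑ h^{ij} b(e_i, e_j)` with respect to the metric of a bilinear map `b` on `T_p N`. -/
def metricTrace (h : Metric n N) (p : N) {W : Type*} [AddCommGroup W] [Module ℝ W]
    (b : Tan n p → Tan n p → W) : W :=
  ∑ i : Fin n, ∑ j : Fin n, (gram h p)⁻¹ i j • b (frame p i) (frame p j)

/-- The vector `v = ∑ h^{ij} ℓ(e_i) e_j` of `T_p N` with `⟨v, w⟩ = ℓ(w)`, for a linear form `ℓ`. -/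
def sharp (h : Metric n N) (p : N) (l : Tan n p → ℝ) : Tan n p :=
  ∑ i : Fin n, ∑ j : Fin n, ((gram h p)⁻¹ i j * l (frame p i)) • frame p j

end OneManifold

section Maps

variable {m n : ℕ} {M N : Type*}
  [TopologicalSpace M] [ChartedSpace (Eu m) M]
  [TopologicalSpace N] [ChartedSpace (Eu n) N]

/-- The differential `dφ_p : T_p M → T_{φ p} N`. -/
def dMap (φ : M → N) (p : M) : Tan m p →L[ℝ] Tan n (φ p) :=
  mfderiv 𝓘(ℝ, Eu m) 𝓘(ℝ, Eu n) φ p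

variable [IsManifold 𝓘(ℝ, Eu n) ∞ N]

/-- The covariant derivative `∇^φ_v V` at `p` of a vector field `V` along `φ : M → N`, for the
pull-back of the Levi-Civita connection of `(N, h)`: in a chart of `N` around `φ p` its components
are `v(V^k) + ∑ Γ^k_{ij} dφ(v)^i V^j`. -/
def covDerivAlong (h : Metric n N) (φ : M → N) (V : ∀ q : M, Tan n (φ q)) (p : M)
    (v : Tan m p) : Tan n (φ p) :=
  let f := chartAt (Eu n) (φ p)
  let Vf : M → Eu n := fun q => dChart f (φ q) (V q)
  dChartInv f (φ p)
    (mvfderiv 𝓘(ℝ, Eu m) Vf p v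
      + christoffel h f (f (φ p)) (dChart f (φ p) (dMap φ p v)) (Vf p))

end Maps

section LeviCivita

variable {m : ℕ} {M : Type*} [TopologicalSpace M] [ChartedSpace (Eu m) M]
  [IsManifold 𝓘(ℝ, Eu m) ∞ M]

/-- The Levi-Civita connection `∇_v V` of `(M, g)` at `p`. -/
def leviCivita (g : Metric m M) (V : ∀ q : M, Tan m q) (p : M) (v : Tan m p) : Tan m p :=
  covDerivAlong g (fun q : M => q) V p v

/-- The covariant derivative `(∇_u S)(v, w)` at `p` of a tensor field `S` of type `(0,2)`:
`(∇_u S)(v, w) = u(S(V, W)) - S(∇_u V, w) - S(v, ∇_u W)` for extensions `V`, `W` of `v`, `w`. -/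
def covDerivTensor (g : Metric m M) (S : ∀ q : M, Tan m q → Tan m q → ℝ) (p : M)
    (u v w : Tan m p) : ℝ :=
  mvfderiv 𝓘(ℝ, Eu m) (fun q => S q (localExt p v q) (localExt p w q)) p u
    - S p (leviCivita g (localExt p v) p u) w - S p v (leviCivita g (localExt p w) p u)

/-- The divergence `(div S)(w) = trace ((u, v) ↦ (∇_u S)(v, w))`. -/
def divTensor (g : Metric m M) (S : ∀ q : M, Tan m q → Tan m q → ℝ) (p : M) (w : Tan m p) : ℝ :=
  metricTrace g p (fun u v => covDerivTensor g S p u v w)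

end LeviCivita

section Submanifolds

variable {m n : ℕ} {M N : Type*}
  [TopologicalSpace M] [ChartedSpace (Eu m) M] [IsManifold 𝓘(ℝ, Eu m) ∞ M]
  [TopologicalSpace N] [ChartedSpace (Eu n) N] [IsManifold 𝓘(ℝ, Eu n) ∞ N]

/-- `φ : (M, g) → (N, h)` is a Riemannian (isometric) immersion. -/
structure IsRiemannianImmersion (g : Metric m M) (h : Metric n N) (φ : M → N) : Prop where
  smooth : ContMDiff 𝓘(ℝ, Eu m) 𝓘(ℝ, Eu n) ∞ φ
  isometric : ∀ (p : M) (v w : Tan m p), h.inner (φ p) (dMap φ p v) (dMap φ p w) = g.inner p v w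

/-- The second fundamental form `B(v, w) = (∇ dφ)(v, w) = ∇^φ_v dφ(W) - dφ(∇_v W)`, where `W`
extends `w`. For a Riemannian immersion this is the second fundamental form of the submanifold. -/
def secondFF (g : Metric m M) (h : Metric n N) (φ : M → N) (p : M) (v w : Tan m p) :
    Tan n (φ p) :=
  covDerivAlong h φ (fun q => dMap φ q (localExt p w q)) p v
    - dMap φ p (leviCivita g (localExt p w) p v)

/-- The tension field `τ(φ) = trace ∇ dφ`. -/
def tension (g : Metric m M) (h : Metric n N) (φ : M → N) (p : M) : Tan n (φ p) :=
  metricTrace g p (secondFF g h φ p)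

/-- The mean curvature vector field `H = (1/m) trace B`. -/
def meanCurvature (g : Metric m M) (h : Metric n N) (φ : M → N) (p : M) : Tan n (φ p) :=
  (1 / (m : ℝ)) • metricTrace g p (secondFF g h φ p)

/-- The mean curvature `|H|`. -/
def meanCurvatureNorm (g : Metric m M) (h : Metric n N) (φ : M → N) (p : M) : ℝ :=
  √(h.inner (φ p) (meanCurvature g h φ p) (meanCurvature g h φ p))

/-- The shape operator `A_H` in the direction of the mean curvature vector field:
`⟨A_H v, w⟩ = ⟨B(v, w), H⟩`. -/
def shapeH (g : Metric m M) (h : Metric n N) (φ : M → N) (p : M) (v : Tan m p) : Tan m p :=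
  sharp g p (fun w => h.inner (φ p) (secondFF g h φ p v w) (meanCurvature g h φ p))

/-- The stress-bienergy tensor
`⟨S₂ X, Y⟩ = 1/2 |τ|² ⟨X, Y⟩ + ⟨dφ, ∇τ⟩ ⟨X, Y⟩ - ⟨dφ X, ∇_Y τ⟩ - ⟨dφ Y, ∇_X τ⟩`. -/
def stressBienergy (g : Metric m M) (h : Metric n N) (φ : M → N) (p : M) (X Y : Tan m p) : ℝ :=
  (1 / 2 : ℝ) * h.inner (φ p) (tension g h φ p) (tension g h φ p) * g.inner p X Y
    + metricTrace g p (fun u v =>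
        h.inner (φ p) (dMap φ p u) (covDerivAlong h φ (tension g h φ) p v)) * g.inner p X Y
    - h.inner (φ p) (dMap φ p X) (covDerivAlong h φ (tension g h φ) p Y)
    - h.inner (φ p) (dMap φ p Y) (covDerivAlong h φ (tension g h φ) p X)

/-- The submanifold is biconservative: `div S₂ = 0`. -/
def IsBiconservative (g : Metric m M) (h : Metric n N) (φ : M → N) : Prop :=
  ∀ (p : M) (w : Tan m p), divTensor g (stressBienergy g h φ) p w = 0

/-- The submanifold is CMC: `|H|` is constant. -/
def IsCMC (g : Metric m M) (h : Metric n N) (φ : M → N) : Prop :=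
  ∃ c : ℝ, ∀ p : M, meanCurvatureNorm g h φ p = c

/-- The point `p` is pseudoumbilical: `A_H = |H|² I` at `p`. -/
def IsPseudoumbilicalAt (g : Metric m M) (h : Metric n N) (φ : M → N) (p : M) : Prop :=
  ∀ v : Tan m p, shapeH g h φ p v = (meanCurvatureNorm g h φ p ^ 2) • v

/-- The set of principal curvatures at `p`, that is, of eigenvalues of `A_H`. -/
def principalCurvatures (g : Metric m M) (h : Metric n N) (φ : M → N) (p : M) : Set ℝ :=
  {t | ∃ v : Tan m p, v ≠ 0 ∧ shapeH g h φ p v = t • v}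

/-- The largest principal curvature `λ₁`. -/
def maxPrincipalCurvature (g : Metric m M) (h : Metric n N) (φ : M → N) (p : M) : ℝ :=
  sSup (principalCurvatures g h φ p)

/-- The smallest principal curvature `λ₂` (of a surface). -/
def minPrincipalCurvature (g : Metric m M) (h : Metric n N) (φ : M → N) (p : M) : ℝ :=
  sInf (principalCurvatures g h φ p)

/-- The difference `μ = λ₁ - λ₂` of the principal curvatures of a surface. -/
def principalGap (g : Metric m M) (h : Metric n N) (φ : M → N) (p : M) : ℝ :=
  maxPrincipalCurvature g h φ p - minPrincipalCurvature g h φ p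

/-- The coordinate chart `e` is isothermal: on its domain the metric is a positive multiple of the
Euclidean one. -/
def IsIsothermal (g : Metric m M) (e : OpenPartialHomeomorph M (Eu m)) : Prop :=
  ∃ c : M → ℝ, ∀ q ∈ e.source, 0 < c q ∧
    ∀ v w : Tan m q, g.inner q v w = c q * inner ℝ (dChart e q v) (dChart e q w)

/-- The coordinate chart `e` is a line of curvature coordinate system for `A_H`: the coordinate
vectors are orthogonal and are eigenvectors of `A_H`. -/
def IsLineOfCurvature (g : Metric m M) (h : Metric n N) (φ : M → N)
    (e : OpenPartialHomeomorph M (Eu m)) : Prop :=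
  ∀ q ∈ e.source,
    (∀ i j : Fin m, i ≠ j → g.inner q (dChartInv e q (stdVec i)) (dChartInv e q (stdVec j)) = 0) ∧
    ∀ i : Fin m, ∃ t : ℝ,
      shapeH g h φ q (dChartInv e q (stdVec i)) = t • dChartInv e q (stdVec i)

end Submanifolds

end RiemSub

end

open RiemSub

open Bundle Manifold
open scoped ContDiff
open RiemSub

noncomputable section

namespace RiemSub

section Shortcuts

variable {A B C : Type*} [NormedAddCommGroup A] [NormedSpace ℝ A]
  [NormedAddCommGroup B] [NormedSpace ℝ B] [NormedAddCommGroup C] [NormedSpace ℝ C]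

/-! Put c = |H| and let A be the trace-free symmetric form ⟨A_H ·, ·⟩ - c² g. Since τ = 2H is
normal, Weingarten's formula turns the stress-bienergy tensor into 4⟨A_H ·, ·⟩ - 2c² g = 4A + 2c² g
(`stressBienergy_eq`). As g is parallel and c is constant, biconservativity becomes div A = 0
(`div_devForm_eq_zero`). On a surface, a trace-free divergence-free symmetric tensor is the real
part of a holomorphic quadratic differential, and the coordinates sought are those in which A =
Re(dz²)/2.

The proof carries this out in real terms. Where A ≠ 0 its eigenvalues with respect to g are ±μ/2, so
(μ/2)g + A and (μ/2)g - A have rank one and positive trace. They are therefore squares of smooth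
one-forms: μ g = ω₁² + ω₂² and 2A = ω₁² - ω₂² (`exists_coframe`). In the frame dual to ω₁, ω₂ the
two components of div A are dω₁ and dω₂, the derivatives of μ dropping out
(`coframe_closed_of_div_eq_zero`, `coframe_closed`). The Poincaré lemma and the inverse function
theorem give coordinates with dx = ω₁ and dy = ω₂ (`exists_coordinates_of_closed`,
`exists_isothermal_chart`). The formulas for g and A_H, and the fact that μ is the gap of the
eigenvalues, are then read off (`IsDiagonalAt`).

For n = 3 the remaining equation is the Gauss equation. The metric μ⁻¹(dx² + dy²) has curvature
(μ(μ_xx + μ_yy) - |∇μ|²)/(2μ) (`curvature_conformal`). The normal space is the line spanned by H, so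
B is determined by A_H (`inner_secondFF_secondFF`), and the extrinsic term is det A_H / c² = c² -
μ²/(4c²). Both enter through `gauss_equation`.

The geometric objects are defined in preferred charts that vary with the point, so they must first
be made computable in any chart. The tool is the transformation law of the Koszul expression under
pull-back (`koszul_pullForm`). Applied to the immersion, it shows that B is normal
(`sffForm_normal`). Applied to the identity map, it gives the transformation law of the Christoffel
symbols (`hessAlong_rep_id`), hence the tensoriality of B. -/

instance instNormedAddCommGroupBilin : NormedAddCommGroup (A →L[ℝ] B →L[ℝ] C) :=
  ContinuousLinearMap.toNormedAddCommGroup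

instance instNormedSpaceBilin : NormedSpace ℝ (A →L[ℝ] B →L[ℝ] C) :=
  ContinuousLinearMap.toNormedSpace

end Shortcuts

/-! ### Koszul expressions of metrics on normed spaces and their pull-backs. -/

section Euclidean

variable {E F : Type*} [NormedAddCommGroup E] [NormedSpace ℝ E]
  [NormedAddCommGroup F] [NormedSpace ℝ F]

/-- The Koszul expression (Christoffel symbols of the first kind) of a field of bilinear forms. -/
def koszul (G : E → E →L[ℝ] E →L[ℝ] ℝ) (x u v w : E) : ℝ :=
  (1 / 2 : ℝ) * (fderiv ℝ G x u v w + fderiv ℝ G x v u w - fderiv ℝ G x w u v)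

/-- The pull-back of a field of bilinear forms. -/
def pullForm (G : F → F →L[ℝ] F →L[ℝ] ℝ) (ψ : E → F) (x : E) : E →L[ℝ] E →L[ℝ] ℝ :=
  (G (ψ x)).bilinearComp (fderiv ℝ ψ x) (fderiv ℝ ψ x)

@[simp] lemma pullForm_apply (G : F → F →L[ℝ] F →L[ℝ] ℝ) (ψ : E → F) (x u v : E) :
    pullForm G ψ x u v = G (ψ x) (fderiv ℝ ψ x u) (fderiv ℝ ψ x v) := rfl

lemma differentiableAt_comp_and_fderiv {A B C : Type*} [NormedAddCommGroup A] [NormedSpace ℝ A]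
    [NormedAddCommGroup B] [NormedSpace ℝ B] [NormedAddCommGroup C] [NormedSpace ℝ C]
    {g : B → C} {f : A → B} {x : A} (hg : DifferentiableAt ℝ g (f x)) (hf : DifferentiableAt ℝ f x) :
    DifferentiableAt ℝ (fun y => g (f y)) x ∧
      ∀ u, fderiv ℝ (fun y => g (f y)) x u = fderiv ℝ g (f x) (fderiv ℝ f x u) := by
  refine ⟨hg.comp x hf, fun u => ?_⟩
  have := fderiv_comp x hg hf
  rw [show (fun y => g (f y)) = g ∘ f from rfl, this]
  rfl

lemma fderiv_fderiv_apply_const {ψ : E → F} {x : E} (hdd : DifferentiableAt ℝ (fderiv ℝ ψ) x)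
    (u v : E) : fderiv ℝ (fun y => fderiv ℝ ψ y v) x u = fderiv ℝ (fderiv ℝ ψ) x u v := by
  rw [fderiv_clm_apply hdd (differentiableAt_const v)]
  simp

lemma fderiv_clm_apply₂ {G : E → F →L[ℝ] F →L[ℝ] ℝ} {x : E} (hG : DifferentiableAt ℝ G x)
    {a b : E → F} (ha : DifferentiableAt ℝ a x) (hb : DifferentiableAt ℝ b x) (u : E) :
    fderiv ℝ (fun y => G y (a y) (b y)) x u
      = fderiv ℝ G x u (a x) (b x) + G x (fderiv ℝ a x u) (b x) + G x (a x) (fderiv ℝ b x u) := by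
  rw [fderiv_clm_apply (hG.clm_apply ha) hb, fderiv_clm_apply hG ha]
  simp only [add_apply, ContinuousLinearMap.comp_apply,
    ContinuousLinearMap.flip_apply]
  ring

lemma fderiv_clm_const_apply₂ {G : E → F →L[ℝ] F →L[ℝ] ℝ} {x : E} (hG : DifferentiableAt ℝ G x)
    (a b : F) (u : E) :
    fderiv ℝ (fun y => G y a b) x u = fderiv ℝ G x u a b := by
  rw [fderiv_clm_apply₂ hG (differentiableAt_const a) (differentiableAt_const b)]
  simp

lemma fderiv_clm_apply₂' {H : Type*} [NormedAddCommGroup H] [NormedSpace ℝ H]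
    {G : E → F →L[ℝ] F →L[ℝ] H} {x : E} (hG : DifferentiableAt ℝ G x)
    {a b : E → F} (ha : DifferentiableAt ℝ a x) (hb : DifferentiableAt ℝ b x) (u : E) :
    fderiv ℝ (fun y => G y (a y) (b y)) x u
      = fderiv ℝ G x u (a x) (b x) + G x (fderiv ℝ a x u) (b x) + G x (a x) (fderiv ℝ b x u) := by
  rw [fderiv_clm_apply (hG.clm_apply ha) hb, fderiv_clm_apply hG ha]
  simp only [add_apply, ContinuousLinearMap.comp_apply,
    ContinuousLinearMap.flip_apply]
  abel

lemma fderiv_form_symm {G : E → F →L[ℝ] F →L[ℝ] ℝ} {x : E} (hG : DifferentiableAt ℝ G x)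
    (hs : ∀ᶠ y in nhds x, ∀ a b, G y a b = G y b a) (u : E) (a b : F) :
    fderiv ℝ G x u a b = fderiv ℝ G x u b a := by
  rw [← fderiv_clm_const_apply₂ hG, ← fderiv_clm_const_apply₂ hG]
  have : (fun y => G y a b) =ᶠ[nhds x] fun y => G y b a := hs.mono fun y hy => hy a b
  rw [this.fderiv_eq]

/-- Metric compatibility of the Koszul expression. -/
lemma koszul_add_koszul {G : E → E →L[ℝ] E →L[ℝ] ℝ} {x : E} (hG : DifferentiableAt ℝ G x)
    (hs : ∀ᶠ y in nhds x, ∀ a b, G y a b = G y b a) (u v w : E) :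
    koszul G x u v w + koszul G x u w v = fderiv ℝ G x u v w := by
  have h1 := fderiv_form_symm hG hs u v w
  have h2 := fderiv_form_symm hG hs v u w
  have h3 := fderiv_form_symm hG hs w u v
  unfold koszul
  linarith

lemma koszul_symm {G : E → E →L[ℝ] E →L[ℝ] ℝ} {x : E} (hG : DifferentiableAt ℝ G x)
    (hs : ∀ᶠ y in nhds x, ∀ a b, G y a b = G y b a) (u v w : E) :
    koszul G x u v w = koszul G x v u w := by
  have h3 := fderiv_form_symm hG hs w u v
  unfold koszul
  linarith

set_option synthInstance.maxHeartbeats 400000 in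
lemma fderiv_pullForm {G : F → F →L[ℝ] F →L[ℝ] ℝ} {ψ : E → F} {x : E}
    (hψ : ContDiffAt ℝ 2 ψ x) (hG : DifferentiableAt ℝ G (ψ x)) (u v w : E) :
    fderiv ℝ (pullForm G ψ) x u v w
      = fderiv ℝ G (ψ x) (fderiv ℝ ψ x u) (fderiv ℝ ψ x v) (fderiv ℝ ψ x w)
        + G (ψ x) (fderiv ℝ (fderiv ℝ ψ) x u v) (fderiv ℝ ψ x w)
        + G (ψ x) (fderiv ℝ ψ x v) (fderiv ℝ (fderiv ℝ ψ) x u w) := by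
  have hd : DifferentiableAt ℝ ψ x := hψ.differentiableAt (by simp)
  have hdd : DifferentiableAt ℝ (fderiv ℝ ψ) x :=
    (hψ.fderiv_right (m := 1) (by norm_num)).differentiableAt (by simp)
  have hGψ : DifferentiableAt ℝ (fun y => G (ψ y)) x := (differentiableAt_comp_and_fderiv (C := F →L[ℝ] F →L[ℝ] ℝ) hG hd).1
  have hp : DifferentiableAt ℝ (pullForm G ψ) x := by
    unfold pullForm
    -- Writing the pull-back as a composite of linear maps makes its differentiability an instance
    -- of the rule for `comp`.
    have : (fun y => (G (ψ y)).bilinearComp (fderiv ℝ ψ y) (fderiv ℝ ψ y))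
        = fun y => (((ContinuousLinearMap.compL ℝ E F ℝ).flip (fderiv ℝ ψ y)).comp
            ((G (ψ y)).comp (fderiv ℝ ψ y))) := by
      ext y a b; rfl
    rw [this]
    exact (differentiableAt_comp_and_fderiv
      ((ContinuousLinearMap.compL ℝ E F ℝ).flip.differentiableAt) hdd).1.clm_comp
      (hGψ.clm_comp hdd)
  rw [← fderiv_clm_const_apply₂ hp]
  simp only [pullForm_apply]
  rw [fderiv_clm_apply₂ hGψ (hdd.clm_apply (differentiableAt_const v))
    (hdd.clm_apply (differentiableAt_const w))]
  have h1 : fderiv ℝ (fun y => G (ψ y)) x u = fderiv ℝ G (ψ x) (fderiv ℝ ψ x u) := by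
    exact (differentiableAt_comp_and_fderiv (C := F →L[ℝ] F →L[ℝ] ℝ) hG hd).2 u
  have h2 : ∀ v, fderiv ℝ (fun y => fderiv ℝ ψ y v) x u = fderiv ℝ (fderiv ℝ ψ) x u v := by
    intro v
    rw [fderiv_clm_apply hdd (differentiableAt_const v)]
    simp
  rw [h1, h2, h2]

/-- The Koszul expression of a pulled back form. -/
lemma koszul_pullForm {G : F → F →L[ℝ] F →L[ℝ] ℝ} {ψ : E → F} {x : E}
    (hψ : ContDiffAt ℝ 2 ψ x) (hG : DifferentiableAt ℝ G (ψ x))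
    (hs : ∀ a b, G (ψ x) a b = G (ψ x) b a) (u v w : E) :
    koszul (pullForm G ψ) x u v w
      = koszul G (ψ x) (fderiv ℝ ψ x u) (fderiv ℝ ψ x v) (fderiv ℝ ψ x w)
        + G (ψ x) (fderiv ℝ (fderiv ℝ ψ) x u v) (fderiv ℝ ψ x w) := by
  -- The three derivatives of the pull-back contribute six terms containing D²ψ. By the symmetry of
  -- D²ψ and of G, four of them cancel and the other two coincide, which absorbs the factor 1/2.
  have hsym : IsSymmSndFDerivAt ℝ ψ x := hψ.isSymmSndFDerivAt (by simp)
  unfold koszul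
  rw [fderiv_pullForm hψ hG, fderiv_pullForm hψ hG, fderiv_pullForm hψ hG,
    hsym.eq v u, hsym.eq w u, hsym.eq w v, hs (fderiv ℝ ψ x v), hs (fderiv ℝ ψ x u)]
  ring

end Euclidean

/-! ### Curvature of Christoffel symbols along a map. -/

section Gauss

variable {E F : Type*} [NormedAddCommGroup E] [NormedSpace ℝ E]
  [NormedAddCommGroup F] [NormedSpace ℝ F]

/-- The covariant derivative `∇_v ∂_w` along `ψ` of the coordinate field `∂_w`, in terms of
Christoffel symbols `Γ`. -/
def hessAlong (Γ : F → F →L[ℝ] F →L[ℝ] F) (ψ : E → F) (x v w : E) : F :=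
  fderiv ℝ (fderiv ℝ ψ) x v w + Γ (ψ x) (fderiv ℝ ψ x v) (fderiv ℝ ψ x w)

/-- The curvature of Christoffel symbols `Γ`. -/
def curvOf (Γ : F → F →L[ℝ] F →L[ℝ] F) (y u v w : F) : F :=
  fderiv ℝ Γ y u v w - fderiv ℝ Γ y v u w + Γ y u (Γ y v w) - Γ y v (Γ y u w)

lemma fderiv_hessAlong {Γ : F → F →L[ℝ] F →L[ℝ] F} {ψ : E → F} {x : E}
    (hψ : ContDiffAt ℝ 3 ψ x) (hΓ : DifferentiableAt ℝ Γ (ψ x)) (u v w : E) :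
    DifferentiableAt ℝ (fun y => hessAlong Γ ψ y v w) x ∧
    fderiv ℝ (fun y => hessAlong Γ ψ y v w) x u
      = fderiv ℝ (fderiv ℝ (fderiv ℝ ψ)) x u v w
        + (fderiv ℝ Γ (ψ x) (fderiv ℝ ψ x u) (fderiv ℝ ψ x v) (fderiv ℝ ψ x w)
        + Γ (ψ x) (fderiv ℝ (fderiv ℝ ψ) x u v) (fderiv ℝ ψ x w)
        + Γ (ψ x) (fderiv ℝ ψ x v) (fderiv ℝ (fderiv ℝ ψ) x u w)) := by
  have hd : DifferentiableAt ℝ ψ x := hψ.differentiableAt (by simp)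
  have h1 : ContDiffAt ℝ 2 (fderiv ℝ ψ) x := hψ.fderiv_right (by norm_num)
  have hdd : DifferentiableAt ℝ (fderiv ℝ ψ) x := h1.differentiableAt (by simp)
  have hddd : DifferentiableAt ℝ (fderiv ℝ (fderiv ℝ ψ)) x :=
    (h1.fderiv_right (m := 1) (by norm_num)).differentiableAt (by simp)
  have hΓψ : DifferentiableAt ℝ (fun y => Γ (ψ y)) x := (differentiableAt_comp_and_fderiv (C := F →L[ℝ] F →L[ℝ] F) hΓ hd).1
  have e1 : fderiv ℝ (fun y => Γ (ψ y)) x u = fderiv ℝ Γ (ψ x) (fderiv ℝ ψ x u) := by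
    exact (differentiableAt_comp_and_fderiv (C := F →L[ℝ] F →L[ℝ] F) hΓ hd).2 u
  have e2 : ∀ v, fderiv ℝ (fun y => fderiv ℝ ψ y v) x u = fderiv ℝ (fderiv ℝ ψ) x u v := by
    intro v
    rw [fderiv_clm_apply hdd (differentiableAt_const v)]
    simp
  have c1 : DifferentiableAt ℝ (fun y => fderiv ℝ (fderiv ℝ ψ) y v w) x :=
    (hddd.clm_apply (differentiableAt_const v)).clm_apply (differentiableAt_const w)
  have c2 : DifferentiableAt ℝ (fun y => Γ (ψ y) (fderiv ℝ ψ y v) (fderiv ℝ ψ y w)) x :=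
    (hΓψ.clm_apply (hdd.clm_apply (differentiableAt_const v))).clm_apply
      (hdd.clm_apply (differentiableAt_const w))
  refine ⟨c1.add c2, ?_⟩
  unfold hessAlong
  rw [fderiv_fun_add c1 c2, add_apply,
    fderiv_clm_apply₂' hΓψ (hdd.clm_apply (differentiableAt_const v))
      (hdd.clm_apply (differentiableAt_const w)),
    fderiv_clm_apply₂' hddd (differentiableAt_const v) (differentiableAt_const w), e1, e2, e2]
  simp

/-- The Gauss equation along a map `ψ`: the curvature of the target in terms of the covariant
derivatives of the coordinate fields. -/
lemma gauss_along {G : F → F →L[ℝ] F →L[ℝ] ℝ} {Γ : F → F →L[ℝ] F →L[ℝ] F} {ψ : E → F} {x : E}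
    (hψ : ContDiffAt ℝ 3 ψ x) (hΓ : DifferentiableAt ℝ Γ (ψ x)) (hG : DifferentiableAt ℝ G (ψ x))
    (hΓs : ∀ a b, Γ (ψ x) a b = Γ (ψ x) b a)
    (hGs : ∀ a b, G (ψ x) a b = G (ψ x) b a)
    (hc : ∀ a b c, fderiv ℝ G (ψ x) a b c = G (ψ x) (Γ (ψ x) a b) c + G (ψ x) b (Γ (ψ x) a c))
    (u v : E) :
    G (ψ x) (curvOf Γ (ψ x) (fderiv ℝ ψ x u) (fderiv ℝ ψ x v) (fderiv ℝ ψ x v)) (fderiv ℝ ψ x u)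
      = fderiv ℝ (fun y => G (ψ y) (hessAlong Γ ψ y v v) (fderiv ℝ ψ y u)) x u
        - fderiv ℝ (fun y => G (ψ y) (hessAlong Γ ψ y u v) (fderiv ℝ ψ y u)) x v
        - G (ψ x) (hessAlong Γ ψ x v v) (hessAlong Γ ψ x u u)
        + G (ψ x) (hessAlong Γ ψ x u v) (hessAlong Γ ψ x u v) := by
  have hd : DifferentiableAt ℝ ψ x := hψ.differentiableAt (by simp)
  have h1 : ContDiffAt ℝ 2 (fderiv ℝ ψ) x := hψ.fderiv_right (by norm_num)
  have hdd : DifferentiableAt ℝ (fderiv ℝ ψ) x := h1.differentiableAt (by simp)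
  have hGψ : DifferentiableAt ℝ (fun y => G (ψ y)) x := (differentiableAt_comp_and_fderiv (C := F →L[ℝ] F →L[ℝ] ℝ) hG hd).1
  have hsym : IsSymmSndFDerivAt ℝ ψ x := (hψ.of_le (m := 2) (by norm_num)).isSymmSndFDerivAt (by simp)
  -- By metric compatibility the two differentiated inner products expand to ⟨∇_u∇_v ∂_v - ∇_v∇_u
  -- ∂_v, ∂_u⟩ plus products of first covariant derivatives. The third derivatives of ψ cancel by
  -- this symmetry, and the rest of the commutator is the curvature.
  have hsym3 : fderiv ℝ (fderiv ℝ (fderiv ℝ ψ)) x u v v = fderiv ℝ (fderiv ℝ (fderiv ℝ ψ)) x v u v := by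
    have : IsSymmSndFDerivAt ℝ (fderiv ℝ ψ) x := h1.isSymmSndFDerivAt (by simp)
    rw [this.eq]
  have e1 : ∀ u, fderiv ℝ (fun y => G (ψ y)) x u = fderiv ℝ G (ψ x) (fderiv ℝ ψ x u) := by
    intro u
    exact (differentiableAt_comp_and_fderiv (C := F →L[ℝ] F →L[ℝ] ℝ) hG hd).2 u
  have e2 : ∀ u v, fderiv ℝ (fun y => fderiv ℝ ψ y v) x u = fderiv ℝ (fderiv ℝ ψ) x u v := by
    intro u v
    rw [fderiv_clm_apply hdd (differentiableAt_const v)]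
    simp
  rw [fderiv_clm_apply₂ hGψ (fderiv_hessAlong hψ hΓ u v v).1
      (hdd.clm_apply (differentiableAt_const u)),
    fderiv_clm_apply₂ hGψ (fderiv_hessAlong hψ hΓ v u v).1
      (hdd.clm_apply (differentiableAt_const u)), e1, e1, e2, e2, hc, hc,
    (fderiv_hessAlong hψ hΓ u v v).2, (fderiv_hessAlong hψ hΓ v u v).2]
  have s1 := hsym.eq v u
  have s2 := hΓs (fderiv ℝ ψ x v) (fderiv ℝ ψ x u)
  have s3 := hΓs (fderiv ℝ (fderiv ℝ ψ) x u v) (fderiv ℝ ψ x v)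
  simp only [curvOf, hessAlong, hsym3, s1, s2, s3, map_add, map_sub, add_apply,
    sub_apply]
  have t1 := hGs (Γ (ψ x) (fderiv ℝ ψ x u) (fderiv ℝ ψ x u))
  ring

end Gauss

/-! ### Differentials of smooth charts. -/

section Charts

variable {n : ℕ} {N : Type*} [TopologicalSpace N] [ChartedSpace (Eu n) N]

/-- The smooth charts of a manifold. -/
abbrev Atl (n : ℕ) (N : Type*) [TopologicalSpace N] [ChartedSpace (Eu n) N] :
    Set (OpenPartialHomeomorph N (Eu n)) :=
  IsManifold.maximalAtlas 𝓘(ℝ, Eu n) ∞ N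

lemma chartAt_mem_atl [IsManifold 𝓘(ℝ, Eu n) ∞ N] (p : N) : chartAt (Eu n) p ∈ Atl n N :=
  IsManifold.chart_mem_maximalAtlas p

lemma mdifferentiable_of_mem_atl {e : OpenPartialHomeomorph N (Eu n)} (he : e ∈ Atl n N) :
    e.MDifferentiable 𝓘(ℝ, Eu n) 𝓘(ℝ, Eu n) :=
  ⟨(contMDiffOn_of_mem_maximalAtlas he).mdifferentiableOn (by simp),
    (contMDiffOn_symm_of_mem_maximalAtlas he).mdifferentiableOn (by simp)⟩

lemma dChartInv_eq {e : OpenPartialHomeomorph N (Eu n)} (he : e ∈ Atl n N) {q : N}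
    (hq : q ∈ e.source) :
    dChartInv e q = mfderiv 𝓘(ℝ, Eu n) 𝓘(ℝ, Eu n) e.symm (e q) := by
  have h := mdifferentiable_of_mem_atl he
  exact ContinuousLinearMap.inverse_equiv (h.mfderiv hq)

@[simp] lemma dChart_dChartInv {e : OpenPartialHomeomorph N (Eu n)} (he : e ∈ Atl n N) {q : N}
    (hq : q ∈ e.source) (v : Eu n) : dChart e q (dChartInv e q v) = v := by
  have h := mdifferentiable_of_mem_atl he
  rw [dChartInv_eq he hq]
  have := (h.mfderiv hq).apply_symm_apply v
  exact this

@[simp] lemma dChartInv_dChart {e : OpenPartialHomeomorph N (Eu n)} (he : e ∈ Atl n N) {q : N}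
    (hq : q ∈ e.source) (v : Tan n q) : dChartInv e q (dChart e q v) = v := by
  have h := mdifferentiable_of_mem_atl he
  rw [dChartInv_eq he hq]
  have := (h.mfderiv hq).symm_apply_apply v
  exact this

lemma dChartInv_injective {e : OpenPartialHomeomorph N (Eu n)} (he : e ∈ Atl n N) {q : N}
    (hq : q ∈ e.source) : Function.Injective (dChartInv e q) :=
  Function.LeftInverse.injective (dChart_dChartInv he hq)

lemma dChart_injective {e : OpenPartialHomeomorph N (Eu n)} (he : e ∈ Atl n N) {q : N}
    (hq : q ∈ e.source) : Function.Injective (dChart e q) :=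
  Function.LeftInverse.injective (dChartInv_dChart he hq)

/-- The derivative of a function on a manifold, in a chart. -/
lemma mvfderiv_eq_of_eventuallyEq {F : Type*} [NormedAddCommGroup F] [NormedSpace ℝ F]
    {e : OpenPartialHomeomorph N (Eu n)} (he : e ∈ Atl n N) {q : N} (hq : q ∈ e.source)
    {V : N → F} {W : Eu n → F} (hV : ∀ᶠ y in nhds q, V y = W (e y))
    (hW : DifferentiableAt ℝ W (e q)) (v : Tan n q) :
    mvfderiv 𝓘(ℝ, Eu n) V q v = fderiv ℝ W (e q) (dChart e q v) := by
  have h := mdifferentiable_of_mem_atl he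
  have h1 : V =ᶠ[nhds q] (W ∘ e) := hV
  have h2 : mfderiv 𝓘(ℝ, Eu n) 𝓘(ℝ, F) V q = mfderiv 𝓘(ℝ, Eu n) 𝓘(ℝ, F) (W ∘ e) q :=
    h1.mfderiv_eq
  have h3 : mfderiv 𝓘(ℝ, Eu n) 𝓘(ℝ, F) (W ∘ e) q
      = (mfderiv 𝓘(ℝ, Eu n) 𝓘(ℝ, F) W (e q)).comp (dChart e q) :=
    mfderiv_comp q hW.mdifferentiableAt (h.mdifferentiableAt hq)
  have h4 : mvfderiv 𝓘(ℝ, Eu n) V q v = (mfderiv 𝓘(ℝ, Eu n) 𝓘(ℝ, F) V q v : F) := rfl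
  rw [h4, h2]
  have h5 := congrArg (fun L => L v) h3
  refine Eq.trans h5 ?_
  rw [mfderiv_eq_fderiv]
  rfl

end Charts

/-! ### Maps between manifolds read in charts. -/

section Rep

variable {m n : ℕ} {M N : Type*}
  [TopologicalSpace M] [ChartedSpace (Eu m) M]
  [TopologicalSpace N] [ChartedSpace (Eu n) N]

/-- The map `φ` read in the charts `e` and `f`. -/
def rep (φ : M → N) (e : OpenPartialHomeomorph M (Eu m)) (f : OpenPartialHomeomorph N (Eu n))
    (x : Eu m) : Eu n := f (φ (e.symm x))

lemma contDiffAt_rep {φ : M → N} (hφ : ContMDiff 𝓘(ℝ, Eu m) 𝓘(ℝ, Eu n) ∞ φ)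
    {e : OpenPartialHomeomorph M (Eu m)} (he : e ∈ Atl m M)
    {f : OpenPartialHomeomorph N (Eu n)} (hf : f ∈ Atl n N) {x : Eu m} (hx : x ∈ e.target)
    (hfx : φ (e.symm x) ∈ f.source) : ContDiffAt ℝ ∞ (rep φ e f) x := by
  rw [← contMDiffAt_iff_contDiffAt]
  have h1 : ContMDiffAt 𝓘(ℝ, Eu m) 𝓘(ℝ, Eu m) ∞ e.symm x :=
    (contMDiffOn_symm_of_mem_maximalAtlas he).contMDiffAt (e.open_target.mem_nhds hx)
  have h2 : ContMDiffAt 𝓘(ℝ, Eu n) 𝓘(ℝ, Eu n) ∞ f (φ (e.symm x)) :=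
    (contMDiffOn_of_mem_maximalAtlas hf).contMDiffAt (f.open_source.mem_nhds hfx)
  exact (h2.comp (e.symm x) hφ.contMDiffAt).comp x h1

lemma fderiv_rep {φ : M → N} (hφ : ContMDiff 𝓘(ℝ, Eu m) 𝓘(ℝ, Eu n) ∞ φ)
    {e : OpenPartialHomeomorph M (Eu m)} (he : e ∈ Atl m M)
    {f : OpenPartialHomeomorph N (Eu n)} (hf : f ∈ Atl n N) {q : M} (hq : q ∈ e.source)
    (hfq : φ q ∈ f.source) (v : Eu m) :
    fderiv ℝ (rep φ e f) (e q) v = dChart f (φ q) (dMap φ q (dChartInv e q v)) := by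
  have h1 : MDifferentiableAt 𝓘(ℝ, Eu m) 𝓘(ℝ, Eu m) e.symm (e q) :=
    (mdifferentiable_of_mem_atl he).mdifferentiableAt_symm (e.map_source hq)
  have h2 : MDifferentiableAt 𝓘(ℝ, Eu n) 𝓘(ℝ, Eu n) f (φ q) :=
    (mdifferentiable_of_mem_atl hf).mdifferentiableAt hfq
  have h3 : MDifferentiableAt 𝓘(ℝ, Eu m) 𝓘(ℝ, Eu n) φ q := hφ.mdifferentiableAt (by simp)
  have h1' : HasMFDerivAt 𝓘(ℝ, Eu m) 𝓘(ℝ, Eu m) e.symm (e q) (dChartInv e q) := by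
    rw [dChartInv_eq he hq]; exact h1.hasMFDerivAt
  have hs : e.symm (e q) = q := e.left_inv hq
  have h3' : HasMFDerivAt 𝓘(ℝ, Eu m) 𝓘(ℝ, Eu n) φ (e.symm (e q)) (dMap φ q) := by
    have := h3.hasMFDerivAt
    rw [hs]; exact this
  have h2' : HasMFDerivAt 𝓘(ℝ, Eu n) 𝓘(ℝ, Eu n) f (φ (e.symm (e q))) (dChart f (φ q)) := by
    have := h2.hasMFDerivAt
    rw [hs]; exact this
  have h4 := (h2'.comp (e q) (h3'.comp (e q) h1'))
  have h5 := h4.mfderiv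
  rw [mfderiv_eq_fderiv] at h5
  exact congrArg (fun L => L v) h5

omit [ChartedSpace (Eu m) M] [ChartedSpace (Eu n) N] in
lemma rep_nhds {φ : M → N} (hφ : Continuous φ) {e : OpenPartialHomeomorph M (Eu m)}
    {f : OpenPartialHomeomorph N (Eu n)} {q : M} (hq : q ∈ e.source) (hfq : φ q ∈ f.source) :
    ∀ᶠ x in nhds (e q), x ∈ e.target ∧ φ (e.symm x) ∈ f.source := by
  have h1 : e.target ∈ nhds (e q) := e.open_target.mem_nhds (e.map_source hq)
  have h2 : ContinuousAt e.symm (e q) := e.continuousAt_symm (e.map_source hq)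
  have h3 : ContinuousAt (fun x => φ (e.symm x)) (e q) := hφ.continuousAt.comp h2
  have h4 : f.source ∈ nhds (φ (e.symm (e q))) := by
    rw [e.left_inv hq]; exact f.open_source.mem_nhds hfq
  exact Filter.Eventually.and h1 (h3 h4)

end Rep

/-! ### The metric in a chart as a smooth field of bilinear forms. -/

section MetricChart

variable {n : ℕ} {N : Type*} [TopologicalSpace N] [ChartedSpace (Eu n) N]

/-- The continuous bilinear map with the same values as `b` on the standard basis. -/
def bilinOf {F : Type*} [NormedAddCommGroup F] [NormedSpace ℝ F] (b : Eu n → Eu n → F) :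
    Eu n →L[ℝ] Eu n →L[ℝ] F :=
  ∑ i : Fin n, ∑ j : Fin n, (EuclideanSpace.proj i : Eu n →L[ℝ] ℝ).smulRight
    ((EuclideanSpace.proj j : Eu n →L[ℝ] ℝ).smulRight (b (stdVec i) (stdVec j)))

lemma sum_stdVec (v : Eu n) : ∑ i, v i • (stdVec i : Eu n) = v := by
  have := (EuclideanSpace.basisFun (Fin n) ℝ).sum_repr v
  simpa [stdVec] using this

lemma bilinOf_apply' {F : Type*} [NormedAddCommGroup F] [NormedSpace ℝ F]
    (b : Eu n → Eu n → F) (u v : Eu n) :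
    bilinOf b u v = ∑ i, ∑ j, (u i * v j) • b (stdVec i) (stdVec j) := by
  simp [bilinOf, smul_smul]

/-- `bilinOf` makes sense for an arbitrary function, and its smoothness in a parameter only involves
finitely many coefficients. Bilinearity is needed only here, to recover the original values. -/
lemma bilinOf_apply {F : Type*} [NormedAddCommGroup F] [NormedSpace ℝ F]
    (b : Eu n →ₗ[ℝ] Eu n →ₗ[ℝ] F) (u v : Eu n) : bilinOf (fun u v => b u v) u v = b u v := by
  rw [bilinOf_apply']
  conv_rhs => rw [← sum_stdVec u, ← sum_stdVec v]
  simp only [map_sum, LinearMap.sum_apply, map_smul, LinearMap.smul_apply, smul_smul,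
    Finset.smul_sum]
  rw [Finset.sum_comm]
  exact Finset.sum_congr rfl fun i _ => Finset.sum_congr rfl fun j _ => by rw [mul_comm]

lemma contDiffOn_bilinOf {E F : Type*} [NormedAddCommGroup E] [NormedSpace ℝ E]
    [NormedAddCommGroup F] [NormedSpace ℝ F] {b : E → Eu n → Eu n → F} {s : Set E} {k : ℕ∞ω}
    (h : ∀ i j, ContDiffOn ℝ k (fun x => b x (stdVec i) (stdVec j)) s) :
    ContDiffOn ℝ k (fun x => bilinOf (b x)) s := by
  unfold bilinOf
  refine ContDiffOn.sum fun i _ => ContDiffOn.sum fun j _ => ?_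
  exact contDiffOn_const.smulRight (contDiffOn_const.smulRight (h i j))

variable [IsManifold 𝓘(ℝ, Eu n) ∞ N]

/-- The field x ↦ `dChartInv f (f.symm x) v` is the tangent map of `f.symm` applied to a constant
section, hence smooth. Two such fields are then fed into the smooth section `h` of the bundle of
bilinear forms. -/
lemma contDiffOn_metricInChart (h : Metric n N) {f : OpenPartialHomeomorph N (Eu n)}
    (hf : f ∈ Atl n N) (v w : Eu n) :
    ContDiffOn ℝ ∞ (fun x => metricInChart h f x v w) f.target := by
  have key : ∀ v : Eu n, ContMDiffOn 𝓘(ℝ, Eu n) (𝓘(ℝ, Eu n).prod 𝓘(ℝ, Eu n)) ∞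
      (fun x : Eu n => (TotalSpace.mk' (Eu n) (f.symm x) (dChartInv f (f.symm x) v) :
        TangentBundle 𝓘(ℝ, Eu n) N)) f.target := by
    intro v
    have h1 := (contMDiffOn_symm_of_mem_maximalAtlas hf).contMDiffOn_tangentMapWithin
      (m := ∞) (by simp) f.open_target.uniqueMDiffOn
    have h2 : ContMDiffOn 𝓘(ℝ, Eu n) (𝓘(ℝ, Eu n).prod 𝓘(ℝ, Eu n)) ∞
      (fun x : Eu n => (TotalSpace.mk' (Eu n) x v : TangentBundle 𝓘(ℝ, Eu n) (Eu n))) f.target := by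
      exact contMDiffOn_vectorSpace_iff_contDiffOn.2 contDiffOn_const
    have h3 := h1.comp h2 (fun x hx => hx)
    refine h3.congr fun x hx => ?_
    simp only [Function.comp, tangentMapWithin]
    rw [mfderivWithin_of_isOpen f.open_target hx]
    have := dChartInv_eq hf (f.map_target hx)
    rw [f.right_inv hx] at this
    rw [this]
    rfl
  rw [← contMDiffOn_iff_contDiffOn]
  intro x hx
  have hb : ContMDiffWithinAt 𝓘(ℝ, Eu n) 𝓘(ℝ, Eu n) ∞ f.symm f.target x :=
    contMDiffOn_symm_of_mem_maximalAtlas hf x hx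
  have : ContMDiffWithinAt 𝓘(ℝ, Eu n) (𝓘(ℝ, Eu n).prod 𝓘(ℝ)) ∞
      (fun m ↦ TotalSpace.mk' ℝ (E := Bundle.Trivial N ℝ) (f.symm m)
        (h.inner (f.symm m) (dChartInv f (f.symm m) v) (dChartInv f (f.symm m) w))) f.target x := by
    apply ContMDiffWithinAt.clm_bundle_apply₂ (F₁ := Eu n) (F₂ := Eu n)
    · exact ContMDiffAt.comp_contMDiffWithinAt x h.contMDiff.contMDiffAt hb
    · exact key v x hx
    · exact key w x hx
  simp only [contMDiffWithinAt_totalSpace] at this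
  exact this.2

/-- The metric in a chart, as a field of continuous bilinear forms. -/
def metricForm (h : Metric n N) (f : OpenPartialHomeomorph N (Eu n)) (x : Eu n) :
    Eu n →L[ℝ] Eu n →L[ℝ] ℝ := bilinOf (metricInChart h f x)

lemma metricForm_apply (h : Metric n N) (f : OpenPartialHomeomorph N (Eu n)) (x u v : Eu n) :
    metricForm h f x u v = metricInChart h f x u v :=
  bilinOf_apply (LinearMap.mk₂ ℝ (metricInChart h f x) (by simp [metricInChart])
    (by simp [metricInChart]) (by simp [metricInChart]) (by simp [metricInChart])) u v

lemma metricForm_symm (h : Metric n N) (f : OpenPartialHomeomorph N (Eu n)) (x u v : Eu n) :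
    metricForm h f x u v = metricForm h f x v u := by
  simp only [metricForm_apply, metricInChart, h.symm (f.symm x) (dChartInv f (f.symm x) u)]

lemma metricForm_pos (h : Metric n N) {f : OpenPartialHomeomorph N (Eu n)} (hf : f ∈ Atl n N)
    {x : Eu n} (hx : x ∈ f.target) {u : Eu n} (hu : u ≠ 0) : 0 < metricForm h f x u u := by
  rw [metricForm_apply]
  apply h.pos
  intro h0
  apply hu
  apply dChartInv_injective hf (f.map_target hx)
  simpa using h0

/-- Nondegeneracy of the metric. Identities between vectors are checked below by pairing with an
arbitrary w, which avoids the inverse Gram matrix. -/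
lemma metricForm_ext (h : Metric n N) {f : OpenPartialHomeomorph N (Eu n)} (hf : f ∈ Atl n N)
    {x : Eu n} (hx : x ∈ f.target) {u v : Eu n}
    (H : ∀ w, metricForm h f x u w = metricForm h f x v w) : u = v := by
  by_contra hne
  have := metricForm_pos h hf hx (sub_ne_zero.2 hne)
  rw [map_sub (metricForm h f x), sub_apply, H, sub_self] at this
  exact lt_irrefl _ this

lemma contDiffOn_metricForm (h : Metric n N) {f : OpenPartialHomeomorph N (Eu n)}
    (hf : f ∈ Atl n N) : ContDiffOn ℝ ∞ (metricForm h f) f.target :=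
  contDiffOn_bilinOf fun _ _ => contDiffOn_metricInChart h hf _ _

lemma contDiffAt_metricForm (h : Metric n N) {f : OpenPartialHomeomorph N (Eu n)}
    (hf : f ∈ Atl n N) {x : Eu n} (hx : x ∈ f.target) : ContDiffAt ℝ ∞ (metricForm h f) x :=
  (contDiffOn_metricForm h hf).contDiffAt (f.open_target.mem_nhds hx)

lemma differentiableAt_metricForm (h : Metric n N) {f : OpenPartialHomeomorph N (Eu n)}
    (hf : f ∈ Atl n N) {x : Eu n} (hx : x ∈ f.target) : DifferentiableAt ℝ (metricForm h f) x :=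
  (contDiffAt_metricForm h hf hx).differentiableAt (by simp)

/-- Inner products are computed by the metric in a chart. -/
lemma inner_eq_metricForm (h : Metric n N) {f : OpenPartialHomeomorph N (Eu n)} (hf : f ∈ Atl n N)
    {q : N} (hq : q ∈ f.source) (v w : Tan n q) :
    h.inner q v w = metricForm h f (f q) (dChart f q v) (dChart f q w) := by
  rw [metricForm_apply, metricInChart, f.left_inv hq, dChartInv_dChart hf hq,
    dChartInv_dChart hf hq]

/-- A vector c in the kernel of the Gram matrix satisfies G(c, c) = 0, so positivity forces c = 0.
-/
lemma isUnit_gramInChart (h : Metric n N) {f : OpenPartialHomeomorph N (Eu n)} (hf : f ∈ Atl n N)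
    {x : Eu n} (hx : x ∈ f.target) : IsUnit (gramInChart h f x).det := by
  rw [← Matrix.isUnit_iff_isUnit_det, ← Matrix.mulVec_injective_iff_isUnit]
  rw [← Matrix.coe_mulVecLin, injective_iff_map_eq_zero]
  intro c hc
  have hz : (WithLp.toLp 2 c : Eu n) = 0 := by
    by_contra hne
    have := metricForm_pos h hf hx hne
    have h2 : metricForm h f x (WithLp.toLp 2 c) (WithLp.toLp 2 c)
        = ∑ i, c i * ((gramInChart h f x).mulVec c) i := by
      unfold metricForm
      rw [bilinOf_apply']
      simp only [Matrix.mulVec, dotProduct, Finset.mul_sum, smul_eq_mul, gramInChart, Matrix.of_apply]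
      refine Finset.sum_congr rfl fun i _ => Finset.sum_congr rfl fun j _ => by ring
    rw [Matrix.coe_mulVecLin] at hc
    rw [h2, hc] at this
    simp at this
  ext i
  exact congrArg (fun z : Eu n => z i) hz

end MetricChart

/-! ### Smooth dependence of the inverse matrix. -/

section MatrixSmooth

variable {E : Type*} [NormedAddCommGroup E] [NormedSpace ℝ E] {ι : Type*} [Fintype ι]
  [DecidableEq ι] {A : E → Matrix ι ι ℝ} {s : Set E} {k : ℕ∞ω}

lemma contDiffOn_det (hA : ∀ i j, ContDiffOn ℝ k (fun x => A x i j) s) :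
    ContDiffOn ℝ k (fun x => (A x).det) s := by
  simp only [Matrix.det_apply]
  refine ContDiffOn.sum fun σ _ => ?_
  simp only [Units.smul_def, zsmul_eq_mul]
  exact contDiffOn_const.mul (contDiffOn_prod fun i _ => hA _ _)

/-- Cramer's rule: each entry of the inverse is a quotient of two determinants. The row replaced by
a unit vector is constant, so the numerator is smooth as well. -/
lemma contDiffOn_matrix_inv (hA : ∀ i j, ContDiffOn ℝ k (fun x => A x i j) s)
    (hu : ∀ x ∈ s, IsUnit (A x).det) (i j : ι) : ContDiffOn ℝ k (fun x => (A x)⁻¹ i j) s := by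
  have h1 : (fun x => (A x)⁻¹ i j)
      = fun x => ((A x).det)⁻¹ * ((A x).updateRow j (Pi.single i 1)).det := by
    ext x
    rw [Matrix.inv_def, Matrix.smul_apply, Ring.inverse_eq_inv', smul_eq_mul,
      Matrix.adjugate_apply]
  rw [h1]
  refine ((contDiffOn_det hA).inv fun x hx => (hu x hx).ne_zero).mul (contDiffOn_det fun a b => ?_)
  by_cases haj : a = j
  · subst haj
    simpa using contDiffOn_const
  · simpa [Matrix.updateRow_ne haj] using hA a b

end MatrixSmooth

/-! ### The Levi-Civita connection in a chart. -/

section Christoffel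

variable {n : ℕ} {N : Type*} [TopologicalSpace N] [ChartedSpace (Eu n) N]
  [IsManifold 𝓘(ℝ, Eu n) ∞ N]

lemma gramInChart_apply (h : Metric n N) (f : OpenPartialHomeomorph N (Eu n)) (x : Eu n)
    (i j : Fin n) : gramInChart h f x i j = metricForm h f x (stdVec i) (stdVec j) := by
  rw [metricForm_apply]; rfl

/-- Lowering the index multiplies the inverse Gram matrix in the definition by the Gram matrix. This
characterizes the Christoffel symbols by the Koszul formula, from which their bilinearity, their
symmetry and metric compatibility are derived. -/
lemma metricForm_christoffel (h : Metric n N) {f : OpenPartialHomeomorph N (Eu n)}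
    (hf : f ∈ Atl n N) {x : Eu n} (hx : x ∈ f.target) (u v w : Eu n) :
    metricForm h f x (christoffel h f x u v) w = koszul (metricForm h f) x u v w := by
  have hd := differentiableAt_metricForm h hf hx
  have hG := isUnit_gramInChart h hf hx
  have hfd : ∀ a b c, fderiv ℝ (fun y => metricInChart h f y a b) x c
      = fderiv ℝ (metricForm h f) x c a b := by
    intro a b c
    rw [← fderiv_clm_const_apply₂ hd]
    simp only [metricForm_apply]
  have key : ∀ l, metricForm h f x (christoffel h f x u v) (stdVec l)
      = koszul (metricForm h f) x u v (stdVec l) := by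
    intro l
    have h1 : ∑ k, gramInChart h f x l k * (gramInChart h f x)⁻¹ k l = 1 := by
      rw [← Matrix.mul_apply, Matrix.mul_nonsing_inv _ hG, Matrix.one_apply_eq]
    have h2 : ∀ l', l' ≠ l → ∑ k, gramInChart h f x l k * (gramInChart h f x)⁻¹ k l' = 0 := by
      intro l' hl
      rw [← Matrix.mul_apply, Matrix.mul_nonsing_inv _ hG, Matrix.one_apply_ne hl.symm]
    simp only [christoffel, hfd, map_sum, map_smul, sum_apply, smul_apply, smul_eq_mul]
    rw [Finset.sum_comm]
    have h3 : ∀ l', ∑ k, (gramInChart h f x)⁻¹ k l' * ((1 / 2 : ℝ) *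
          (fderiv ℝ (metricForm h f) x u v (stdVec l') + fderiv ℝ (metricForm h f) x v u (stdVec l')
            - fderiv ℝ (metricForm h f) x (stdVec l') u v)) *
          metricForm h f x (stdVec k) (stdVec l)
        = koszul (metricForm h f) x u v (stdVec l') *
          ∑ k, gramInChart h f x l k * (gramInChart h f x)⁻¹ k l' := by
      intro l'
      rw [Finset.mul_sum]
      refine Finset.sum_congr rfl fun k _ => ?_
      rw [gramInChart_apply h f x l k, metricForm_symm h f x (stdVec l), koszul]
      ring
    simp only [h3]
    rw [Finset.sum_eq_single l (fun l' _ hl => by rw [h2 l' hl, mul_zero]) (by simp), h1, mul_one]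
  rw [← sum_stdVec w, map_sum]
  simp only [map_smul, key, koszul, map_sum, sum_apply, smul_apply, smul_eq_mul]
  rw [← Finset.sum_add_distrib, ← Finset.sum_sub_distrib, Finset.mul_sum]
  exact Finset.sum_congr rfl fun i _ => by ring

/-- The Christoffel symbols in a chart, as a field of continuous bilinear maps. -/
def christForm (h : Metric n N) (f : OpenPartialHomeomorph N (Eu n)) (x : Eu n) :
    Eu n →L[ℝ] Eu n →L[ℝ] Eu n := bilinOf (christoffel h f x)

/-- Bilinearity of `christoffel` is not visible in its definition, which differentiates functions
built from u and v. It holds because the pairing with any w is the Koszul expression, which is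
linear in each argument. -/
lemma christForm_apply (h : Metric n N) {f : OpenPartialHomeomorph N (Eu n)}
    (hf : f ∈ Atl n N) {x : Eu n} (hx : x ∈ f.target) (u v : Eu n) :
    christForm h f x u v = christoffel h f x u v := by
  refine bilinOf_apply (LinearMap.mk₂ ℝ (christoffel h f x) ?_ ?_ ?_ ?_) u v
  all_goals
    intros
    refine metricForm_ext h hf hx fun w => ?_
    simp only [map_add, map_smul, add_apply, smul_apply, smul_eq_mul,
      metricForm_christoffel h hf hx, koszul]
    ring

lemma metricForm_christForm (h : Metric n N) {f : OpenPartialHomeomorph N (Eu n)}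
    (hf : f ∈ Atl n N) {x : Eu n} (hx : x ∈ f.target) (u v w : Eu n) :
    metricForm h f x (christForm h f x u v) w = koszul (metricForm h f) x u v w := by
  rw [christForm_apply h hf hx, metricForm_christoffel h hf hx]

lemma christForm_symm (h : Metric n N) {f : OpenPartialHomeomorph N (Eu n)}
    (hf : f ∈ Atl n N) {x : Eu n} (hx : x ∈ f.target) (u v : Eu n) :
    christForm h f x u v = christForm h f x v u := by
  refine metricForm_ext h hf hx fun w => ?_
  rw [metricForm_christForm h hf hx, metricForm_christForm h hf hx]
  exact koszul_symm (differentiableAt_metricForm h hf hx)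
    (Filter.Eventually.of_forall (metricForm_symm h f)) u v w

/-- Metric compatibility of the Levi-Civita connection, in a chart. -/
lemma fderiv_metricForm (h : Metric n N) {f : OpenPartialHomeomorph N (Eu n)}
    (hf : f ∈ Atl n N) {x : Eu n} (hx : x ∈ f.target) (u v w : Eu n) :
    fderiv ℝ (metricForm h f) x u v w
      = metricForm h f x (christForm h f x u v) w + metricForm h f x v (christForm h f x u w) := by
  rw [metricForm_symm h f x v, metricForm_christForm h hf hx, metricForm_christForm h hf hx,
    koszul_add_koszul (differentiableAt_metricForm h hf hx)
      (Filter.Eventually.of_forall (metricForm_symm h f))]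

lemma contDiffOn_gramInv (h : Metric n N) {f : OpenPartialHomeomorph N (Eu n)}
    (hf : f ∈ Atl n N) (i j : Fin n) :
    ContDiffOn ℝ ∞ (fun x => (gramInChart h f x)⁻¹ i j) f.target :=
  contDiffOn_matrix_inv (fun _ _ => contDiffOn_metricInChart h hf _ _)
    (fun _ hx => isUnit_gramInChart h hf hx) i j

lemma contDiffOn_christForm (h : Metric n N) {f : OpenPartialHomeomorph N (Eu n)}
    (hf : f ∈ Atl n N) : ContDiffOn ℝ ∞ (christForm h f) f.target := by
  refine contDiffOn_bilinOf fun i j => ?_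
  unfold christoffel
  have hfd : ∀ a b c, ContDiffOn ℝ ∞
      (fun x => fderiv ℝ (fun y => metricInChart h f y a b) x c) f.target := by
    intro a b c
    exact ((contDiffOn_metricInChart h hf a b).fderiv_of_isOpen f.open_target (m := ∞)
      (by simp)).clm_apply contDiffOn_const
  refine ContDiffOn.sum fun k _ => ContDiffOn.sum fun l _ => ContDiffOn.fun_smul ?_ contDiffOn_const
  exact (contDiffOn_gramInv h hf k l).mul (contDiffOn_const.mul
    (((hfd _ _ _).add (hfd _ _ _)).sub (hfd _ _ _)))

lemma contDiffAt_christForm (h : Metric n N) {f : OpenPartialHomeomorph N (Eu n)}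
    (hf : f ∈ Atl n N) {x : Eu n} (hx : x ∈ f.target) : ContDiffAt ℝ ∞ (christForm h f) x :=
  (contDiffOn_christForm h hf).contDiffAt (f.open_target.mem_nhds hx)

lemma differentiableAt_christForm (h : Metric n N) {f : OpenPartialHomeomorph N (Eu n)}
    (hf : f ∈ Atl n N) {x : Eu n} (hx : x ∈ f.target) : DifferentiableAt ℝ (christForm h f) x :=
  (contDiffAt_christForm h hf hx).differentiableAt (by simp)

lemma curvatureInChart_eq (h : Metric n N) {f : OpenPartialHomeomorph N (Eu n)}
    (hf : f ∈ Atl n N) {x : Eu n} (hx : x ∈ f.target) (u v w : Eu n) :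
    curvatureInChart h f x u v w = curvOf (christForm h f) x u v w := by
  have key : ∀ a b c, fderiv ℝ (fun y => christoffel h f y a b) x c
      = fderiv ℝ (christForm h f) x c a b := by
    intro a b c
    have h1 : (fun y => christoffel h f y a b) =ᶠ[nhds x] fun y => christForm h f y a b := by
      filter_upwards [f.open_target.mem_nhds hx] with y hy
      rw [christForm_apply h hf hy]
    rw [h1.fderiv_eq, fderiv_clm_apply₂' (differentiableAt_christForm h hf hx)
      (differentiableAt_const a) (differentiableAt_const b)]
    simp
  simp only [curvatureInChart, curvOf, key, christForm_apply h hf hx]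

end Christoffel

/-! ### The second fundamental form in charts is normal. -/

section SecondFF

variable {m n : ℕ} {M N : Type*}
  [TopologicalSpace M] [ChartedSpace (Eu m) M] [IsManifold 𝓘(ℝ, Eu m) ∞ M]
  [TopologicalSpace N] [ChartedSpace (Eu n) N] [IsManifold 𝓘(ℝ, Eu n) ∞ N]

/-- The second fundamental form in charts. -/
def sffForm (g : Metric m M) (h : Metric n N) (φ : M → N) (e : OpenPartialHomeomorph M (Eu m))
    (f : OpenPartialHomeomorph N (Eu n)) (x v w : Eu m) : Eu n :=
  hessAlong (christForm h f) (rep φ e f) x v w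
    - fderiv ℝ (rep φ e f) x (christForm g e x v w)

/-- The metric of the source is the pull-back of the metric of the target. -/
lemma metricForm_eventuallyEq_pullForm {g : Metric m M} {h : Metric n N} {φ : M → N}
    (hφ : IsRiemannianImmersion g h φ) {e : OpenPartialHomeomorph M (Eu m)} (he : e ∈ Atl m M)
    {f : OpenPartialHomeomorph N (Eu n)} (hf : f ∈ Atl n N) {q : M} (hq : q ∈ e.source)
    (hfq : φ q ∈ f.source) :
    metricForm g e =ᶠ[nhds (e q)] pullForm (metricForm h f) (rep φ e f) := by
  filter_upwards [rep_nhds hφ.smooth.continuous hq hfq] with x hx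
  ext u v
  have h1 := e.map_target hx.1
  have h2 := e.right_inv hx.1
  have h3 := fderiv_rep hφ.smooth he hf h1 hx.2
  rw [h2] at h3
  rw [pullForm_apply, h3, h3, metricForm_apply, metricInChart, ← hφ.isometric,
    inner_eq_metricForm h hf hx.2]
  rfl

/-- Near q the metric g is the pull-back of h, so the Koszul expressions of the two agree. By the
pull-back law the tangential part of the covariant derivative of dψ is then dψ applied to the
Christoffel symbols of g, which is exactly what `sffForm` subtracts. -/
lemma sffForm_normal {g : Metric m M} {h : Metric n N} {φ : M → N}
    (hφ : IsRiemannianImmersion g h φ) {e : OpenPartialHomeomorph M (Eu m)} (he : e ∈ Atl m M)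
    {f : OpenPartialHomeomorph N (Eu n)} (hf : f ∈ Atl n N) {q : M} (hq : q ∈ e.source)
    (hfq : φ q ∈ f.source) (u v w : Eu m) :
    metricForm h f (f (φ q)) (sffForm g h φ e f (e q) u v) (fderiv ℝ (rep φ e f) (e q) w) = 0 := by
  have hev := metricForm_eventuallyEq_pullForm hφ he hf hq hfq
  have hx : e q ∈ e.target := e.map_source hq
  have hψ : ContDiffAt ℝ 2 (rep φ e f) (e q) :=
    (contDiffAt_rep hφ.smooth he hf hx (by rwa [e.left_inv hq])).of_le ENat.LEInfty.out
  have hrep : rep φ e f (e q) = f (φ q) := by rw [rep, e.left_inv hq]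
  have hy : rep φ e f (e q) ∈ f.target := by rw [hrep]; exact f.map_source hfq
  have h1 : koszul (metricForm g e) (e q) u v w
      = koszul (pullForm (metricForm h f) (rep φ e f)) (e q) u v w := by
    unfold koszul; rw [hev.fderiv_eq]
  rw [koszul_pullForm hψ (differentiableAt_metricForm h hf hy) (metricForm_symm h f _),
    ← metricForm_christForm g he hx, ← metricForm_christForm h hf hy, hev.eq_of_nhds,
    pullForm_apply] at h1
  rw [← hrep, sffForm, hessAlong, map_sub, map_add, sub_apply, add_apply]
  linarith

end SecondFF

/-! ### The second-order chain rule and changes of charts. -/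

section Comp

variable {E F H : Type*} [NormedAddCommGroup E] [NormedSpace ℝ E]
  [NormedAddCommGroup F] [NormedSpace ℝ F] [NormedAddCommGroup H] [NormedSpace ℝ H]

lemma fderiv_fderiv_comp {τ : F → H} {ψ : E → F} {x : E} (hτ : ContDiffAt ℝ 2 τ (ψ x))
    (hψ : ContDiffAt ℝ 2 ψ x) (v w : E) :
    fderiv ℝ (fderiv ℝ (fun y => τ (ψ y))) x v w
      = fderiv ℝ (fderiv ℝ τ) (ψ x) (fderiv ℝ ψ x v) (fderiv ℝ ψ x w)
        + fderiv ℝ τ (ψ x) (fderiv ℝ (fderiv ℝ ψ) x v w) := by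
  have h1 : ∀ᶠ y in nhds x, ∀ w, fderiv ℝ (fun y => τ (ψ y)) y w
      = fderiv ℝ τ (ψ y) (fderiv ℝ ψ y w) := by
    have hτe := hψ.continuousAt.eventually (hτ.eventually (by simp))
    filter_upwards [hτe, hψ.eventually (by simp)] with y h1 h2 w
    exact (differentiableAt_comp_and_fderiv (h1.differentiableAt (by simp))
      (h2.differentiableAt (by simp))).2 w
  have hd : DifferentiableAt ℝ ψ x := hψ.differentiableAt (by simp)
  have hdψ : DifferentiableAt ℝ (fderiv ℝ ψ) x :=
    (hψ.fderiv_right (m := 1) (by norm_num)).differentiableAt (by simp)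
  have hdτ : DifferentiableAt ℝ (fderiv ℝ τ) (ψ x) :=
    (hτ.fderiv_right (m := 1) (by norm_num)).differentiableAt (by simp)
  have hc : ContDiffAt ℝ 2 (fun y => τ (ψ y)) x := hτ.comp x hψ
  have hdc : DifferentiableAt ℝ (fderiv ℝ (fun y => τ (ψ y))) x :=
    (hc.fderiv_right (m := 1) (by norm_num)).differentiableAt (by simp)
  rw [← fderiv_fderiv_apply_const hdc]
  have h2 : (fun y => fderiv ℝ (fun y => τ (ψ y)) y w)
      =ᶠ[nhds x] fun y => fderiv ℝ τ (ψ y) (fderiv ℝ ψ y w) := h1.mono fun y hy => hy w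
  have h3 := differentiableAt_comp_and_fderiv hdτ hd
  rw [h2.fderiv_eq, fderiv_clm_apply h3.1 (hdψ.clm_apply (differentiableAt_const w)),
    add_apply, ContinuousLinearMap.comp_apply, ContinuousLinearMap.flip_apply,
    fderiv_fderiv_apply_const hdψ, h3.2, add_comm]

end Comp

section ChangeOfCharts

variable {m n : ℕ} {M N : Type*}
  [TopologicalSpace M] [ChartedSpace (Eu m) M] [IsManifold 𝓘(ℝ, Eu m) ∞ M]
  [TopologicalSpace N] [ChartedSpace (Eu n) N] [IsManifold 𝓘(ℝ, Eu n) ∞ N]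

omit [IsManifold 𝓘(ℝ, Eu m) ∞ M] in
lemma dMap_id (q : M) (v : Tan m q) : dMap (fun q : M => q) q v = v := by
  have : dMap (fun q : M => q) q = ContinuousLinearMap.id ℝ (Tan m q) := mfderiv_id
  rw [this]; rfl

lemma isRiemannianImmersion_id (g : Metric m M) : IsRiemannianImmersion g g (fun q : M => q) :=
  ⟨contMDiff_id, fun p v w => by rw [dMap_id, dMap_id]⟩

omit [IsManifold 𝓘(ℝ, Eu m) ∞ M] in
/-- The derivative of a change of charts. -/
lemma fderiv_rep_id {e e' : OpenPartialHomeomorph M (Eu m)} (he : e ∈ Atl m M) (he' : e' ∈ Atl m M)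
    {q : M} (hq : q ∈ e.source) (hq' : q ∈ e'.source) (v : Eu m) :
    fderiv ℝ (rep (fun q : M => q) e e') (e q) v = dChart e' q (dChartInv e q v) := by
  rw [fderiv_rep (φ := fun q : M => q) contMDiff_id he he' hq hq', dMap_id]

/-- The transformation law of the Christoffel symbols. -/
lemma hessAlong_rep_id (g : Metric m M) {e e' : OpenPartialHomeomorph M (Eu m)} (he : e ∈ Atl m M)
    (he' : e' ∈ Atl m M) {q : M} (hq : q ∈ e.source) (hq' : q ∈ e'.source) (u v : Eu m) :
    hessAlong (christForm g e') (rep (fun q : M => q) e e') (e q) u v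
      = dChart e' q (dChartInv e q (christForm g e (e q) u v)) := by
  rw [← fderiv_rep_id he he' hq hq', ← sub_eq_zero]
  refine metricForm_ext g he' (e'.map_source hq') fun w => ?_
  rw [map_zero]
  -- The identity is an isometric immersion of M into itself. Its second fundamental form is normal,
  -- but every vector is tangent, so it vanishes; this is the transformation law.
  have := sffForm_normal (isRiemannianImmersion_id g) he he' hq hq' u v
    (dChart e q (dChartInv e' q w))
  rw [fderiv_rep_id he he' hq hq', dChartInv_dChart he hq, dChart_dChartInv he' hq'] at this
  exact this

/-- Near `e q` the representatives satisfy ψ = τ ∘ ψ' ∘ σ with transition maps σ and τ. The second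
derivatives of σ and τ in the chain rule are absorbed by the transformation laws of the Christoffel
symbols on M and on N, so the form is tensorial. -/
lemma sffForm_change {g : Metric m M} {h : Metric n N} {φ : M → N}
    (hφ : ContMDiff 𝓘(ℝ, Eu m) 𝓘(ℝ, Eu n) ∞ φ)
    {e e' : OpenPartialHomeomorph M (Eu m)} (he : e ∈ Atl m M) (he' : e' ∈ Atl m M)
    {f f' : OpenPartialHomeomorph N (Eu n)} (hf : f ∈ Atl n N) (hf' : f' ∈ Atl n N)
    {q : M} (hq : q ∈ e.source) (hq' : q ∈ e'.source) (hfq : φ q ∈ f.source)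
    (hfq' : φ q ∈ f'.source) (u v : Tan m q) :
    dChartInv f (φ q) (sffForm g h φ e f (e q) (dChart e q u) (dChart e q v))
      = dChartInv f' (φ q) (sffForm g h φ e' f' (e' q) (dChart e' q u) (dChart e' q v)) := by
  have two : (2 : ℕ∞ω) ≤ ∞ := ENat.LEInfty.out
  apply dChart_injective hf hfq
  rw [dChart_dChartInv hf hfq]
  set σ := rep (fun q : M => q) e e' with hσ
  set τ := rep (fun q : N => q) f' f with hτ
  set ψ := rep φ e f with hψ
  set ψ' := rep φ e' f' with hψ'
  have sx : σ (e q) = e' q := by simp [hσ, rep, e.left_inv hq]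
  have sx' : ψ' (e' q) = f' (φ q) := by simp [hψ', rep, e'.left_inv hq']
  have sxψ : ψ (e q) = f (φ q) := by simp [hψ, rep, e.left_inv hq]
  have syτ : τ (f' (φ q)) = f (φ q) := by simp [hτ, rep, f'.left_inv hfq']
  have hσ2 : ContDiffAt ℝ 2 σ (e q) := (contDiffAt_rep contMDiff_id he he' (e.map_source hq)
    (by rwa [e.left_inv hq])).of_le two
  have hτ2 : ContDiffAt ℝ 2 τ (f' (φ q)) := (contDiffAt_rep contMDiff_id hf' hf
    (f'.map_source hfq') (by rwa [f'.left_inv hfq'])).of_le two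
  have hψ'2 : ContDiffAt ℝ 2 ψ' (e' q) := (contDiffAt_rep hφ he' hf' (e'.map_source hq')
    (by rwa [e'.left_inv hq'])).of_le two
  have hev : ψ =ᶠ[nhds (e q)] fun x => τ (ψ' (σ x)) := by
    have h1 : ∀ᶠ x in nhds (e q), x ∈ e.target ∧ e.symm x ∈ e'.source :=
      rep_nhds (φ := fun q : M => q) continuous_id hq hq'
    have h2 : ∀ᶠ x in nhds (e q), x ∈ e.target ∧ φ (e.symm x) ∈ f'.source :=
      rep_nhds hφ.continuous hq hfq'
    filter_upwards [h1, h2] with x hx1 hx2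
    simp only [hτ, hψ', hσ, hψ, rep]
    rw [e'.left_inv hx1.2, f'.left_inv hx2.2]
  have hψσ2 : ContDiffAt ℝ 2 (fun x => ψ' (σ x)) (e q) :=
    ContDiffAt.comp (g := ψ') (f := σ) (e q) (by rwa [sx]) hσ2
  have d1 : ∀ a, fderiv ℝ (fun x => ψ' (σ x)) (e q) a = fderiv ℝ ψ' (e' q) (fderiv ℝ σ (e q) a) := by
    intro a
    rw [(differentiableAt_comp_and_fderiv (g := ψ') (f := σ)
      (by rw [sx]; exact hψ'2.differentiableAt (by simp)) (hσ2.differentiableAt (by simp))).2, sx]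
  have d2 : ∀ a, fderiv ℝ ψ (e q) a
      = fderiv ℝ τ (f' (φ q)) (fderiv ℝ ψ' (e' q) (fderiv ℝ σ (e q) a)) := by
    intro a
    rw [hev.fderiv_eq, (differentiableAt_comp_and_fderiv (g := τ) (f := fun x => ψ' (σ x))
      (by rw [sx, sx']; exact hτ2.differentiableAt (by simp))
      (hψσ2.differentiableAt (by simp))).2, sx, sx', d1]
  have dd : ∀ a b, fderiv ℝ (fderiv ℝ ψ) (e q) a b
      = fderiv ℝ (fderiv ℝ τ) (f' (φ q)) (fderiv ℝ ψ' (e' q) (fderiv ℝ σ (e q) a))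
          (fderiv ℝ ψ' (e' q) (fderiv ℝ σ (e q) b))
        + fderiv ℝ τ (f' (φ q)) (fderiv ℝ (fderiv ℝ ψ') (e' q) (fderiv ℝ σ (e q) a)
            (fderiv ℝ σ (e q) b) + fderiv ℝ ψ' (e' q) (fderiv ℝ (fderiv ℝ σ) (e q) a b)) := by
    intro a b
    rw [(hev.fderiv).fderiv_eq, fderiv_fderiv_comp (τ := τ) (ψ := fun x => ψ' (σ x))
      (by rwa [sx, sx']) hψσ2, fderiv_fderiv_comp (τ := ψ') (ψ := σ) (by rwa [sx]) hσ2, sx, sx',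
      d1, d1]
  have dσ : ∀ a, fderiv ℝ σ (e q) (dChart e q a) = dChart e' q a := by
    intro a
    rw [fderiv_rep_id he he' hq hq', dChartInv_dChart he hq]
  have cτ : ∀ a b, fderiv ℝ (fderiv ℝ τ) (f' (φ q)) a b
      + christForm h f (f (φ q)) (fderiv ℝ τ (f' (φ q)) a) (fderiv ℝ τ (f' (φ q)) b)
      = fderiv ℝ τ (f' (φ q)) (christForm h f' (f' (φ q)) a b) := by
    intro a b
    have := hessAlong_rep_id h hf' hf hfq' hfq a b
    rw [hessAlong, ← hτ, syτ, ← fderiv_rep_id hf' hf hfq' hfq] at this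
    exact this
  have cσ : ∀ a b, fderiv ℝ (fderiv ℝ σ) (e q) a b
      + christForm g e' (e' q) (fderiv ℝ σ (e q) a) (fderiv ℝ σ (e q) b)
      = fderiv ℝ σ (e q) (christForm g e (e q) a b) := by
    intro a b
    have := hessAlong_rep_id g he he' hq hq' a b
    rw [hessAlong, ← hσ, sx, ← fderiv_rep_id he he' hq hq'] at this
    exact this
  rw [← fderiv_rep_id hf' hf hfq' hfq, ← hτ]
  simp only [sffForm, hessAlong, ← hψ, ← hψ', sx', sxψ, dd, d2, ← cσ, dσ, map_sub, map_add, ← cτ]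
  abel

end ChangeOfCharts

/-! ### Covariant derivatives and the second fundamental form in arbitrary charts. -/

section SecondFF

variable {m n : ℕ} {M N : Type*}
  [TopologicalSpace M] [ChartedSpace (Eu m) M] [IsManifold 𝓘(ℝ, Eu m) ∞ M]
  [TopologicalSpace N] [ChartedSpace (Eu n) N] [IsManifold 𝓘(ℝ, Eu n) ∞ N]

-- The chart of N is fixed by the definition of `covDerivAlong`, but the derivative of the
-- components may be taken in any smooth chart of M around q, by the chain rule.
omit [IsManifold 𝓘(ℝ, Eu m) ∞ M] in
lemma covDerivAlong_eq (h : Metric n N) {φ : M → N} {V : ∀ q : M, Tan n (φ q)}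
    {e : OpenPartialHomeomorph M (Eu m)} (he : e ∈ Atl m M) {q : M} (hq : q ∈ e.source)
    {W : Eu m → Eu n} (hW : DifferentiableAt ℝ W (e q))
    (hV : ∀ᶠ y in nhds q, dChart (chartAt (Eu n) (φ q)) (φ y) (V y) = W (e y)) (v : Tan m q) :
    covDerivAlong h φ V q v = dChartInv (chartAt (Eu n) (φ q)) (φ q)
      (fderiv ℝ W (e q) (dChart e q v)
        + christForm h (chartAt (Eu n) (φ q)) (chartAt (Eu n) (φ q) (φ q))
            (dChart (chartAt (Eu n) (φ q)) (φ q) (dMap φ q v)) (W (e q))) := by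
  unfold covDerivAlong
  simp only
  rw [mvfderiv_eq_of_eventuallyEq he hq hV hW, hV.self_of_nhds,
    christForm_apply h (chartAt_mem_atl _)
      ((chartAt (Eu n) (φ q)).map_source (mem_chart_source _ _))]

lemma dChart_localExt (q : M) (w : Tan m q) {y : M} (hy : y ∈ (chartAt (Eu m) q).source) :
    dChart (chartAt (Eu m) q) y (localExt q w y) = dChart (chartAt (Eu m) q) q w := by
  unfold localExt
  rw [dChart_dChartInv (chartAt_mem_atl q) hy]

omit [IsManifold 𝓘(ℝ, Eu m) ∞ M] in
lemma eventually_mem_chart_source (q : M) : ∀ᶠ y in nhds q, y ∈ (chartAt (Eu m) q).source :=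
  (chartAt (Eu m) q).open_source.mem_nhds (mem_chart_source _ q)

/-- The extension has constant components in the preferred chart, so the derivative term vanishes
and only the Christoffel term is left. -/
lemma leviCivita_localExt (g : Metric m M) (q : M) (w v : Tan m q) :
    leviCivita g (localExt q w) q v = dChartInv (chartAt (Eu m) q) q
      (christForm g (chartAt (Eu m) q) (chartAt (Eu m) q q) (dChart (chartAt (Eu m) q) q v)
        (dChart (chartAt (Eu m) q) q w)) := by
  unfold leviCivita
  rw [covDerivAlong_eq g (chartAt_mem_atl q) (mem_chart_source _ q)
    (W := fun _ => dChart (chartAt (Eu m) q) q w) (differentiableAt_const _), dMap_id]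
  · simp
  · filter_upwards [eventually_mem_chart_source (m := m) q] with y hy
    exact dChart_localExt q w hy

/-- The second fundamental form in arbitrary charts. -/
lemma secondFF_eq {g : Metric m M} {h : Metric n N} {φ : M → N}
    (hφ : ContMDiff 𝓘(ℝ, Eu m) 𝓘(ℝ, Eu n) ∞ φ)
    {e : OpenPartialHomeomorph M (Eu m)} (he : e ∈ Atl m M)
    {f : OpenPartialHomeomorph N (Eu n)} (hf : f ∈ Atl n N)
    {q : M} (hq : q ∈ e.source) (hfq : φ q ∈ f.source) (v w : Tan m q) :
    secondFF g h φ q v w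
      = dChartInv f (φ q) (sffForm g h φ e f (e q) (dChart e q v) (dChart e q w)) := by
  have two : (2 : ℕ∞ω) ≤ ∞ := ENat.LEInfty.out
  rw [sffForm_change hφ he (chartAt_mem_atl (n := m) q) hf (chartAt_mem_atl (n := n) (φ q)) hq
    (mem_chart_source (Eu m) q) hfq (mem_chart_source (Eu n) (φ q))]
  set E := chartAt (Eu m) q
  set f' := chartAt (Eu n) (φ q)
  have hE : E ∈ Atl m M := chartAt_mem_atl q
  have hqE : q ∈ E.source := mem_chart_source (Eu m) q
  have hf' : f' ∈ Atl n N := chartAt_mem_atl _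
  have hqf : φ q ∈ f'.source := mem_chart_source _ _
  have h2 : ContDiffAt ℝ 2 (rep φ E f') (E q) := (contDiffAt_rep hφ hE hf' (E.map_source hqE)
    (by rwa [E.left_inv hqE])).of_le two
  have hdd : DifferentiableAt ℝ (fderiv ℝ (rep φ E f')) (E q) :=
    (h2.fderiv_right (m := 1) (by norm_num)).differentiableAt (by simp)
  have hW : DifferentiableAt ℝ (fun x => fderiv ℝ (rep φ E f') x (dChart E q w)) (E q) :=
    hdd.clm_apply (differentiableAt_const _)
  have hrep : rep φ E f' (E q) = f' (φ q) := by rw [rep, E.left_inv hqE]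
  unfold secondFF
  rw [covDerivAlong_eq h hE hqE hW, leviCivita_localExt, fderiv_fderiv_apply_const hdd, sffForm,
    hessAlong, map_sub, fderiv_rep hφ hE hf' hqE hqf, fderiv_rep hφ hE hf' hqE hqf,
    fderiv_rep hφ hE hf' hqE hqf, dChartInv_dChart hE hqE, dChartInv_dChart hE hqE,
    dChartInv_dChart hf' hqf, hrep]
  have hs : ∀ᶠ y in nhds q, φ y ∈ f'.source :=
    hφ.continuous.continuousAt (f'.open_source.mem_nhds hqf)
  filter_upwards [eventually_mem_chart_source (m := m) q, hs] with y hy hy'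
  rw [fderiv_rep hφ hE hf' hy hy']
  rfl

/-- The second fundamental form is normal. -/
lemma inner_secondFF_dMap {g : Metric m M} {h : Metric n N} {φ : M → N}
    (hφ : IsRiemannianImmersion g h φ) (q : M) (u v w : Tan m q) :
    h.inner (φ q) (secondFF g h φ q u v) (dMap φ q w) = 0 := by
  have hE : chartAt (Eu m) q ∈ Atl m M := chartAt_mem_atl q
  have hqE : q ∈ (chartAt (Eu m) q).source := mem_chart_source (Eu m) q
  have hf' : chartAt (Eu n) (φ q) ∈ Atl n N := chartAt_mem_atl _
  have hqf : φ q ∈ (chartAt (Eu n) (φ q)).source := mem_chart_source (Eu n) (φ q)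
  have := sffForm_normal hφ hE hf' hqE hqf (dChart (chartAt (Eu m) q) q u)
    (dChart (chartAt (Eu m) q) q v) (dChart (chartAt (Eu m) q) q w)
  rw [fderiv_rep hφ.smooth hE hf' hqE hqf, dChartInv_dChart hE hqE] at this
  rw [secondFF_eq hφ.smooth hE hf' hqE hqf, inner_eq_metricForm h hf' hqf,
    dChart_dChartInv hf' hqf, this]

end SecondFF

/-! ### Traces in arbitrary bases and in orthogonal frames. -/

section Trace

variable {n : ℕ} {N : Type*} [TopologicalSpace N] [ChartedSpace (Eu n) N]
  [IsManifold 𝓘(ℝ, Eu n) ∞ N]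

/-- The metric trace may be computed in any basis. -/
lemma metricTrace_eq_of_basis (h : Metric n N) (p : N) {W : Type*} [AddCommGroup W] [Module ℝ W]
    (b : Tan n p →ₗ[ℝ] Tan n p →ₗ[ℝ] W) (L : Eu n ≃ₗ[ℝ] Tan n p) :
    metricTrace h p (fun u v => b u v)
      = ∑ i, ∑ j, (Matrix.of fun k l : Fin n => h.inner p (L (stdVec k)) (L (stdVec l)))⁻¹ i j
          • b (L (stdVec i)) (L (stdVec j)) := by
  set C : Matrix (Fin n) (Fin n) ℝ :=
    Matrix.of fun k l : Fin n => h.inner p (L (stdVec k)) (L (stdVec l)) with hC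
  have hp := mem_chart_source (Eu n) p
  have he : chartAt (Eu n) p ∈ Atl n N := chartAt_mem_atl p
  set P : Matrix (Fin n) (Fin n) ℝ := Matrix.of fun i k => L.symm (frame p i) k with hP
  set Q : Matrix (Fin n) (Fin n) ℝ :=
    Matrix.of fun k i => dChart (chartAt (Eu n) p) p (L (stdVec k)) i with hQ
  have hframe : ∀ i, frame p i = ∑ k, P i k • L (stdVec k) := by
    intro i
    have := congrArg L (sum_stdVec (L.symm (frame p i)))
    rw [map_sum, L.apply_symm_apply] at this
    simp only [map_smul] at this
    exact this.symm
  have hPQ : P * Q = 1 := by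
    ext i j
    have h1 : dChart (chartAt (Eu n) p) p (frame p i) = stdVec i := dChart_dChartInv he hp _
    rw [hframe i, map_sum] at h1
    have h2 := congrArg (fun z : Eu n => z j) h1
    simp only [map_smul] at h2
    rw [Matrix.mul_apply]
    simp only [hQ, Matrix.of_apply]
    have h3 : (stdVec i : Eu n) j = (1 : Matrix (Fin n) (Fin n) ℝ) i j := by
      simp [stdVec, Matrix.one_apply, eq_comm]
    rw [← h3, ← h2]
    simp
  have hPu : IsUnit P.det := (Matrix.isUnit_iff_isUnit_det P).1
    (IsUnit.of_mul_eq_one Q hPQ)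
  -- P expresses the preferred frame in the basis given by L. The Gram matrix changes by the
  -- congruence with P, hence its inverse by the opposite one, and this cancels the factors P that
  -- bilinearity of b produces.
  have hA : gram h p = P * C * P.transpose := by
    ext i j
    simp only [gram, Matrix.of_apply, Matrix.mul_apply, Matrix.transpose_apply, hC]
    rw [hframe i, hframe j]
    simp only [map_sum, map_smul, sum_apply, smul_apply, smul_eq_mul, Finset.sum_mul,
      Finset.mul_sum]
    refine Finset.sum_congr rfl fun l _ => Finset.sum_congr rfl fun k _ => by ring
  have hCinv : C⁻¹ = P.transpose * (gram h p)⁻¹ * P := by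
    have hPt : IsUnit P.transpose.det := by rwa [Matrix.det_transpose]
    rw [hA, Matrix.mul_inv_rev, Matrix.mul_inv_rev, ← Matrix.mul_assoc, ← Matrix.mul_assoc,
      Matrix.mul_nonsing_inv _ hPt, Matrix.one_mul, Matrix.mul_assoc, Matrix.nonsing_inv_mul _ hPu,
      Matrix.mul_one]
  unfold metricTrace
  rw [hCinv]
  have h1 : ∀ i j, (gram h p)⁻¹ i j • b (frame p i) (frame p j)
      = ∑ k, ∑ l, (P i k * (gram h p)⁻¹ i j * P j l) • b (L (stdVec k)) (L (stdVec l)) := by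
    intro i j
    rw [hframe i, hframe j]
    simp only [map_sum, map_smul, LinearMap.sum_apply, LinearMap.smul_apply, smul_smul,
      Finset.smul_sum]
    rw [Finset.sum_comm]
    refine Finset.sum_congr rfl fun k _ => Finset.sum_congr rfl fun l _ => ?_
    congr 1; ring
  have h2 : ∀ k l, (P.transpose * (gram h p)⁻¹ * P) k l
      = ∑ i, ∑ j, P i k * (gram h p)⁻¹ i j * P j l := by
    intro k l
    simp only [Matrix.mul_apply, Matrix.transpose_apply, Finset.sum_mul]
    rw [Finset.sum_comm]
  simp only [h1, h2, Finset.sum_smul]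
  calc _ = ∑ i, ∑ k, ∑ j, ∑ l, (P i k * (gram h p)⁻¹ i j * P j l) •
        b (L (stdVec k)) (L (stdVec l)) :=
        Finset.sum_congr rfl fun i _ => Finset.sum_comm
    _ = ∑ k, ∑ i, ∑ j, ∑ l, (P i k * (gram h p)⁻¹ i j * P j l) •
        b (L (stdVec k)) (L (stdVec l)) := Finset.sum_comm
    _ = ∑ k, ∑ i, ∑ l, ∑ j, (P i k * (gram h p)⁻¹ i j * P j l) •
        b (L (stdVec k)) (L (stdVec l)) :=
        Finset.sum_congr rfl fun k _ => Finset.sum_congr rfl fun i _ => Finset.sum_comm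
    _ = _ := Finset.sum_congr rfl fun k _ => Finset.sum_comm

/-- The metric trace in the coordinate basis of a chart. -/
lemma metricTrace_eq_chart (h : Metric n N) {W : Type*} [AddCommGroup W] [Module ℝ W]
    {e : OpenPartialHomeomorph N (Eu n)} (he : e ∈ Atl n N) {p : N} (hp : p ∈ e.source)
    (b : Tan n p →ₗ[ℝ] Tan n p →ₗ[ℝ] W) :
    metricTrace h p (fun u v => b u v)
      = ∑ i, ∑ j, (gramInChart h e (e p))⁻¹ i j
          • b (dChartInv e p (stdVec i)) (dChartInv e p (stdVec j)) := by
  have := metricTrace_eq_of_basis h p b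
    (LinearEquiv.ofLinearMap (dChartInv e p).toLinearMap (dChart e p).toLinearMap
      (by ext v; simp [dChartInv_dChart he hp])
      (LinearMap.ext fun v => dChart_dChartInv he hp v))
  rw [this]
  have h2 : (Matrix.of fun k l : Fin n =>
      h.inner p (dChartInv e p (stdVec k)) (dChartInv e p (stdVec l)))
      = gramInChart h e (e p) := by
    ext i j
    simp only [gramInChart, metricInChart, Matrix.of_apply]
    rw [e.left_inv hp]
  rw [← h2]
  rfl

end Trace

section Trace2

variable {N : Type*} [TopologicalSpace N] [ChartedSpace (Eu 2) N]
  [IsManifold 𝓘(ℝ, Eu 2) ∞ N]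

/-- The basis of a tangent plane given by two orthogonal vectors of equal length. -/
def orthoEquiv (h : Metric 2 N) (p : N) {r : ℝ} (hr : 0 < r)
    {u v : Tan 2 p} (huu : h.inner p u u = r) (hvv : h.inner p v v = r) (huv : h.inner p u v = 0) :
    Eu 2 ≃ₗ[ℝ] Tan 2 p :=
  haveI : FiniteDimensional ℝ (Tan 2 p) := inferInstanceAs (FiniteDimensional ℝ (Eu 2))
  LinearMap.linearEquivOfInjective (V₂ := Tan 2 p)
    ((EuclideanSpace.proj 0 : Eu 2 →L[ℝ] ℝ).toLinearMap.smulRight u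
      + (EuclideanSpace.proj 1 : Eu 2 →L[ℝ] ℝ).toLinearMap.smulRight v)
    (by
      rw [← LinearMap.ker_eq_bot, LinearMap.ker_eq_bot']
      intro x hx
      have hx' : x 0 • u + x 1 • v = (0 : Tan 2 p) := hx
      have h1 := congrArg (fun z => h.inner p z u) hx'
      have h2 := congrArg (fun z => h.inner p z v) hx'
      simp only [map_add, map_smul, add_apply, smul_apply, smul_eq_mul, map_zero, zero_apply,
        huu, hvv, huv, h.symm p v u] at h1 h2
      ext i
      fin_cases i
      · simpa [hr.ne'] using h1
      · simpa [hr.ne'] using h2) rfl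

lemma orthoEquiv_apply (h : Metric 2 N) (p : N) {r : ℝ} (hr : 0 < r)
    {u v : Tan 2 p} (huu : h.inner p u u = r) (hvv : h.inner p v v = r) (huv : h.inner p u v = 0)
    (x : Eu 2) : orthoEquiv h p hr huu hvv huv x = x 0 • u + x 1 • v := rfl

lemma metricTrace_eq_ortho (h : Metric 2 N) (p : N) {r : ℝ} (hr : 0 < r)
    {u v : Tan 2 p} (huu : h.inner p u u = r) (hvv : h.inner p v v = r) (huv : h.inner p u v = 0)
    {W : Type*} [AddCommGroup W] [Module ℝ W] (b : Tan 2 p →ₗ[ℝ] Tan 2 p →ₗ[ℝ] W) :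
    metricTrace h p (fun u v => b u v) = r⁻¹ • (b u u + b v v) := by
  rw [metricTrace_eq_of_basis h p b (orthoEquiv h p hr huu hvv huv)]
  have h0 : orthoEquiv h p hr huu hvv huv (stdVec 0) = u := by
    rw [orthoEquiv_apply]; simp [stdVec]
  have h1 : orthoEquiv h p hr huu hvv huv (stdVec 1) = v := by
    rw [orthoEquiv_apply]; simp [stdVec]
  have hm : (Matrix.of fun k l : Fin 2 => h.inner p (orthoEquiv h p hr huu hvv huv (stdVec k))
      (orthoEquiv h p hr huu hvv huv (stdVec l)))⁻¹ = Matrix.diagonal fun _ => r⁻¹ := by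
    have : (Matrix.of fun k l : Fin 2 => h.inner p (orthoEquiv h p hr huu hvv huv (stdVec k))
      (orthoEquiv h p hr huu hvv huv (stdVec l))) = Matrix.diagonal fun _ => r := by
      ext i j
      fin_cases i <;> fin_cases j <;> simp [h0, h1, huu, hvv, huv, h.symm p v u]
    rw [this]
    apply Matrix.inv_eq_right_inv
    rw [Matrix.diagonal_mul_diagonal]
    simp [hr.ne']
  rw [hm]
  simp [Fin.sum_univ_two, h0, h1]

end Trace2

/-! ### Tensor fields of type (0,2) and their covariant derivatives in a chart. -/

section Tensor

variable {m : ℕ} {M : Type*} [TopologicalSpace M] [ChartedSpace (Eu m) M]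

/-- A tensor field of type `(0,2)` in a chart. -/
def tensorForm (S : ∀ q : M, Tan m q →ₗ[ℝ] Tan m q →ₗ[ℝ] ℝ) (e : OpenPartialHomeomorph M (Eu m))
    (x : Eu m) : Eu m →L[ℝ] Eu m →L[ℝ] ℝ :=
  bilinOf fun v w => S (e.symm x) (dChartInv e (e.symm x) v) (dChartInv e (e.symm x) w)

lemma tensorForm_apply (S : ∀ q : M, Tan m q →ₗ[ℝ] Tan m q →ₗ[ℝ] ℝ)
    (e : OpenPartialHomeomorph M (Eu m)) (x v w : Eu m) :
    tensorForm S e x v w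
      = S (e.symm x) (dChartInv e (e.symm x) v) (dChartInv e (e.symm x) w) :=
  bilinOf_apply ((S (e.symm x)).compl₁₂ (dChartInv e (e.symm x)).toLinearMap
    (dChartInv e (e.symm x)).toLinearMap) v w

lemma tensorForm_dChart (S : ∀ q : M, Tan m q →ₗ[ℝ] Tan m q →ₗ[ℝ] ℝ)
    {e : OpenPartialHomeomorph M (Eu m)} (he : e ∈ Atl m M) {q : M} (hq : q ∈ e.source)
    (v w : Tan m q) : tensorForm S e (e q) (dChart e q v) (dChart e q w) = S q v w := by
  rw [tensorForm_apply, e.left_inv hq, dChartInv_dChart he hq, dChartInv_dChart he hq]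

variable [IsManifold 𝓘(ℝ, Eu m) ∞ M]

/-- The extensions of v and w have constant components in the preferred chart at q, so only the
coefficients of S are differentiated and the two connection terms are pure Christoffel terms. -/
lemma covDerivTensor_eq (g : Metric m M) (S : ∀ q : M, Tan m q →ₗ[ℝ] Tan m q →ₗ[ℝ] ℝ) (q : M)
    (hS : DifferentiableAt ℝ (tensorForm S (chartAt (Eu m) q)) (chartAt (Eu m) q q))
    (u v w : Tan m q) :
    covDerivTensor g (fun q v w => S q v w) q u v w =
      letI E := chartAt (Eu m) q
      fderiv ℝ (tensorForm S E) (E q) (dChart E q u) (dChart E q v) (dChart E q w)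
        - tensorForm S E (E q) (christForm g E (E q) (dChart E q u) (dChart E q v)) (dChart E q w)
        - tensorForm S E (E q) (dChart E q v)
            (christForm g E (E q) (dChart E q u) (dChart E q w)) := by
  have he : chartAt (Eu m) q ∈ Atl m M := chartAt_mem_atl q
  have hq := mem_chart_source (Eu m) q
  unfold covDerivTensor
  dsimp only
  set E := chartAt (Eu m) q
  have hW : DifferentiableAt ℝ (fun x => tensorForm S E x (dChart E q v) (dChart E q w)) (E q) :=
    (hS.clm_apply (differentiableAt_const _)).clm_apply (differentiableAt_const _)
  rw [mvfderiv_eq_of_eventuallyEq he hq (W := fun x => tensorForm S E x (dChart E q v)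
    (dChart E q w)) _ hW, fderiv_clm_const_apply₂ hS, leviCivita_localExt, leviCivita_localExt,
    ← tensorForm_dChart S he hq, ← tensorForm_dChart S he hq, dChart_dChartInv he hq,
    dChart_dChartInv he hq]
  filter_upwards [eventually_mem_chart_source (m := m) q] with y hy
  rw [← tensorForm_dChart S he hy, dChart_localExt q v hy, dChart_localExt q w hy]

end Tensor

/-! ### The shape operator and its smoothness. -/

section Shape

variable {m n : ℕ} {M N : Type*}
  [TopologicalSpace M] [ChartedSpace (Eu m) M] [IsManifold 𝓘(ℝ, Eu m) ∞ M]
  [TopologicalSpace N] [ChartedSpace (Eu n) N] [IsManifold 𝓘(ℝ, Eu n) ∞ N]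
  {g : Metric m M} {h : Metric n N} {φ : M → N}

lemma sffForm_add_left (e : OpenPartialHomeomorph M (Eu m)) (f : OpenPartialHomeomorph N (Eu n))
    (x u u' v : Eu m) :
    sffForm g h φ e f x (u + u') v = sffForm g h φ e f x u v + sffForm g h φ e f x u' v := by
  simp only [sffForm, hessAlong, map_add, add_apply]; abel

lemma sffForm_smul_left (e : OpenPartialHomeomorph M (Eu m)) (f : OpenPartialHomeomorph N (Eu n))
    (c : ℝ) (x u v : Eu m) :
    sffForm g h φ e f x (c • u) v = c • sffForm g h φ e f x u v := by
  simp only [sffForm, hessAlong, map_smul, smul_apply, smul_sub, smul_add]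

lemma sffForm_symm (hφ : ContMDiff 𝓘(ℝ, Eu m) 𝓘(ℝ, Eu n) ∞ φ)
    {e : OpenPartialHomeomorph M (Eu m)} (he : e ∈ Atl m M)
    {f : OpenPartialHomeomorph N (Eu n)} (hf : f ∈ Atl n N)
    {q : M} (hq : q ∈ e.source) (hfq : φ q ∈ f.source) (u v : Eu m) :
    sffForm g h φ e f (e q) u v = sffForm g h φ e f (e q) v u := by
  have hψ : ContDiffAt ℝ 2 (rep φ e f) (e q) := (contDiffAt_rep hφ he hf (e.map_source hq)
    (by rwa [e.left_inv hq])).of_le ENat.LEInfty.out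
  have hs : IsSymmSndFDerivAt ℝ (rep φ e f) (e q) := hψ.isSymmSndFDerivAt (by simp)
  have hy : rep φ e f (e q) ∈ f.target := by
    rw [rep, e.left_inv hq]; exact f.map_source hfq
  rw [sffForm, sffForm, hessAlong, hessAlong, hs.eq u v, christForm_symm h hf hy,
    christForm_symm g he (e.map_source hq) u v]

lemma contDiffAt_sffForm (hφ : ContMDiff 𝓘(ℝ, Eu m) 𝓘(ℝ, Eu n) ∞ φ)
    {e : OpenPartialHomeomorph M (Eu m)} (he : e ∈ Atl m M)
    {f : OpenPartialHomeomorph N (Eu n)} (hf : f ∈ Atl n N)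
    {q : M} (hq : q ∈ e.source) (hfq : φ q ∈ f.source) (u v : Eu m) :
    ContDiffAt ℝ ∞ (fun x => sffForm g h φ e f x u v) (e q) := by
  have hψ : ContDiffAt ℝ ∞ (rep φ e f) (e q) := contDiffAt_rep hφ he hf (e.map_source hq)
    (by rwa [e.left_inv hq])
  have hy : rep φ e f (e q) ∈ f.target := by
    rw [rep, e.left_inv hq]; exact f.map_source hfq
  have h1 : ContDiffAt ℝ ∞ (fderiv ℝ (rep φ e f)) (e q) := hψ.fderiv_right (by simp)
  have h2 : ContDiffAt ℝ ∞ (fderiv ℝ (fderiv ℝ (rep φ e f))) (e q) := h1.fderiv_right (by simp)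
  have h3 : ContDiffAt ℝ ∞ (fun x => christForm h f (rep φ e f x)) (e q) :=
    (contDiffAt_christForm h hf hy).comp (e q) hψ
  have h4 : ContDiffAt ℝ ∞ (christForm g e) (e q) := contDiffAt_christForm g he (e.map_source hq)
  have d : ∀ u, ContDiffAt ℝ ∞ (fun x => fderiv ℝ (rep φ e f) x u) (e q) :=
    fun u => h1.clm_apply contDiffAt_const
  exact (((h2.clm_apply contDiffAt_const).clm_apply contDiffAt_const).add
    ((h3.clm_apply (d u)).clm_apply (d v))).sub
    (h1.clm_apply ((h4.clm_apply contDiffAt_const).clm_apply contDiffAt_const))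

lemma secondFF_symm (hφ : IsRiemannianImmersion g h φ) (q : M) (u v : Tan m q) :
    secondFF g h φ q u v = secondFF g h φ q v u := by
  have he : chartAt (Eu m) q ∈ Atl m M := chartAt_mem_atl q
  have hf : chartAt (Eu n) (φ q) ∈ Atl n N := chartAt_mem_atl _
  rw [secondFF_eq hφ.smooth he hf (mem_chart_source _ _) (mem_chart_source _ _),
    secondFF_eq hφ.smooth he hf (mem_chart_source _ _) (mem_chart_source _ _),
    sffForm_symm hφ.smooth he hf (mem_chart_source _ _) (mem_chart_source _ _)]

lemma secondFF_add_left (hφ : IsRiemannianImmersion g h φ) (q : M) (u u' v : Tan m q) :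
    secondFF g h φ q (u + u') v = secondFF g h φ q u v + secondFF g h φ q u' v := by
  have he : chartAt (Eu m) q ∈ Atl m M := chartAt_mem_atl q
  have hf : chartAt (Eu n) (φ q) ∈ Atl n N := chartAt_mem_atl _
  simp only [secondFF_eq hφ.smooth he hf (mem_chart_source _ _) (mem_chart_source _ _), map_add,
    sffForm_add_left]

lemma secondFF_smul_left (hφ : IsRiemannianImmersion g h φ) (q : M) (c : ℝ) (u v : Tan m q) :
    secondFF g h φ q (c • u) v = c • secondFF g h φ q u v := by
  have he : chartAt (Eu m) q ∈ Atl m M := chartAt_mem_atl q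
  have hf : chartAt (Eu n) (φ q) ∈ Atl n N := chartAt_mem_atl _
  simp only [secondFF_eq hφ.smooth he hf (mem_chart_source _ _) (mem_chart_source _ _), map_smul,
    sffForm_smul_left]

/-- The second fundamental form as a bilinear map. -/
def secondFFL (hφ : IsRiemannianImmersion g h φ) (q : M) :
    Tan m q →ₗ[ℝ] Tan m q →ₗ[ℝ] Tan n (φ q) :=
  LinearMap.mk₂ ℝ (secondFF g h φ q) (secondFF_add_left hφ q) (secondFF_smul_left hφ q)
    (fun u v v' => by simp only [secondFF_symm hφ q u, secondFF_add_left hφ])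
    (fun c u v => by simp only [secondFF_symm hφ q u, secondFF_smul_left hφ])

@[simp] lemma secondFFL_apply (hφ : IsRiemannianImmersion g h φ) (q : M) (u v : Tan m q) :
    secondFFL hφ q u v = secondFF g h φ q u v := rfl

/-- The bilinear form `⟨A_H u, v⟩ = ⟨B(u, v), H⟩`. -/
def shapeForm (hφ : IsRiemannianImmersion g h φ) (q : M) : Tan m q →ₗ[ℝ] Tan m q →ₗ[ℝ] ℝ :=
  (secondFFL hφ q).compr₂ (h.inner (φ q) (meanCurvature g h φ q)).toLinearMap

lemma shapeForm_apply (hφ : IsRiemannianImmersion g h φ) (q : M) (u v : Tan m q) :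
    shapeForm hφ q u v = h.inner (φ q) (secondFF g h φ q u v) (meanCurvature g h φ q) :=
  h.symm _ _ _

lemma shapeForm_symm (hφ : IsRiemannianImmersion g h φ) (q : M) (u v : Tan m q) :
    shapeForm hφ q u v = shapeForm hφ q v u := by
  rw [shapeForm_apply, shapeForm_apply, secondFF_symm hφ]

/-- The mean curvature vector field in charts. -/
def meanRep (g : Metric m M) (h : Metric n N) (φ : M → N) (e : OpenPartialHomeomorph M (Eu m))
    (f : OpenPartialHomeomorph N (Eu n)) (x : Eu m) : Eu n :=
  (1 / (m : ℝ)) • ∑ i, ∑ j, (gramInChart g e x)⁻¹ i j • sffForm g h φ e f x (stdVec i) (stdVec j)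

lemma dChart_meanCurvature (hφ : IsRiemannianImmersion g h φ)
    {e : OpenPartialHomeomorph M (Eu m)} (he : e ∈ Atl m M)
    {f : OpenPartialHomeomorph N (Eu n)} (hf : f ∈ Atl n N)
    {q : M} (hq : q ∈ e.source) (hfq : φ q ∈ f.source) :
    dChart f (φ q) (meanCurvature g h φ q) = meanRep g h φ e f (e q) := by
  have h1 : metricTrace g q (secondFF g h φ q) = _ := metricTrace_eq_chart g he hq (secondFFL hφ q)
  rw [meanCurvature, h1, meanRep]
  simp only [map_smul, map_sum, secondFFL_apply, secondFF_eq hφ.smooth he hf hq hfq,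
    dChart_dChartInv hf hfq, dChart_dChartInv he hq]

lemma contDiffAt_meanRep (hφ : IsRiemannianImmersion g h φ)
    {e : OpenPartialHomeomorph M (Eu m)} (he : e ∈ Atl m M)
    {f : OpenPartialHomeomorph N (Eu n)} (hf : f ∈ Atl n N)
    {q : M} (hq : q ∈ e.source) (hfq : φ q ∈ f.source) :
    ContDiffAt ℝ ∞ (meanRep g h φ e f) (e q) := by
  unfold meanRep
  refine ContDiffAt.fun_smul contDiffAt_const (ContDiffAt.sum fun i _ => ContDiffAt.sum fun j _ =>
    ContDiffAt.fun_smul ?_ (contDiffAt_sffForm hφ.smooth he hf hq hfq _ _))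
  exact (contDiffOn_gramInv g he i j).contDiffAt (e.open_target.mem_nhds (e.map_source hq))

/-- Smoothness is local, so each point may use its own chart of N around the image. There the form
is the metric of N along φ applied to the chart expressions of B and H, all of which are smooth. -/
lemma contDiffOn_shapeForm (hφ : IsRiemannianImmersion g h φ)
    {e : OpenPartialHomeomorph M (Eu m)} (he : e ∈ Atl m M) :
    ContDiffOn ℝ ∞ (tensorForm (shapeForm hφ) e) e.target := by
  refine contDiffOn_bilinOf fun i j x hx => ContDiffAt.contDiffWithinAt ?_
  set q := e.symm x with hqdef
  have hq : q ∈ e.source := e.map_target hx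
  have hxq : e q = x := e.right_inv hx
  set f := chartAt (Eu n) (φ q)
  have hf : f ∈ Atl n N := chartAt_mem_atl _
  have hfq : φ q ∈ f.source := mem_chart_source _ _
  have hψ : ContDiffAt ℝ ∞ (rep φ e f) (e q) :=
    contDiffAt_rep hφ.smooth he hf (e.map_source hq) (by rwa [e.left_inv hq])
  have hy : rep φ e f (e q) ∈ f.target := by
    rw [rep, e.left_inv hq]; exact f.map_source hfq
  have h1 : ContDiffAt ℝ ∞ (fun x => metricForm h f (rep φ e f x)) (e q) :=
    (contDiffAt_metricForm h hf hy).comp (e q) hψ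
  have h2 := (h1.clm_apply (contDiffAt_sffForm (g := g) (h := h) hφ.smooth he hf hq hfq
    (stdVec i) (stdVec j))).clm_apply (contDiffAt_meanRep (g := g) (h := h) hφ he hf hq hfq)
  rw [← hxq]
  refine h2.congr_of_eventuallyEq ?_
  filter_upwards [rep_nhds hφ.smooth.continuous hq hfq] with y hy
  have hys := e.map_target hy.1
  have h3 := dChart_meanCurvature hφ he hf hys hy.2
  rw [e.right_inv hy.1] at h3
  rw [shapeForm_apply, secondFF_eq hφ.smooth he hf hys hy.2, inner_eq_metricForm h hf hy.2,
    dChart_dChartInv hf hy.2, dChart_dChartInv he hys, dChart_dChartInv he hys, h3,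
    e.right_inv hy.1]
  rfl

end Shape

/-! ### Weingarten's formula and the stress-bienergy tensor. -/

section Weingarten

variable {m n : ℕ} {M N : Type*}
  [TopologicalSpace M] [ChartedSpace (Eu m) M] [IsManifold 𝓘(ℝ, Eu m) ∞ M]
  [TopologicalSpace N] [ChartedSpace (Eu n) N] [IsManifold 𝓘(ℝ, Eu n) ∞ N]
  {g : Metric m M} {h : Metric n N} {φ : M → N}

/-- Weingarten's formula for a normal vector field. -/
lemma inner_dMap_covDerivAlong (hφ : IsRiemannianImmersion g h φ) {V : ∀ q : M, Tan n (φ q)}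
    (hn : ∀ (q : M) (w : Tan m q), h.inner (φ q) (V q) (dMap φ q w) = 0) {q : M} {W : Eu m → Eu n}
    (hW : DifferentiableAt ℝ W (chartAt (Eu m) q q))
    (hV : ∀ᶠ y in nhds q, dChart (chartAt (Eu n) (φ q)) (φ y) (V y) = W (chartAt (Eu m) q y))
    (X Y : Tan m q) :
    h.inner (φ q) (dMap φ q X) (covDerivAlong h φ V q Y)
      = - h.inner (φ q) (secondFF g h φ q Y X) (V q) := by
  have he : chartAt (Eu m) q ∈ Atl m M := chartAt_mem_atl q
  have hf : chartAt (Eu n) (φ q) ∈ Atl n N := chartAt_mem_atl _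
  have hq : q ∈ (chartAt (Eu m) q).source := mem_chart_source _ q
  have hfq : φ q ∈ (chartAt (Eu n) (φ q)).source := mem_chart_source _ (φ q)
  have hnq := hn q
  rw [covDerivAlong_eq h he hq hW hV, secondFF_eq hφ.smooth he hf hq hfq]
  set e := chartAt (Eu m) q
  set f := chartAt (Eu n) (φ q)
  set ψ := rep φ e f with hψdef
  have hψ : ContDiffAt ℝ 2 ψ (e q) := (contDiffAt_rep hφ.smooth he hf (e.map_source hq)
    (by rwa [e.left_inv hq])).of_le ENat.LEInfty.out
  have hψq : ψ (e q) = f (φ q) := by simp only [hψdef, rep, e.left_inv hq]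
  have hy : ψ (e q) ∈ f.target := by rw [hψq]; exact f.map_source hfq
  have hVq : dChart f (φ q) (V q) = W (e q) := hV.self_of_nhds
  have hdψ : ∀ w : Tan m q, dChart f (φ q) (dMap φ q w) = fderiv ℝ ψ (e q) (dChart e q w) := by
    intro w
    rw [hψdef, fderiv_rep hφ.smooth he hf hq hfq, dChartInv_dChart he hq]
  -- The pairing of V with the coordinate field dψ(X) vanishes identically near the point.
  -- Differentiating this in the direction Y with metric compatibility gives Weingarten's formula.
  have hev : (fun x => metricForm h f (ψ x) (W x) (fderiv ℝ ψ x (dChart e q X)))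
      =ᶠ[nhds (e q)] fun _ => (0 : ℝ) := by
    have h1 : ∀ᶠ x in nhds (e q), dChart f (φ (e.symm x)) (V (e.symm x)) = W (e (e.symm x)) := by
      have := e.continuousAt_symm (e.map_source hq)
      rw [ContinuousAt, e.left_inv hq] at this
      exact this hV
    filter_upwards [h1, rep_nhds hφ.smooth.continuous hq hfq] with x h2 hx
    rw [e.right_inv hx.1] at h2
    have h3 := e.map_target hx.1
    have h4 := hn (e.symm x) (dChartInv e (e.symm x) (dChart e q X))
    rw [inner_eq_metricForm h hf hx.2, ← fderiv_rep hφ.smooth he hf h3 hx.2, e.right_inv hx.1,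
      h2] at h4
    exact h4
  have hdd : DifferentiableAt ℝ (fderiv ℝ ψ) (e q) :=
    (hψ.fderiv_right (m := 1) (by norm_num)).differentiableAt (by simp)
  have hG := differentiableAt_comp_and_fderiv (differentiableAt_metricForm h hf hy)
    (hψ.differentiableAt (by simp))
  have h5 : fderiv ℝ (fun x => metricForm h f (ψ x) (W x) (fderiv ℝ ψ x (dChart e q X))) (e q)
      (dChart e q Y) = 0 := by
    rw [hev.fderiv_eq]; simp
  rw [fderiv_clm_apply₂ hG.1 hW (hdd.clm_apply (differentiableAt_const _)), hG.2,
    fderiv_fderiv_apply_const hdd, fderiv_metricForm h hf hy] at h5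
  have h6 : ∀ z, metricForm h f (ψ (e q)) (W (e q)) (fderiv ℝ ψ (e q) z) = 0 := by
    intro z
    have := hnq (dChartInv e q z)
    rw [inner_eq_metricForm h hf hfq, hdψ, dChart_dChartInv he hq, ← hψq, hVq] at this
    exact this
  rw [inner_eq_metricForm h hf hfq, inner_eq_metricForm h hf hfq, dChart_dChartInv hf hfq,
    dChart_dChartInv hf hfq, hVq, hdψ, hdψ, ← hψq, metricForm_symm h f (ψ (e q)) (fderiv ℝ ψ (e q) _),
    metricForm_symm h f (ψ (e q)) _ (W (e q)), sffForm, hessAlong, ← hψdef, map_sub, h6, map_add,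
    map_add, add_apply]
  linarith

lemma inner_meanCurvature_dMap (hφ : IsRiemannianImmersion g h φ) (q : M) (w : Tan m q) :
    h.inner (φ q) (meanCurvature g h φ q) (dMap φ q w) = 0 := by
  simp only [meanCurvature, metricTrace, map_smul, map_sum, sum_apply, smul_apply,
    inner_secondFF_dMap hφ, smul_zero, Finset.sum_const_zero]

lemma tension_eq (hm : m ≠ 0) (q : M) :
    tension g h φ q = (m : ℝ) • meanCurvature g h φ q := by
  have : (m : ℝ) ≠ 0 := Nat.cast_ne_zero.2 hm
  rw [tension, meanCurvature, smul_smul, mul_one_div_cancel this, one_smul]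

lemma inner_dMap_covDerivAlong_tension (hφ : IsRiemannianImmersion g h φ) (hm : m ≠ 0) (q : M)
    (X Y : Tan m q) :
    h.inner (φ q) (dMap φ q X) (covDerivAlong h φ (tension g h φ) q Y)
      = - (m : ℝ) * shapeForm hφ q X Y := by
  have he : chartAt (Eu m) q ∈ Atl m M := chartAt_mem_atl q
  have hf : chartAt (Eu n) (φ q) ∈ Atl n N := chartAt_mem_atl _
  have hq : q ∈ (chartAt (Eu m) q).source := mem_chart_source _ q
  have hfq : φ q ∈ (chartAt (Eu n) (φ q)).source := mem_chart_source _ (φ q)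
  rw [inner_dMap_covDerivAlong (V := tension g h φ) hφ
    (W := fun x => (m : ℝ) • meanRep g h φ (chartAt (Eu m) q) (chartAt (Eu n) (φ q)) x)]
  · rw [tension_eq hm, map_smul, shapeForm_apply, secondFF_symm hφ q Y X, smul_eq_mul, neg_mul]
  · intro q w
    rw [tension_eq hm, map_smul, smul_apply, inner_meanCurvature_dMap hφ, smul_zero]
  · exact ((contDiffAt_meanRep hφ he hf hq hfq).differentiableAt (by simp)).const_smul (m : ℝ)
  · have hs : ∀ᶠ y in nhds q, φ y ∈ (chartAt (Eu n) (φ q)).source :=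
      hφ.smooth.continuous.continuousAt ((chartAt (Eu n) (φ q)).open_source.mem_nhds hfq)
    filter_upwards [eventually_mem_chart_source (m := m) q, hs] with y hy hy'
    rw [tension_eq hm, map_smul, dChart_meanCurvature hφ he hf hy hy']

lemma metricTrace_shapeForm (hφ : IsRiemannianImmersion g h φ) (hm : m ≠ 0) (q : M) :
    metricTrace g q (fun u v => shapeForm hφ q u v)
      = m * h.inner (φ q) (meanCurvature g h φ q) (meanCurvature g h φ q) := by
  have : m * h.inner (φ q) (meanCurvature g h φ q) (meanCurvature g h φ q)
      = h.inner (φ q) (tension g h φ q) (meanCurvature g h φ q) := by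
    rw [tension_eq hm, map_smul, smul_apply, smul_eq_mul]
  rw [this, tension]
  simp only [metricTrace, shapeForm_apply, map_sum, map_smul, sum_apply, smul_apply]

/-- Since τ = mH is normal, Weingarten gives ⟨dφ X, ∇_Y τ⟩ = -m⟨A_H X, Y⟩, so the last two terms add
up to 2m A_H. The scalar coefficient of the metric is m²|H|²/2 - m²|H|², because A_H has trace
m|H|². -/
lemma stressBienergy_eq (hφ : IsRiemannianImmersion g h φ) (hm : m ≠ 0) (q : M) (X Y : Tan m q) :
    stressBienergy g h φ q X Y
      = 2 * m * shapeForm hφ q X Y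
        - (m : ℝ) ^ 2 / 2 * h.inner (φ q) (meanCurvature g h φ q) (meanCurvature g h φ q)
          * g.inner q X Y := by
  unfold stressBienergy
  simp only [inner_dMap_covDerivAlong_tension hφ hm]
  have h1 : metricTrace g q (fun u v => -(m : ℝ) * shapeForm hφ q u v)
      = -(m : ℝ) * metricTrace g q (fun u v => shapeForm hφ q u v) := by
    simp only [metricTrace, Finset.mul_sum, smul_eq_mul]
    exact Finset.sum_congr rfl fun i _ => Finset.sum_congr rfl fun j _ => by ring
  rw [h1, metricTrace_shapeForm hφ hm, shapeForm_symm hφ q Y X, tension_eq hm]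
  simp only [map_smul, smul_apply, smul_eq_mul]
  ring

lemma meanCurvatureNorm_sq (q : M) :
    meanCurvatureNorm g h φ q ^ 2
      = h.inner (φ q) (meanCurvature g h φ q) (meanCurvature g h φ q) := by
  apply Real.sq_sqrt
  by_cases h0 : meanCurvature g h φ q = 0
  · simp [h0]
  · exact (h.pos _ _ h0).le

end Weingarten

/-! ### Symmetric bilinear forms on the plane. -/

section Algebra

lemma eu_two_eq (v : Eu 2) : v = v 0 • (stdVec 0 : Eu 2) + v 1 • (stdVec 1 : Eu 2) := by
  conv_lhs => rw [← sum_stdVec v]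
  rw [Fin.sum_univ_two]

/-- The determinant of a symmetric bilinear form on the plane. -/
def detForm (B : Eu 2 →L[ℝ] Eu 2 →L[ℝ] ℝ) : ℝ :=
  B (stdVec 0) (stdVec 0) * B (stdVec 1) (stdVec 1) - B (stdVec 0) (stdVec 1) ^ 2

/-- A positive multiple of the trace of `A` with respect to the form `G` on the plane. -/
def trForm (G A : Eu 2 →L[ℝ] Eu 2 →L[ℝ] ℝ) : ℝ :=
  G (stdVec 1) (stdVec 1) * A (stdVec 0) (stdVec 0)
    - 2 * G (stdVec 0) (stdVec 1) * A (stdVec 0) (stdVec 1)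
    + G (stdVec 0) (stdVec 0) * A (stdVec 1) (stdVec 1)

lemma form_apply_coord {B : Eu 2 →L[ℝ] Eu 2 →L[ℝ] ℝ} (hs : ∀ a b, B a b = B b a) (a b : Eu 2) :
    B a b = a 0 * b 0 * B (stdVec 0) (stdVec 0)
      + (a 0 * b 1 + a 1 * b 0) * B (stdVec 0) (stdVec 1)
      + a 1 * b 1 * B (stdVec 1) (stdVec 1) := by
  conv_lhs => rw [eu_two_eq a, eu_two_eq b]
  simp only [map_add, map_smul, add_apply, smul_apply, smul_eq_mul, hs (stdVec 1) (stdVec 0)]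
  ring

/-- A symmetric form with zero determinant has rank one. -/
lemma mul_eq_of_detForm_eq_zero {B : Eu 2 →L[ℝ] Eu 2 →L[ℝ] ℝ} (hs : ∀ a b, B a b = B b a)
    (hd : detForm B = 0) (v a b : Eu 2) : B a b * B v v = B v a * B v b := by
  rw [form_apply_coord hs a b, form_apply_coord hs v v, form_apply_coord hs v a,
    form_apply_coord hs v b]
  unfold detForm at hd
  -- The difference of the two sides is det B times the two minors of the pairs (a, v) and (b, v).
  linear_combination (a 0 * v 1 - a 1 * v 0) * (b 0 * v 1 - b 1 * v 0) * hd

variable {G A : Eu 2 →L[ℝ] Eu 2 →L[ℝ] ℝ}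

lemma stdVec_ne_zero (i : Fin 2) : (stdVec i : Eu 2) ≠ 0 := by
  intro h0
  have := congrArg (fun z : Eu 2 => z i) h0
  simp [stdVec] at this

/-- Gram-Schmidt: with w = e₁ - (G₀₁/G₀₀) e₀, the determinant equals G₀₀ · G(w, w). -/
lemma detForm_pos (hG : ∀ v, v ≠ 0 → 0 < G v v) (hs : ∀ a b, G a b = G b a) : 0 < detForm G := by
  have h0 := hG _ (stdVec_ne_zero 0)
  have hv : (stdVec 1 : Eu 2) - (G (stdVec 0) (stdVec 1) / G (stdVec 0) (stdVec 0)) •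
      (stdVec 0 : Eu 2) ≠ 0 := by
    intro h0
    have := congrArg (fun z : Eu 2 => z 1) h0
    simp [stdVec] at this
  have h1 := hG _ hv
  simp only [map_sub, map_smul, sub_apply, smul_apply, smul_eq_mul, hs (stdVec 1) (stdVec 0)] at h1
  unfold detForm
  have h2 : G (stdVec 0) (stdVec 0) * (G (stdVec 1) (stdVec 1)
      - G (stdVec 0) (stdVec 1) ^ 2 / G (stdVec 0) (stdVec 0)) =
      G (stdVec 0) (stdVec 0) * G (stdVec 1) (stdVec 1) - G (stdVec 0) (stdVec 1) ^ 2 := by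
    field_simp
  rw [← h2]
  apply mul_pos h0
  have h3 : ∀ x y z : ℝ, x ≠ 0 → z - y ^ 2 / x = z - y / x * y - (y / x * (y - y / x * x)) := by
    intro x y z hx
    field_simp
    ring
  have h4 := h3 _ (G (stdVec 0) (stdVec 1)) (G (stdVec 1) (stdVec 1)) h0.ne'
  rw [h4]
  linarith

/-- A nonzero trace-free form has negative determinant. -/
lemma detForm_neg (hG : ∀ v, v ≠ 0 → 0 < G v v) (hs : ∀ a b, G a b = G b a)
    (hA : ∀ a b, A a b = A b a) (ht : trForm G A = 0) (h0 : A ≠ 0) : detForm A < 0 := by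
  have hd := detForm_pos hG hs
  have hg := hG _ (stdVec_ne_zero 0)
  unfold trForm at ht
  unfold detForm at hd ⊢
  set a := A (stdVec 0) (stdVec 0) with ha
  set b := A (stdVec 0) (stdVec 1) with hb
  set c := A (stdVec 1) (stdVec 1) with hc
  set x := G (stdVec 0) (stdVec 0) with hx
  set y := G (stdVec 0) (stdVec 1) with hy
  set z := G (stdVec 1) (stdVec 1) with hz
  -- Eliminating c by the trace condition x c = 2 y b - z a and completing the square exhibits x²
  -- det A as minus a sum of two nonnegative terms. Both must vanish if det A ≥ 0, which forces A =
  -- 0.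
  have key : x ^ 2 * (a * c - b ^ 2) = - ((x * b - y * a) ^ 2 + (x * z - y ^ 2) * a ^ 2) := by
    linear_combination x * a * ht
  by_contra hcon
  push Not at hcon
  have h1 : (x * b - y * a) ^ 2 + (x * z - y ^ 2) * a ^ 2 ≤ 0 := by
    have := mul_nonneg (sq_nonneg x) hcon
    linarith
  have h2 : 0 ≤ (x * z - y ^ 2) * a ^ 2 := mul_nonneg hd.le (sq_nonneg a)
  have ha0 : a = 0 := by
    have h3 : (x * z - y ^ 2) * a ^ 2 = 0 :=
      le_antisymm (by linarith [sq_nonneg (x * b - y * a)]) h2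
    simpa [hd.ne'] using h3
  have hb0 : b = 0 := by
    have h3 : (x * b - y * a) ^ 2 = 0 :=
      le_antisymm (by linarith) (sq_nonneg _)
    rw [ha0] at h3
    simpa [hg.ne'] using h3
  have hc0 : c = 0 := by
    rw [ha0, hb0] at ht
    simpa [hg.ne'] using ht
  apply h0
  ext v w
  rw [form_apply_coord hA, ← ha, ← hb, ← hc, ha0, hb0, hc0]
  simp

/-- A form of rank one with positive trace is positive on a basis vector. -/
lemma exists_pos_of_trForm_pos (hG : ∀ v, v ≠ 0 → 0 < G v v) (hs : ∀ a b, G a b = G b a)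
    (hd : detForm A = 0) (ht : 0 < trForm G A) : ∃ v : Eu 2, 0 < A v v := by
  have hdG := detForm_pos hG hs
  have hg := hG _ (stdVec_ne_zero 0)
  by_contra! hcon
  have h1 := hcon (stdVec 0)
  have h2 := hcon (stdVec 1)
  unfold trForm at ht
  unfold detForm at hd hdG
  set a := A (stdVec 0) (stdVec 0)
  set b := A (stdVec 0) (stdVec 1)
  set c := A (stdVec 1) (stdVec 1)
  set x := G (stdVec 0) (stdVec 0)
  set y := G (stdVec 0) (stdVec 1)
  set z := G (stdVec 1) (stdVec 1)
  rcases h1.eq_or_lt with ha | ha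
  · have hb : b = 0 := by
      rw [ha] at hd
      simpa using hd
    rw [ha, hb] at ht
    nlinarith
  -- When a < 0, the positive trace multiplied by x a is negative, yet the relation a c = b² makes
  -- it a sum of nonnegative terms.
  · have h3 : x * (a * (z * a - 2 * y * b + x * c)) = (x * b - y * a) ^ 2
        + (x * z - y ^ 2) * a ^ 2 := by linear_combination x ^ 2 * hd
    have h4 : x * (a * (z * a - 2 * y * b + x * c)) < 0 :=
      mul_neg_of_pos_of_neg hg (mul_neg_of_neg_of_pos ha ht)
    have h5 : 0 ≤ (x * z - y ^ 2) * a ^ 2 := mul_nonneg hdG.le (sq_nonneg a)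
    linarith [sq_nonneg (x * b - y * a)]

end Algebra

/-! ### Simultaneous diagonalization by a smooth coframe. -/

section Coframe

lemma contDiffOn_form_apply {G : Eu 2 → Eu 2 →L[ℝ] Eu 2 →L[ℝ] ℝ} {s : Set (Eu 2)}
    (hG : ContDiffOn ℝ ∞ G s) (a b : Eu 2) : ContDiffOn ℝ ∞ (fun x => G x a b) s :=
  (hG.clm_apply contDiffOn_const).clm_apply contDiffOn_const

lemma contDiffOn_detForm {G : Eu 2 → Eu 2 →L[ℝ] Eu 2 →L[ℝ] ℝ} {s : Set (Eu 2)}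
    (hG : ContDiffOn ℝ ∞ G s) : ContDiffOn ℝ ∞ (fun x => detForm (G x)) s := by
  unfold detForm
  exact ((contDiffOn_form_apply hG _ _).mul (contDiffOn_form_apply hG _ _)).sub
    ((contDiffOn_form_apply hG _ _).pow 2)

/-- A trace-free symmetric form `A` and a metric `G` are simultaneously diagonalized, near a point
where `A ≠ 0`, by smooth forms `ω₁, ω₂`, so that `μ G = ω₁² + ω₂²` and `2 A = ω₁² - ω₂²`. -/
lemma exists_coframe {G A : Eu 2 → Eu 2 →L[ℝ] Eu 2 →L[ℝ] ℝ} {s : Set (Eu 2)} (hso : IsOpen s)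
    (hG : ContDiffOn ℝ ∞ G s) (hA : ContDiffOn ℝ ∞ A s)
    (hGs : ∀ x a b, G x a b = G x b a) (hAs : ∀ x a b, A x a b = A x b a)
    (hGp : ∀ x ∈ s, ∀ v, v ≠ 0 → 0 < G x v v) (ht : ∀ x ∈ s, trForm (G x) (A x) = 0)
    {x₀ : Eu 2} (hx₀ : x₀ ∈ s) (h0 : A x₀ ≠ 0) :
    ∃ r > 0, Metric.ball x₀ r ⊆ s ∧ ∃ (μ : Eu 2 → ℝ) (ω₁ ω₂ : Eu 2 → Eu 2 →L[ℝ] ℝ),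
      ContDiffOn ℝ ∞ μ (Metric.ball x₀ r) ∧ ContDiffOn ℝ ∞ ω₁ (Metric.ball x₀ r) ∧
      ContDiffOn ℝ ∞ ω₂ (Metric.ball x₀ r) ∧ ∀ x ∈ Metric.ball x₀ r, 0 < μ x ∧ ∀ a b,
        μ x * G x a b = ω₁ x a * ω₁ x b + ω₂ x a * ω₂ x b ∧
        2 * A x a b = ω₁ x a * ω₁ x b - ω₂ x a * ω₂ x b := by
  -- The eigenvalues of A with respect to G have sum zero and product det A / det G, so they are
  -- ±√(-det A / det G) and μ is their difference. Subtracting one of them from A degenerates it: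
  -- det((μ/2)G ± A) = (μ/2)² det G + det A ± (μ/2) `trForm G A` = 0.
  set μ : Eu 2 → ℝ := fun x => 2 * √(-detForm (A x) / detForm (G x)) with hμ
  set P : Eu 2 → Eu 2 →L[ℝ] Eu 2 →L[ℝ] ℝ := fun x => (μ x / 2) • G x + A x with hP
  set Q : Eu 2 → Eu 2 →L[ℝ] Eu 2 →L[ℝ] ℝ := fun x => (μ x / 2) • G x - A x with hQ
  have hPs : ∀ x a b, P x a b = P x b a := by
    intro x a b
    simp only [hP, add_apply, smul_apply, hGs x a b, hAs x a b]
  have hQs : ∀ x a b, Q x a b = Q x b a := by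
    intro x a b
    simp only [hQ, sub_apply, smul_apply, hGs x a b, hAs x a b]
  have hdG : ∀ x ∈ s, 0 < detForm (G x) := fun x hx => detForm_pos (hGp x hx) (hGs x)
  have hμsq : ∀ x ∈ s, detForm (A x) < 0 →
      (μ x / 2) ^ 2 * detForm (G x) + detForm (A x) = 0 := by
    intro x hx hd
    have h1 := hdG x hx
    have h2 : 0 ≤ -detForm (A x) / detForm (G x) := div_nonneg (by linarith) h1.le
    have h3 : μ x / 2 = √(-detForm (A x) / detForm (G x)) := by simp only [hμ]; ring
    rw [h3, Real.sq_sqrt h2]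
    field_simp
    ring
  have hμpos : ∀ x ∈ s, detForm (A x) < 0 → 0 < μ x := by
    intro x hx hd
    exact mul_pos two_pos (Real.sqrt_pos.2 (div_pos (by linarith) (hdG x hx)))
  have hdP : ∀ x ∈ s, detForm (A x) < 0 → detForm (P x) = 0 := by
    intro x hx hd
    have h1 := hμsq x hx hd
    have h2 := ht x hx
    simp only [detForm, trForm, hP, add_apply, smul_apply, smul_eq_mul] at h1 h2 ⊢
    linear_combination h1 + (μ x / 2) * h2
  have hdQ : ∀ x ∈ s, detForm (A x) < 0 → detForm (Q x) = 0 := by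
    intro x hx hd
    have h1 := hμsq x hx hd
    have h2 := ht x hx
    simp only [detForm, trForm, hQ, sub_apply, smul_apply, smul_eq_mul] at h1 h2 ⊢
    linear_combination h1 - (μ x / 2) * h2
  have hd₀ : detForm (A x₀) < 0 := detForm_neg (hGp x₀ hx₀) (hGs x₀) (hAs x₀) (ht x₀ hx₀) h0
  have htP : 0 < trForm (G x₀) (P x₀) := by
    have h2 := ht x₀ hx₀
    have : trForm (G x₀) (P x₀) = μ x₀ * detForm (G x₀) := by
      simp only [detForm, trForm, hP, add_apply, smul_apply, smul_eq_mul] at h2 ⊢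
      linear_combination h2
    rw [this]
    exact mul_pos (hμpos x₀ hx₀ hd₀) (hdG x₀ hx₀)
  have htQ : 0 < trForm (G x₀) (Q x₀) := by
    have h2 := ht x₀ hx₀
    have : trForm (G x₀) (Q x₀) = μ x₀ * detForm (G x₀) := by
      simp only [detForm, trForm, hQ, sub_apply, smul_apply, smul_eq_mul] at h2 ⊢
      linear_combination -h2
    rw [this]
    exact mul_pos (hμpos x₀ hx₀ hd₀) (hdG x₀ hx₀)
  -- The vectors v and w are chosen at x₀ only and then kept constant; P(v, v) > 0 and Q(w, w) > 0
  -- persist on a small ball.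
  obtain ⟨v, hv⟩ := exists_pos_of_trForm_pos (hGp x₀ hx₀) (hGs x₀) (hdP x₀ hx₀ hd₀) htP
  obtain ⟨w, hw⟩ := exists_pos_of_trForm_pos (hGp x₀ hx₀) (hGs x₀) (hdQ x₀ hx₀ hd₀) htQ
  have hdA := contDiffOn_detForm hA
  have hopen1 : IsOpen (s ∩ {x | detForm (A x) < 0}) :=
    hdA.continuousOn.isOpen_inter_preimage hso isOpen_Iio
  set s₁ := s ∩ {x | detForm (A x) < 0} with hs₁
  have hss : s₁ ⊆ s := Set.inter_subset_left
  have hμc : ContDiffOn ℝ ∞ μ s₁ := by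
    refine contDiffOn_const.mul (ContDiffOn.sqrt ?_ ?_)
    · exact (hdA.mono hss).neg.div ((contDiffOn_detForm hG).mono hss)
        fun x hx => (hdG x hx.1).ne'
    · intro x hx
      have h2 : detForm (A x) < 0 := hx.2
      exact (div_pos (by linarith) (hdG x hx.1)).ne'
  have hμh : ContDiffOn ℝ ∞ (fun x => μ x / 2) s₁ := hμc.div_const 2
  have hPc : ContDiffOn ℝ ∞ P s₁ := (hμh.smul (hG.mono hss)).add (hA.mono hss)
  have hQc : ContDiffOn ℝ ∞ Q s₁ := (hμh.smul (hG.mono hss)).sub (hA.mono hss)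
  have hPv := contDiffOn_form_apply hPc v v
  have hQw := contDiffOn_form_apply hQc w w
  have hopen2 : IsOpen (s₁ ∩ {x | 0 < P x v v}) :=
    hPv.continuousOn.isOpen_inter_preimage hopen1 isOpen_Ioi
  have hopen3 : IsOpen (s₁ ∩ {x | 0 < Q x w w}) :=
    hQw.continuousOn.isOpen_inter_preimage hopen1 isOpen_Ioi
  obtain ⟨r, hr, hball⟩ := Metric.isOpen_iff.1 (hopen2.inter hopen3) x₀
    ⟨⟨⟨hx₀, hd₀⟩, hv⟩, ⟨⟨hx₀, hd₀⟩, hw⟩⟩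
  have hb1 : Metric.ball x₀ r ⊆ s₁ := fun x hx => (hball hx).1.1
  have hbP : ∀ x ∈ Metric.ball x₀ r, 0 < P x v v := fun x hx => (hball hx).1.2
  have hbQ : ∀ x ∈ Metric.ball x₀ r, 0 < Q x w w := fun x hx => (hball hx).2.2
  -- A symmetric form P of rank one with P(v, v) > 0 is the square of the linear form P(v, ·)/√P(v,
  -- v). With v fixed, this root depends smoothly on x.
  refine ⟨r, hr, fun x hx => hss (hb1 hx), μ, fun x => (√(P x v v))⁻¹ • P x v,
    fun x => (√(Q x w w))⁻¹ • Q x w, hμc.mono hb1, ?_, ?_, ?_⟩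
  · refine ContDiffOn.fun_smul (ContDiffOn.inv ((hPv.mono hb1).sqrt fun x hx => (hbP x hx).ne') ?_)
      ((hPc.mono hb1).clm_apply contDiffOn_const)
    exact fun x hx => (Real.sqrt_pos.2 (hbP x hx)).ne'
  · refine ContDiffOn.fun_smul (ContDiffOn.inv ((hQw.mono hb1).sqrt fun x hx => (hbQ x hx).ne') ?_)
      ((hQc.mono hb1).clm_apply contDiffOn_const)
    exact fun x hx => (Real.sqrt_pos.2 (hbQ x hx)).ne'
  · intro x hx
    have hxs := hb1 hx
    refine ⟨hμpos x hxs.1 hxs.2, fun a b => ?_⟩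
    have key : ∀ (B : Eu 2 →L[ℝ] Eu 2 →L[ℝ] ℝ) (z : Eu 2), (∀ a b, B a b = B b a) →
        detForm B = 0 → 0 < B z z →
        ((√(B z z))⁻¹ • B z) a * ((√(B z z))⁻¹ • B z) b = B a b := by
      intro B z hB hdB hpos
      have h1 := mul_eq_of_detForm_eq_zero hB hdB z a b
      have h2 := Real.sq_sqrt hpos.le
      have h3 := (Real.sqrt_pos.2 hpos).ne'
      simp only [smul_apply, smul_eq_mul]
      have h4 : (√(B z z))⁻¹ * B z a * ((√(B z z))⁻¹ * B z b)
          = (B z a * B z b) / (√(B z z)) ^ 2 := by field_simp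
      rw [h4, h2, ← h1]
      field_simp
    rw [key (P x) v (hPs x) (hdP x hxs.1 hxs.2) (hbP x hx),
      key (Q x) w (hQs x) (hdQ x hxs.1 hxs.2) (hbQ x hx)]
    simp only [hP, hQ, add_apply, sub_apply, smul_apply, smul_eq_mul]
    constructor <;> ring

end Coframe

/-! ### Vanishing divergence and closed coframes. -/

section Closed

/-- For a coframe `ω₁, ω₂` which diagonalizes `G` and a form `A` as `μ G = ω₁² + ω₂²`,
`2 A = ω₁² - ω₂²`, the vanishing of the divergence of `A` means that `ω₁` and `ω₂` are closed. -/
lemma coframe_closed_of_div_eq_zero {G A : Eu 2 → Eu 2 →L[ℝ] Eu 2 →L[ℝ] ℝ} {μ : Eu 2 → ℝ}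
    {ω₁ ω₂ : Eu 2 → Eu 2 →L[ℝ] ℝ} {Γ : Eu 2 →L[ℝ] Eu 2 →L[ℝ] Eu 2} {x : Eu 2}
    (hG : DifferentiableAt ℝ G x) (hA : DifferentiableAt ℝ A x) (hμ : DifferentiableAt ℝ μ x)
    (hω₁ : DifferentiableAt ℝ ω₁ x) (hω₂ : DifferentiableAt ℝ ω₂ x) (hμ0 : 0 < μ x)
    (hev : ∀ᶠ y in nhds x, ∀ a b, μ y * G y a b = ω₁ y a * ω₁ y b + ω₂ y a * ω₂ y b ∧
      2 * A y a b = ω₁ y a * ω₁ y b - ω₂ y a * ω₂ y b)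
    (hΓ : ∀ a b c, G x (Γ a b) c = koszul G x a b c) {u v : Eu 2}
    (h1u : ω₁ x u = 1) (h2u : ω₂ x u = 0) (h1v : ω₁ x v = 0) (h2v : ω₂ x v = 1)
    (hdiv : ∀ w, (fderiv ℝ A x u u w - A x (Γ u u) w - A x u (Γ u w))
      + (fderiv ℝ A x v v w - A x (Γ v v) w - A x v (Γ v w)) = 0) :
    fderiv ℝ ω₁ x u v = fderiv ℝ ω₁ x v u ∧ fderiv ℝ ω₂ x u v = fderiv ℝ ω₂ x v u := by
  have dω : ∀ {θ : Eu 2 → Eu 2 →L[ℝ] ℝ}, DifferentiableAt ℝ θ x → ∀ b,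
      DifferentiableAt ℝ (fun y => θ y b) x :=
    fun hω b => hω.clm_apply (differentiableAt_const b)
  have fω : ∀ {θ : Eu 2 → Eu 2 →L[ℝ] ℝ}, DifferentiableAt ℝ θ x → ∀ a b,
      fderiv ℝ (fun y => θ y b) x a = fderiv ℝ θ x a b := by
    intro θ hω a b
    rw [fderiv_clm_apply hω (differentiableAt_const b)]
    simp
  have hDG : ∀ a b c, fderiv ℝ μ x a * G x b c + μ x * fderiv ℝ G x a b c
      = fderiv ℝ ω₁ x a b * ω₁ x c + ω₁ x b * fderiv ℝ ω₁ x a c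
        + (fderiv ℝ ω₂ x a b * ω₂ x c + ω₂ x b * fderiv ℝ ω₂ x a c) := by
    intro a b c
    have h1 : (fun y => μ y * G y b c)
        =ᶠ[nhds x] fun y => ω₁ y b * ω₁ y c + ω₂ y b * ω₂ y c :=
      hev.mono fun y hy => (hy b c).1
    have h2 : fderiv ℝ (fun y => μ y * G y b c) x a
        = fderiv ℝ (fun y => ω₁ y b * ω₁ y c + ω₂ y b * ω₂ y c) x a := by rw [h1.fderiv_eq]
    rw [fderiv_fun_mul hμ ((hG.clm_apply (differentiableAt_const b)).clm_apply
        (differentiableAt_const c)),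
      fderiv_fun_add ((dω hω₁ b).fun_mul (dω hω₁ c)) ((dω hω₂ b).fun_mul (dω hω₂ c)),
      fderiv_fun_mul (dω hω₁ b) (dω hω₁ c), fderiv_fun_mul (dω hω₂ b) (dω hω₂ c)] at h2
    simp only [add_apply, smul_apply, smul_eq_mul, fω hω₁, fω hω₂,
      fderiv_clm_const_apply₂ hG] at h2
    linarith
  have hDA : ∀ a b c, 2 * fderiv ℝ A x a b c
      = fderiv ℝ ω₁ x a b * ω₁ x c + ω₁ x b * fderiv ℝ ω₁ x a c
        - (fderiv ℝ ω₂ x a b * ω₂ x c + ω₂ x b * fderiv ℝ ω₂ x a c) := by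
    intro a b c
    have h1 : (fun y => 2 * A y b c)
        =ᶠ[nhds x] fun y => ω₁ y b * ω₁ y c - ω₂ y b * ω₂ y c :=
      hev.mono fun y hy => (hy b c).2
    have h2 : fderiv ℝ (fun y => 2 * A y b c) x a
        = fderiv ℝ (fun y => ω₁ y b * ω₁ y c - ω₂ y b * ω₂ y c) x a := by rw [h1.fderiv_eq]
    rw [fderiv_fun_mul (differentiableAt_const _) ((hA.clm_apply (differentiableAt_const b)).clm_apply
        (differentiableAt_const c)),
      fderiv_fun_sub ((dω hω₁ b).fun_mul (dω hω₁ c)) ((dω hω₂ b).fun_mul (dω hω₂ c)),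
      fderiv_fun_mul (dω hω₁ b) (dω hω₁ c), fderiv_fun_mul (dω hω₂ b) (dω hω₂ c)] at h2
    simp only [add_apply, sub_apply, smul_apply, smul_eq_mul, fω hω₁, fω hω₂,
      fderiv_clm_const_apply₂ hA, fderiv_const_apply, zero_apply] at h2
    linarith
  have hx := hev.self_of_nhds
  have hGu : ∀ z, μ x * G x z u = ω₁ x z := fun z => by rw [(hx z u).1, h1u, h2u]; ring
  have hGv : ∀ z, μ x * G x z v = ω₂ x z := fun z => by rw [(hx z v).1, h1v, h2v]; ring
  have hAu : ∀ z, 2 * A x z u = ω₁ x z := fun z => by rw [(hx z u).2, h1u, h2u]; ring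
  have hAv : ∀ z, 2 * A x z v = -ω₂ x z := fun z => by rw [(hx z v).2, h1v, h2v]; ring
  have hAu' : ∀ z, 2 * A x u z = ω₁ x z := fun z => by rw [(hx u z).2, h1u, h2u]; ring
  have hAv' : ∀ z, 2 * A x v z = -ω₂ x z := fun z => by rw [(hx v z).2, h1v, h2v]; ring
  have huu : G x u u = (μ x)⁻¹ := by
    have := hGu u
    rw [h1u] at this
    field_simp
    linarith
  have hvv : G x v v = (μ x)⁻¹ := by
    have := hGv v
    rw [h2v] at this
    field_simp
    linarith
  have huv : G x u v = 0 := by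
    have := hGv u
    rw [h2u] at this
    simpa [hμ0.ne'] using this
  have hvu : G x v u = 0 := by
    have := hGu v
    rw [h1v] at this
    simpa [hμ0.ne'] using this
  have hω1 : ∀ a b, 2 * ω₁ x (Γ a b) = μ x * fderiv ℝ G x a b u + μ x * fderiv ℝ G x b a u
      - μ x * fderiv ℝ G x u a b := by
    intro a b
    rw [← hGu, hΓ, koszul]; ring
  have hω2 : ∀ a b, 2 * ω₂ x (Γ a b) = μ x * fderiv ℝ G x a b v + μ x * fderiv ℝ G x b a v
      - μ x * fderiv ℝ G x v a b := by
    intro a b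
    rw [← hGv, hΓ, koszul]; ring
  -- After the connection terms are expressed by derivatives of μ, ω₁ and ω₂, the divergence
  -- expression at w = v equals Dω₁(u, v) - Dω₁(v, u), and at w = u it equals, up to sign, the same
  -- expression for ω₂. The derivatives of μ cancel. The relations collected next are those needed
  -- for each component.
  have du := hdiv u
  have dv := hdiv v
  constructor
  · have e1 := hDG u u v
    have e2 := hDG v u u
    have e3 := hDG v v v
    have e4 := hDG u v u
    have e6 := hω2 u u
    have e7 := hω2 v v
    have e8 := hω1 u v
    have e9 := hDA u u v
    have e10 := hDA v v v
    have e11 := hAv (Γ u u)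
    have e12 := hAv (Γ v v)
    have e13 := hAu' (Γ u v)
    have e14 := hAv' (Γ v v)
    simp only [h1u, h2u, h1v, h2v, huu, huv, hvu, hvv] at e1 e2 e3 e4 e9 e10
    linarith
  · have e1 := hDG v v u
    have e2 := hDG u v v
    have e3 := hDG u u u
    have e4 := hDG v u v
    have e6 := hω1 u u
    have e7 := hω1 v v
    have e8 := hω2 v u
    have e9 := hDA u u u
    have e10 := hDA v v u
    have e11 := hAu (Γ u u)
    have e12 := hAu (Γ v v)
    have e13 := hAv' (Γ v u)
    have e14 := hAu' (Γ u u)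
    simp only [h1u, h2u, h1v, h2v, huu, huv, hvu, hvv] at e1 e2 e3 e4 e9 e10
    linarith

/-- The pull-back of a field of linear forms. -/
def pullOne (θ : Eu 2 → Eu 2 →L[ℝ] ℝ) (σ : Eu 2 → Eu 2) (x : Eu 2) : Eu 2 →L[ℝ] ℝ :=
  (θ (σ x)).comp (fderiv ℝ σ x)

lemma fderiv_pullOne {θ : Eu 2 → Eu 2 →L[ℝ] ℝ} {σ : Eu 2 → Eu 2} {x : Eu 2}
    (hω : DifferentiableAt ℝ θ (σ x)) (hσ : ContDiffAt ℝ 2 σ x) :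
    DifferentiableAt ℝ (pullOne θ σ) x ∧ ∀ a b, fderiv ℝ (pullOne θ σ) x a b
      = fderiv ℝ θ (σ x) (fderiv ℝ σ x a) (fderiv ℝ σ x b)
        + θ (σ x) (fderiv ℝ (fderiv ℝ σ) x a b) := by
  have hd : DifferentiableAt ℝ σ x := hσ.differentiableAt (by simp)
  have hdd : DifferentiableAt ℝ (fderiv ℝ σ) x :=
    (hσ.fderiv_right (m := 1) (by norm_num)).differentiableAt (by simp)
  have h1 := differentiableAt_comp_and_fderiv hω hd
  refine ⟨h1.1.clm_comp hdd, fun a b => ?_⟩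
  unfold pullOne
  rw [fderiv_clm_comp h1.1 hdd]
  simp [h1.2, add_comm]

end Closed

/-! ### The trace-free part of the shape operator. -/

section Deviation

variable {m n : ℕ} {M N : Type*}
  [TopologicalSpace M] [ChartedSpace (Eu m) M] [IsManifold 𝓘(ℝ, Eu m) ∞ M]
  [TopologicalSpace N] [ChartedSpace (Eu n) N] [IsManifold 𝓘(ℝ, Eu n) ∞ N]
  {g : Metric m M} {h : Metric n N} {φ : M → N}

/-- The metric as a field of bilinear maps. -/
def metricL (g : Metric m M) (q : M) : Tan m q →ₗ[ℝ] Tan m q →ₗ[ℝ] ℝ :=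
  LinearMap.mk₂ ℝ (fun u v => g.inner q u v) (by simp) (by simp) (by simp) (by simp)

@[simp] lemma metricL_apply (g : Metric m M) (q : M) (u v : Tan m q) :
    metricL g q u v = g.inner q u v := rfl

omit [IsManifold 𝓘(ℝ, Eu m) ∞ M] in
lemma tensorForm_add_smul (S T : ∀ q : M, Tan m q →ₗ[ℝ] Tan m q →ₗ[ℝ] ℝ) (a b : ℝ)
    (e : OpenPartialHomeomorph M (Eu m)) (x : Eu m) :
    tensorForm (fun q => a • S q + b • T q) e x
      = a • tensorForm S e x + b • tensorForm T e x := by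
  ext u v
  simp only [tensorForm_apply, LinearMap.add_apply, LinearMap.smul_apply, add_apply, smul_apply]

/-- The trace-free part `⟨A_H u, v⟩ - c² ⟨u, v⟩` of the shape operator, where `c = |H|`. -/
def devForm (hφ : IsRiemannianImmersion g h φ) (c : ℝ) (q : M) : Tan m q →ₗ[ℝ] Tan m q →ₗ[ℝ] ℝ :=
  (1 : ℝ) • shapeForm hφ q + (-c ^ 2) • metricL g q

lemma devForm_apply (hφ : IsRiemannianImmersion g h φ) (c : ℝ) (q : M) (u v : Tan m q) :
    devForm hφ c q u v = shapeForm hφ q u v - c ^ 2 * g.inner q u v := by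
  simp only [devForm, LinearMap.add_apply, LinearMap.smul_apply, metricL_apply, smul_eq_mul]
  ring

lemma tensorForm_devForm (hφ : IsRiemannianImmersion g h φ) (c : ℝ)
    (e : OpenPartialHomeomorph M (Eu m)) (x : Eu m) :
    tensorForm (devForm hφ c) e x
      = (1 : ℝ) • tensorForm (shapeForm hφ) e x + (-c ^ 2) • metricForm g e x :=
  tensorForm_add_smul _ _ _ _ _ _

lemma tensorForm_devForm_symm (hφ : IsRiemannianImmersion g h φ) (c : ℝ)
    (e : OpenPartialHomeomorph M (Eu m)) (x u v : Eu m) :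
    tensorForm (devForm hφ c) e x u v = tensorForm (devForm hφ c) e x v u := by
  rw [tensorForm_apply, tensorForm_apply, devForm_apply, devForm_apply, shapeForm_symm, g.symm]

lemma contDiffOn_devForm (hφ : IsRiemannianImmersion g h φ) (c : ℝ)
    {e : OpenPartialHomeomorph M (Eu m)} (he : e ∈ Atl m M) :
    ContDiffOn ℝ ∞ (tensorForm (devForm hφ c) e) e.target := by
  have : tensorForm (devForm hφ c) e = fun x => (1 : ℝ) • tensorForm (shapeForm hφ) e x
      + (-c ^ 2) • metricForm g e x := funext fun x => tensorForm_devForm hφ c e x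
  rw [this]
  exact ((contDiffOn_shapeForm hφ he).const_smul (1 : ℝ)).add
    ((contDiffOn_metricForm g he).const_smul (-c ^ 2))

end Deviation

/-! ### The divergence equation for biconservative CMC surfaces. -/

section Surface

variable {n : ℕ} {M N : Type*}
  [TopologicalSpace M] [ChartedSpace (Eu 2) M] [IsManifold 𝓘(ℝ, Eu 2) ∞ M]
  [TopologicalSpace N] [ChartedSpace (Eu n) N] [IsManifold 𝓘(ℝ, Eu n) ∞ N]
  {g : Metric 2 M} {h : Metric n N} {φ : M → N}

/-- A_H has trace 2|H|² = 2c², which is also the trace of c² g. Multiplying this equality by the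
determinant of the Gram matrix turns the trace into `trForm`. -/
lemma trForm_devForm (hφ : IsRiemannianImmersion g h φ) {c : ℝ}
    (hc : ∀ q, h.inner (φ q) (meanCurvature g h φ q) (meanCurvature g h φ q) = c ^ 2)
    {e : OpenPartialHomeomorph M (Eu 2)} (he : e ∈ Atl 2 M) {x : Eu 2} (hx : x ∈ e.target) :
    trForm (metricForm g e x) (tensorForm (devForm hφ c) e x) = 0 := by
  set q := e.symm x with hq
  have hqs : q ∈ e.source := e.map_target hx
  have hxq : e q = x := e.right_inv hx
  have h1 := metricTrace_shapeForm hφ two_ne_zero q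
  rw [metricTrace_eq_chart g he hqs, hxq, hc] at h1
  have h2 : ∀ i j, shapeForm hφ q (dChartInv e q (stdVec i)) (dChartInv e q (stdVec j))
      = tensorForm (shapeForm hφ) e x (stdVec i) (stdVec j) :=
    fun i j => (tensorForm_apply (shapeForm hφ) e x _ _).symm
  have hT : tensorForm (shapeForm hφ) e x (stdVec 1) (stdVec 0)
      = tensorForm (shapeForm hφ) e x (stdVec 0) (stdVec 1) := by
    rw [tensorForm_apply, tensorForm_apply, shapeForm_symm]
  have hu := (isUnit_gramInChart g he hx).ne_zero
  have hG := metricForm_symm g e x (stdVec 1) (stdVec 0)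
  simp only [Fin.sum_univ_two, h2, Matrix.inv_def, Ring.inverse_eq_inv', Matrix.adjugate_fin_two,
    Matrix.smul_apply, Matrix.of_apply, Matrix.cons_val_zero, Matrix.cons_val_one,
    Matrix.cons_val', Matrix.cons_val_fin_one, smul_eq_mul, hT, gramInChart_apply, hG] at h1
  rw [Matrix.det_fin_two] at h1 hu
  simp only [gramInChart_apply, hG] at h1 hu
  simp only [trForm, tensorForm_devForm, add_apply, smul_apply, smul_eq_mul]
  rw [← sq] at hu h1
  field_simp at h1
  push_cast at h1
  linarith

/-- A biconservative CMC surface has divergence-free trace-free shape operator. -/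
lemma div_devForm_eq_zero (hφ : IsRiemannianImmersion g h φ) (hbi : IsBiconservative g h φ) {c : ℝ}
    (hc : ∀ q, h.inner (φ q) (meanCurvature g h φ q) (meanCurvature g h φ q) = c ^ 2)
    (q : M) {r : ℝ} (hr : 0 < r) {u v : Tan 2 q} (huu : g.inner q u u = r)
    (hvv : g.inner q v v = r) (huv : g.inner q u v = 0) (w : Tan 2 q) :
    let E := chartAt (Eu 2) q
    let A := tensorForm (devForm hφ c) E
    let D : Tan 2 q → ℝ := fun u =>
      fderiv ℝ A (E q) (dChart E q u) (dChart E q u) (dChart E q w)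
        - A (E q) (christForm g E (E q) (dChart E q u) (dChart E q u)) (dChart E q w)
        - A (E q) (dChart E q u) (christForm g E (E q) (dChart E q u) (dChart E q w))
    D u + D v = 0 := by
  intro E A D
  have he : E ∈ Atl 2 M := chartAt_mem_atl q
  have hq : q ∈ E.source := mem_chart_source _ q
  have hx : E q ∈ E.target := E.map_source hq
  -- For m = 2 the stress tensor is 4 A_H - 2c² g, that is 4 `devForm` + 2c² g. The metric part is
  -- parallel and drops out of the covariant derivative.
  set S : ∀ q : M, Tan 2 q →ₗ[ℝ] Tan 2 q →ₗ[ℝ] ℝ :=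
    fun q => (4 : ℝ) • devForm hφ c q + (2 * c ^ 2) • metricL g q with hS
  have hstress : stressBienergy g h φ = fun q v w => S q v w := by
    funext q v w
    rw [stressBienergy_eq hφ two_ne_zero, hc]
    simp only [hS, LinearMap.add_apply, LinearMap.smul_apply, devForm_apply, metricL_apply,
      smul_eq_mul]
    push_cast
    ring
  have hA : DifferentiableAt ℝ A (E q) :=
    ((contDiffOn_devForm hφ c he).contDiffAt (E.open_target.mem_nhds hx)).differentiableAt (by simp)
  have hG := differentiableAt_metricForm g he hx
  have hSform : tensorForm S E = fun x => (4 : ℝ) • A x + (2 * c ^ 2) • metricForm g E x :=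
    funext fun x => tensorForm_add_smul _ _ _ _ _ _
  have hSd : DifferentiableAt ℝ (tensorForm S E) (E q) := by
    rw [hSform]
    exact (hA.const_smul (4 : ℝ)).add (hG.const_smul (2 * c ^ 2))
  have hSf : ∀ a b d, fderiv ℝ (tensorForm S E) (E q) a b d
      = 4 * fderiv ℝ A (E q) a b d + (2 * c ^ 2) * fderiv ℝ (metricForm g E) (E q) a b d := by
    intro a b d
    rw [hSform, fderiv_fun_add (hA.fun_const_smul (4 : ℝ)) (hG.fun_const_smul (2 * c ^ 2)),
      fderiv_fun_const_smul hA, fderiv_fun_const_smul hG]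
    simp only [add_apply, smul_apply, smul_eq_mul]
  have key : ∀ a b : Tan 2 q, covDerivTensor g (fun q v w => S q v w) q a b w
      = 4 * (fderiv ℝ A (E q) (dChart E q a) (dChart E q b) (dChart E q w)
        - A (E q) (christForm g E (E q) (dChart E q a) (dChart E q b)) (dChart E q w)
        - A (E q) (dChart E q b) (christForm g E (E q) (dChart E q a) (dChart E q w))) := by
    intro a b
    rw [covDerivTensor_eq g S q hSd, hSf, fderiv_metricForm g he hx, hSform]
    simp only [add_apply, smul_apply, smul_eq_mul]
    ring
  have h0 := hbi q w
  rw [hstress, divTensor] at h0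
  -- The divergence is defined with the coordinate frame of the preferred chart. Bundling the
  -- covariant derivative as a bilinear map in its first two arguments allows the trace to be taken
  -- in the orthogonal frame u, v.
  set b : Tan 2 q →ₗ[ℝ] Tan 2 q →ₗ[ℝ] ℝ := LinearMap.mk₂ ℝ
    (fun a b => covDerivTensor g (fun q v w => S q v w) q a b w)
    (by intros; simp only [key, map_add, add_apply]; ring)
    (by intros; simp only [key, map_smul, smul_apply, smul_eq_mul]; ring)
    (by intros; simp only [key, map_add, add_apply]; ring)
    (by intros; simp only [key, map_smul, smul_apply, smul_eq_mul]; ring) with hb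
  have h1 : metricTrace g q (fun u v => b u v) = 0 := h0
  rw [metricTrace_eq_ortho g q hr huu hvv huv] at h1
  have h2 : b u u + b v v = 0 := by
    simpa [hr.ne'] using h1
  simp only [hb, LinearMap.mk₂_apply, key] at h2
  simp only [D]
  linarith

/-- The coframe which diagonalizes the shape operator of a biconservative CMC surface is closed. -/
lemma coframe_closed (hφ : IsRiemannianImmersion g h φ) (hbi : IsBiconservative g h φ) {c : ℝ}
    (hc : ∀ q, h.inner (φ q) (meanCurvature g h φ q) (meanCurvature g h φ q) = c ^ 2)
    {e : OpenPartialHomeomorph M (Eu 2)} (he : e ∈ Atl 2 M) {x : Eu 2} (hx : x ∈ e.target)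
    {μ : Eu 2 → ℝ} {ω₁ ω₂ : Eu 2 → Eu 2 →L[ℝ] ℝ} (hμ : DifferentiableAt ℝ μ x)
    (hω₁ : DifferentiableAt ℝ ω₁ x) (hω₂ : DifferentiableAt ℝ ω₂ x) (hμ0 : 0 < μ x)
    (hev : ∀ᶠ y in nhds x, ∀ a b,
      μ y * metricForm g e y a b = ω₁ y a * ω₁ y b + ω₂ y a * ω₂ y b ∧
      2 * tensorForm (devForm hφ c) e y a b = ω₁ y a * ω₁ y b - ω₂ y a * ω₂ y b)
    (a b : Eu 2) :
    fderiv ℝ ω₁ x a b = fderiv ℝ ω₁ x b a ∧ fderiv ℝ ω₂ x a b = fderiv ℝ ω₂ x b a := by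
  obtain ⟨q, hqs, rfl⟩ : ∃ q ∈ e.source, e q = x := ⟨e.symm x, e.map_target hx, e.right_inv hx⟩
  -- The divergence at q is computed in the preferred chart E at q, while the coframe lives in the
  -- chart e. The coframe is therefore pulled back to E by the transition map σ.
  set E := chartAt (Eu 2) q with hEdef
  have hE : E ∈ Atl 2 M := chartAt_mem_atl q
  have hqE : q ∈ E.source := mem_chart_source _ q
  set σ := rep (fun q : M => q) E e with hσ
  have hσq : σ (E q) = e q := by simp only [hσ, rep, E.left_inv hqE]
  have hσ2 : ContDiffAt ℝ 2 σ (E q) := (contDiffAt_rep (φ := fun q : M => q) contMDiff_id hE he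
    (E.map_source hqE) (by rwa [E.left_inv hqE])).of_le ENat.LEInfty.out
  have hdσ : ∀ a, fderiv ℝ σ (E q) a = dChart e q (dChartInv E q a) :=
    fun a => fderiv_rep_id hE he hqE hqs a
  have hsymσ : IsSymmSndFDerivAt ℝ σ (E q) := hσ2.isSymmSndFDerivAt (by simp)
  have hp1 := fderiv_pullOne (θ := ω₁) (σ := σ) (by rwa [hσq]) hσ2
  have hp2 := fderiv_pullOne (θ := ω₂) (σ := σ) (by rwa [hσq]) hσ2
  have hμσ : DifferentiableAt ℝ (fun y => μ (σ y)) (E q) :=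
    (differentiableAt_comp_and_fderiv (by rwa [hσq]) (hσ2.differentiableAt (by simp))).1
  have hevE : ∀ᶠ y in nhds (E q), ∀ a b,
      μ (σ y) * metricForm g E y a b
        = pullOne ω₁ σ y a * pullOne ω₁ σ y b + pullOne ω₂ σ y a * pullOne ω₂ σ y b ∧
      2 * tensorForm (devForm hφ c) E y a b
        = pullOne ω₁ σ y a * pullOne ω₁ σ y b - pullOne ω₂ σ y a * pullOne ω₂ σ y b := by
    have h1 : ContinuousAt σ (E q) := hσ2.continuousAt
    rw [ContinuousAt, hσq] at h1
    have h2 : ∀ᶠ y in nhds (E q), y ∈ E.target ∧ E.symm y ∈ e.source :=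
      rep_nhds (φ := fun q : M => q) continuous_id hqE hqs
    filter_upwards [h1 hev, h2] with y hy hy2 a b
    have hy3 := E.map_target hy2.1
    have hf : ∀ a, fderiv ℝ σ y a = dChart e (E.symm y) (dChartInv E (E.symm y) a) := by
      intro a
      have := fderiv_rep_id hE he hy3 hy2.2 a
      rwa [E.right_inv hy2.1] at this
    have hy4 := hy (fderiv ℝ σ y a) (fderiv ℝ σ y b)
    have hm : metricForm g e (σ y) (fderiv ℝ σ y a) (fderiv ℝ σ y b) = metricForm g E y a b := by
      rw [hf, hf, show σ y = e (E.symm y) from rfl, ← inner_eq_metricForm g he hy2.2,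
        metricForm_apply]
      rfl
    have hT : tensorForm (devForm hφ c) e (σ y) (fderiv ℝ σ y a) (fderiv ℝ σ y b)
        = tensorForm (devForm hφ c) E y a b := by
      rw [hf, hf, show σ y = e (E.symm y) from rfl, tensorForm_dChart _ he hy2.2,
        tensorForm_apply]
    rw [hm, hT] at hy4
    exact hy4
  have hx' : E q ∈ E.target := E.map_source hqE
  have hself := hevE.self_of_nhds
  have hinj : ∀ z : Eu 2, pullOne ω₁ σ (E q) z = 0 → pullOne ω₂ σ (E q) z = 0 → z = 0 := by
    intro z h1 h2
    by_contra hne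
    have h3 := metricForm_pos g hE hx' hne
    have h4 := (hself z z).1
    rw [h1, h2, hσq] at h4
    have := mul_pos hμ0 h3
    linarith
  -- The coframe assembled into an endomorphism of the plane. It is injective because μ G = ω₁² +
  -- ω₂² is definite, and the preimages of the standard basis form the dual frame u, v.
  set Λ : Eu 2 →ₗ[ℝ] Eu 2 := (pullOne ω₁ σ (E q)).toLinearMap.smulRight (stdVec 0)
    + (pullOne ω₂ σ (E q)).toLinearMap.smulRight (stdVec 1) with hΛ
  have hΛ0 : ∀ z, Λ z 0 = pullOne ω₁ σ (E q) z := by intro z; simp [hΛ, stdVec]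
  have hΛ1 : ∀ z, Λ z 1 = pullOne ω₂ σ (E q) z := by intro z; simp [hΛ, stdVec]
  have hΛi : Function.Injective Λ := by
    rw [injective_iff_map_eq_zero]
    intro z hz
    exact hinj z (by rw [← hΛ0, hz]; rfl) (by rw [← hΛ1, hz]; rfl)
  have hΛs : Function.Surjective Λ := LinearMap.injective_iff_surjective.1 hΛi
  obtain ⟨u, hu⟩ := hΛs (stdVec 0)
  obtain ⟨v, hv⟩ := hΛs (stdVec 1)
  have h1u : pullOne ω₁ σ (E q) u = 1 := by rw [← hΛ0, hu]; simp [stdVec]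
  have h2u : pullOne ω₂ σ (E q) u = 0 := by rw [← hΛ1, hu]; simp [stdVec]
  have h1v : pullOne ω₁ σ (E q) v = 0 := by rw [← hΛ0, hv]; simp [stdVec]
  have h2v : pullOne ω₂ σ (E q) v = 1 := by rw [← hΛ1, hv]; simp [stdVec]
  have hGuv : ∀ a b, g.inner q (dChartInv E q a) (dChartInv E q b) = metricForm g E (E q) a b := by
    intro a b
    rw [inner_eq_metricForm g hE hqE, dChart_dChartInv hE hqE, dChart_dChartInv hE hqE]
  have hμq : 0 < μ (σ (E q)) := by rwa [hσq]
  have huu : metricForm g E (E q) u u = (μ (σ (E q)))⁻¹ := by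
    have := (hself u u).1
    rw [h1u, h2u] at this
    field_simp
    linarith
  have hvv : metricForm g E (E q) v v = (μ (σ (E q)))⁻¹ := by
    have := (hself v v).1
    rw [h1v, h2v] at this
    field_simp
    linarith
  have huv : metricForm g E (E q) u v = 0 := by
    have := (hself u v).1
    rw [h1u, h2u, h1v, h2v] at this
    simpa [hμq.ne'] using this
  have hA : DifferentiableAt ℝ (tensorForm (devForm hφ c) E) (E q) :=
    ((contDiffOn_devForm hφ c hE).contDiffAt (E.open_target.mem_nhds hx')).differentiableAt (by simp)
  have hclosed := coframe_closed_of_div_eq_zero (Γ := christForm g E (E q))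
    (differentiableAt_metricForm g hE hx') hA hμσ hp1.1 hp2.1 hμq hevE
    (fun a b d => metricForm_christForm g hE hx' a b d) h1u h2u h1v h2v (by
      intro w
      have := div_devForm_eq_zero hφ hbi hc q (r := (μ (σ (E q)))⁻¹) (inv_pos.2 hμq)
        (u := dChartInv E q u) (v := dChartInv E q v) (by rw [hGuv, huu]) (by rw [hGuv, hvv])
        (by rw [hGuv, huv]) (dChartInv E q w)
      simp only [← hEdef, dChart_dChartInv hE hqE] at this
      exact this)
  have hspan : ∀ z : Eu 2, z = pullOne ω₁ σ (E q) z • u + pullOne ω₂ σ (E q) z • v := by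
    intro z
    apply hΛi
    rw [map_add, map_smul, map_smul, hu, hv]
    conv_lhs => rw [eu_two_eq (Λ z), hΛ0, hΛ1]
  have hcl : ∀ {B : Eu 2 →L[ℝ] Eu 2 →L[ℝ] ℝ}, B u v = B v u → ∀ a b, B a b = B b a := by
    intro B hB a b
    rw [hspan a, hspan b]
    simp only [map_add, map_smul, add_apply, smul_apply, smul_eq_mul, hB]
    ring
  have hsurj : ∀ a, fderiv ℝ σ (E q) (dChart E q (dChartInv e q a)) = a := by
    intro a
    rw [hdσ, dChartInv_dChart hE hqE, dChart_dChartInv he hqs]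
  -- Closedness is invariant under the change of charts: pulling back adds the term θ(D²σ(a, b)),
  -- which is symmetric in a and b.
  have fin : ∀ {θ : Eu 2 → Eu 2 →L[ℝ] ℝ},
      (∀ a b, fderiv ℝ (pullOne θ σ) (E q) a b
        = fderiv ℝ θ (σ (E q)) (fderiv ℝ σ (E q) a) (fderiv ℝ σ (E q) b)
        + θ (σ (E q)) (fderiv ℝ (fderiv ℝ σ) (E q) a b)) →
      (∀ a b, fderiv ℝ (pullOne θ σ) (E q) a b = fderiv ℝ (pullOne θ σ) (E q) b a) →
      fderiv ℝ θ (e q) a b = fderiv ℝ θ (e q) b a := by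
    intro θ h1 h2
    have h3 := h2 (dChart E q (dChartInv e q a)) (dChart E q (dChartInv e q b))
    rw [h1, h1, hsurj, hsurj, hsymσ.eq (dChart E q (dChartInv e q a)), hσq] at h3
    exact add_right_cancel h3
  exact ⟨fin hp1.2 (hcl hclosed.1), fin hp2.2 (hcl hclosed.2)⟩

end Surface

/-- Two closed one-forms on a disc, independent at a point, are locally the coordinate differentials
of a smooth change of coordinates. -/
lemma exists_coordinates_of_closed {x₀ : Eu 2} {r : ℝ} (hr : 0 < r)
    {ω₁ ω₂ : Eu 2 → Eu 2 →L[ℝ] ℝ} (h₁ : ContDiffOn ℝ ∞ ω₁ (Metric.ball x₀ r))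
    (h₂ : ContDiffOn ℝ ∞ ω₂ (Metric.ball x₀ r))
    (hc₁ : ∀ x ∈ Metric.ball x₀ r, ∀ a b, fderiv ℝ ω₁ x a b = fderiv ℝ ω₁ x b a)
    (hc₂ : ∀ x ∈ Metric.ball x₀ r, ∀ a b, fderiv ℝ ω₂ x a b = fderiv ℝ ω₂ x b a)
    (hi : ∀ x ∈ Metric.ball x₀ r, ∀ a, ω₁ x a = 0 → ω₂ x a = 0 → a = 0) :
    ∃ Φ : OpenPartialHomeomorph (Eu 2) (Eu 2), x₀ ∈ Φ.source ∧ Φ.source ⊆ Metric.ball x₀ r ∧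
      ContDiffOn ℝ ∞ Φ Φ.source ∧ ContDiffOn ℝ ∞ Φ.symm Φ.target ∧
      ∀ x ∈ Φ.source, ∀ a, fderiv ℝ Φ x a 0 = ω₁ x a ∧ fderiv ℝ Φ x a 1 = ω₂ x a := by
  -- The Poincaré lemma on the convex ball gives primitives of both forms, which become the
  -- coordinate functions x and y.
  obtain ⟨F₁, hF₁⟩ := (convex_ball x₀ r).exists_forall_hasFDerivAt_of_fderiv_symmetric
    Metric.isOpen_ball (h₁.differentiableOn (by simp)) hc₁
  obtain ⟨F₂, hF₂⟩ := (convex_ball x₀ r).exists_forall_hasFDerivAt_of_fderiv_symmetric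
    Metric.isOpen_ball (h₂.differentiableOn (by simp)) hc₂
  set F : Eu 2 → Eu 2 := fun x => F₁ x • stdVec 0 + F₂ x • stdVec 1 with hFdef
  set L : Eu 2 → Eu 2 →L[ℝ] Eu 2 := fun x =>
    (ω₁ x).smulRight (stdVec 0) + (ω₂ x).smulRight (stdVec 1) with hL
  have hF : ∀ x ∈ Metric.ball x₀ r, HasFDerivAt F (L x) x := fun x hx =>
    ((hF₁ x hx).smul_const (stdVec 0)).add ((hF₂ x hx).smul_const (stdVec 1))
  have hL0 : ∀ x a, L x a 0 = ω₁ x a := by intro x a; simp [hL, stdVec]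
  have hL1 : ∀ x a, L x a 1 = ω₂ x a := by intro x a; simp [hL, stdVec]
  have hbij : ∀ x ∈ Metric.ball x₀ r, ∃ L' : Eu 2 ≃L[ℝ] Eu 2, (L' : Eu 2 →L[ℝ] Eu 2) = L x := by
    intro x hx
    have hinj : Function.Injective (L x : Eu 2 →ₗ[ℝ] Eu 2) := by
      rw [injective_iff_map_eq_zero]
      intro a ha
      have ha' : L x a = 0 := ha
      exact hi x hx a (by rw [← hL0, ha']; rfl) (by rw [← hL1, ha']; rfl)
    refine ⟨(LinearEquiv.ofInjectiveEndo (L x : Eu 2 →ₗ[ℝ] Eu 2) hinj).toContinuousLinearEquiv, ?_⟩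
    ext1 a
    rfl
  have hsm : ContDiffOn ℝ ∞ F (Metric.ball x₀ r) := by
    rw [contDiffOn_infty_iff_fderiv_of_isOpen Metric.isOpen_ball]
    refine ⟨fun x hx => (hF x hx).differentiableAt.differentiableWithinAt, ?_⟩
    refine ContDiffOn.congr (f := L) ?_ fun x hx => (hF x hx).fderiv
    exact (h₁.smulRight contDiffOn_const).add (h₂.smulRight contDiffOn_const)
  have hx₀ : x₀ ∈ Metric.ball x₀ r := Metric.mem_ball_self hr
  have hat : ∀ x ∈ Metric.ball x₀ r, ContDiffAt ℝ ∞ F x := fun x hx =>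
    hsm.contDiffAt (Metric.isOpen_ball.mem_nhds hx)
  obtain ⟨L', hL'⟩ := hbij x₀ hx₀
  have hd : HasFDerivAt F (L' : Eu 2 →L[ℝ] Eu 2) x₀ := by rw [hL']; exact hF x₀ hx₀
  -- The inverse function theorem gives a local inverse near x₀. Restricting to the ball keeps the
  -- derivative `L x` invertible on the whole source, so the inverse is smooth on the whole target.
  set Φ := ((hat x₀ hx₀).toOpenPartialHomeomorph F hd (by simp)).restrOpen _
    (Metric.isOpen_ball (x := x₀) (ε := r)) with hΦ
  have hcoe : (Φ : Eu 2 → Eu 2) = F := rfl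
  have hsrc : Φ.source ⊆ Metric.ball x₀ r := by
    rw [hΦ, OpenPartialHomeomorph.restrOpen_source]
    exact Set.inter_subset_right
  refine ⟨Φ, ?_, hsrc, ?_, ?_, ?_⟩
  · rw [hΦ, OpenPartialHomeomorph.restrOpen_source]
    exact ⟨(hat x₀ hx₀).mem_toOpenPartialHomeomorph_source hd (by simp), hx₀⟩
  · rw [hcoe]
    exact hsm.mono hsrc
  · intro y hy
    have hx := hsrc (Φ.map_target hy)
    obtain ⟨L'', hL''⟩ := hbij _ hx
    refine (Φ.contDiffAt_symm (f₀' := L'') hy ?_ ?_).contDiffWithinAt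
    · rw [hL'', hcoe]; exact hF _ hx
    · rw [hcoe]; exact hat _ hx
  · intro x hx a
    rw [hcoe, (hF x (hsrc hx)).fderiv]
    exact ⟨hL0 x a, hL1 x a⟩

/-! ### Raising an index with the metric. -/

section Sharp

variable {n : ℕ} {N : Type*} [TopologicalSpace N] [ChartedSpace (Eu n) N]
  [IsManifold 𝓘(ℝ, Eu n) ∞ N]

lemma gram_eq (h : Metric n N) (p : N) :
    gram h p = gramInChart h (chartAt (Eu n) p) (chartAt (Eu n) p p) := by
  ext i j
  have hp := mem_chart_source (Eu n) p
  rw [gramInChart_apply, gram, Matrix.of_apply, inner_eq_metricForm h (chartAt_mem_atl p) hp, frame,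
    frame, dChart_dChartInv (chartAt_mem_atl p) hp, dChart_dChartInv (chartAt_mem_atl p) hp]

lemma inner_sharp (h : Metric n N) (p : N) (l : Tan n p →ₗ[ℝ] ℝ) (w : Tan n p) :
    h.inner p (sharp h p l) w = l w := by
  have hp := mem_chart_source (Eu n) p
  have he : chartAt (Eu n) p ∈ Atl n N := chartAt_mem_atl p
  have hu : IsUnit (gram h p).det := by
    rw [gram_eq]
    exact isUnit_gramInChart h he ((chartAt (Eu n) p).map_source hp)
  have hw : w = ∑ k, dChart (chartAt (Eu n) p) p w k • frame p k := by
    conv_lhs => rw [← dChartInv_dChart he hp w, ← sum_stdVec (dChart (chartAt (Eu n) p) p w)]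
    simp only [map_sum, map_smul, frame]
  have hb : ∀ k, h.inner p (sharp h p l) (frame p k) = l (frame p k) := by
    intro k
    simp only [sharp, map_sum, map_smul, sum_apply, smul_apply, smul_eq_mul]
    have h1 : ∀ i j, (gram h p)⁻¹ i j * l (frame p i) * h.inner p (frame p j) (frame p k)
        = l (frame p i) * ((gram h p)⁻¹ i j * gram h p j k) := by
      intro i j
      simp only [gram, Matrix.of_apply]
      ring
    simp only [h1, ← Finset.mul_sum, ← Matrix.mul_apply, Matrix.nonsing_inv_mul _ hu,
      Matrix.one_apply]
    simp
  rw [hw]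
  simp only [map_sum, map_smul, hb]

lemma inner_ext (h : Metric n N) (p : N) {u v : Tan n p}
    (H : ∀ w, h.inner p u w = h.inner p v w) : u = v := by
  by_contra hne
  have := h.pos p _ (sub_ne_zero.2 hne)
  rw [map_sub (h.inner p), sub_apply, H, sub_self] at this
  exact lt_irrefl _ this

end Sharp

/-! ### Construction of the isothermal line of curvature chart. -/

section Surface

variable {n : ℕ} {M N : Type*}
  [TopologicalSpace M] [ChartedSpace (Eu 2) M] [IsManifold 𝓘(ℝ, Eu 2) ∞ M]
  [TopologicalSpace N] [ChartedSpace (Eu n) N] [IsManifold 𝓘(ℝ, Eu n) ∞ N]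
  {g : Metric 2 M} {h : Metric n N} {φ : M → N}

lemma inner_shapeH {m : ℕ} {M : Type*} [TopologicalSpace M] [ChartedSpace (Eu m) M]
    [IsManifold 𝓘(ℝ, Eu m) ∞ M] {g : Metric m M} {φ : M → N}
    (hφ : IsRiemannianImmersion g h φ) (q : M) (v w : Tan m q) :
    g.inner q (shapeH g h φ q v) w = shapeForm hφ q v w := by
  have h1 : shapeH g h φ q v = sharp g q (shapeForm hφ q v) := by
    rw [shapeH]
    congr 1
    funext w
    rw [shapeForm_apply]
  rw [h1, inner_sharp]

/-- Isothermal line of curvature coordinates around a point which is not pseudoumbilical. -/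
theorem exists_isothermal_chart (hφ : IsRiemannianImmersion g h φ) (hbi : IsBiconservative g h φ)
    {c : ℝ} (hc : ∀ q, h.inner (φ q) (meanCurvature g h φ q) (meanCurvature g h φ q) = c ^ 2)
    {p : M} (hp : ¬ IsPseudoumbilicalAt g h φ p) :
    ∃ e ∈ Atl 2 M, p ∈ e.source ∧ ∃ μ : M → ℝ,
      ContMDiffOn 𝓘(ℝ, Eu 2) 𝓘(ℝ, ℝ) ∞ μ e.source ∧ ∀ q ∈ e.source, 0 < μ q ∧ ∀ v w : Tan 2 q,
        μ q * g.inner q v w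
          = dChart e q v 0 * dChart e q w 0 + dChart e q v 1 * dChart e q w 1 ∧
        2 * devForm hφ c q v w
          = dChart e q v 0 * dChart e q w 0 - dChart e q v 1 * dChart e q w 1 := by
  set E := chartAt (Eu 2) p with hE
  have hEa : E ∈ Atl 2 M := chartAt_mem_atl p
  have hpE : p ∈ E.source := mem_chart_source _ p
  -- If the trace-free part vanished at p, then A_H would equal |H|² I there, contrary to the choice
  -- of p.
  have h0 : tensorForm (devForm hφ c) E (E p) ≠ 0 := by
    intro h0
    apply hp
    intro v
    apply inner_ext g p
    intro w
    have h1 := congrArg (fun B => B (dChart E p v) (dChart E p w)) h0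
    simp only [tensorForm_dChart _ hEa hpE, zero_apply, devForm_apply] at h1
    rw [inner_shapeH hφ, meanCurvatureNorm_sq, hc, map_smul, smul_apply, smul_eq_mul]
    linarith
  obtain ⟨r, hr, hrs, μ, ω₁, ω₂, hμ, h₁, h₂, H⟩ := exists_coframe E.open_target
    (contDiffOn_metricForm g hEa) (contDiffOn_devForm hφ c hEa)
    (fun x a b => metricForm_symm g E x a b) (fun x a b => tensorForm_devForm_symm hφ c E x a b)
    (fun x hx v hv => metricForm_pos g hEa hx hv) (fun x hx => trForm_devForm hφ hc hEa hx)
    (E.map_source hpE) h0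
  have hcl : ∀ x ∈ Metric.ball (E p) r, ∀ a b,
      fderiv ℝ ω₁ x a b = fderiv ℝ ω₁ x b a ∧ fderiv ℝ ω₂ x a b = fderiv ℝ ω₂ x b a := by
    intro x hx
    have hn := Metric.isOpen_ball.mem_nhds hx
    exact coframe_closed hφ hbi hc hEa (hrs hx) ((hμ.contDiffAt hn).differentiableAt (by simp))
      ((h₁.contDiffAt hn).differentiableAt (by simp))
      ((h₂.contDiffAt hn).differentiableAt (by simp)) (H x hx).1
      (Filter.eventually_of_mem hn fun y hy => (H y hy).2)
  obtain ⟨Φ, hΦ0, hΦs, hΦ, hΦ', hdΦ⟩ := exists_coordinates_of_closed hr h₁ h₂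
    (fun x hx a b => (hcl x hx a b).1) (fun x hx a b => (hcl x hx a b).2) (by
      intro x hx a ha1 ha2
      by_contra hne
      have h3 := metricForm_pos g hEa (hrs hx) hne
      have h4 := ((H x hx).2 a a).1
      rw [ha1, ha2] at h4
      have := mul_pos (H x hx).1 h3
      linarith)
  have hsrc : ∀ q, q ∈ (E.trans Φ).source ↔ q ∈ E.source ∧ E q ∈ Φ.source := by
    intro q
    rw [OpenPartialHomeomorph.trans_source]
    rfl
  have he : E.trans Φ ∈ Atl 2 M := by
    apply OpenPartialHomeomorph.mem_maximalAtlas_of_contMDiffOn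
    · exact (contMDiffOn_iff_contDiffOn.2 hΦ).comp
        ((contMDiffOn_of_mem_maximalAtlas hEa).mono fun q hq => ((hsrc q).1 hq).1)
        fun q hq => ((hsrc q).1 hq).2
    · have : (E.trans Φ).target = Φ.target ∩ Φ.symm ⁻¹' E.target :=
        OpenPartialHomeomorph.trans_target _ _
      rw [this]
      exact (contMDiffOn_symm_of_mem_maximalAtlas hEa).comp
        ((contMDiffOn_iff_contDiffOn.2 hΦ').mono Set.inter_subset_left)
        Set.inter_subset_right
  have hd : ∀ q ∈ (E.trans Φ).source, ∀ v, dChart (E.trans Φ) q v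
      = fderiv ℝ Φ (E q) (dChart E q v) := by
    intro q hq v
    have hq' := (hsrc q).1 hq
    have h1 : MDifferentiableAt 𝓘(ℝ, Eu 2) 𝓘(ℝ, Eu 2) E q :=
      (mdifferentiable_of_mem_atl hEa).mdifferentiableAt hq'.1
    have h2 : DifferentiableAt ℝ Φ (E q) :=
      (hΦ.contDiffAt (Φ.open_source.mem_nhds hq'.2)).differentiableAt (by simp)
    have h3 := mfderiv_comp q h2.mdifferentiableAt h1
    rw [mfderiv_eq_fderiv] at h3
    exact congrArg (fun L => L v) h3
  refine ⟨E.trans Φ, he, (hsrc p).2 ⟨hpE, hΦ0⟩, fun q => μ (E q), ?_, ?_⟩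
  · exact (contMDiffOn_iff_contDiffOn.2 hμ).comp
        ((contMDiffOn_of_mem_maximalAtlas hEa).mono fun q hq => ((hsrc q).1 hq).1)
        fun q hq => hΦs ((hsrc q).1 hq).2
  · intro q hq
    have hq' := (hsrc q).1 hq
    have hb := H (E q) (hΦs hq'.2)
    refine ⟨hb.1, fun v w => ?_⟩
    rw [hd q hq, hd q hq, (hdΦ _ hq'.2 _).1, (hdΦ _ hq'.2 _).2, (hdΦ _ hq'.2 _).1,
      (hdΦ _ hq'.2 _).2, inner_eq_metricForm g hEa hq'.1, ← tensorForm_dChart _ hEa hq'.1]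
    exact hb.2 _ _

end Surface

lemma stdVec_apply {n : ℕ} (i j : Fin n) : (stdVec i : Eu n) j = if j = i then 1 else 0 :=
  PiLp.single_apply 2 ℝ i 1 j

/-! ### Principal curvatures in the diagonalizing chart. -/

section PrincipalCurvatures

variable {n : ℕ} {M N : Type*}
  [TopologicalSpace M] [ChartedSpace (Eu 2) M] [IsManifold 𝓘(ℝ, Eu 2) ∞ M]
  [TopologicalSpace N] [ChartedSpace (Eu n) N] [IsManifold 𝓘(ℝ, Eu n) ∞ N]
  {g : Metric 2 M} {h : Metric n N} {φ : M → N}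

/-- If H = 0 then both A_H and |H|² I vanish. This excludes c = 0 in the main theorem; the value is
written `0 ^ 2` to match the hypothesis `c ^ 2` after substitution. -/
lemma isPseudoumbilicalAt_of_meanCurvature_eq_zero (hφ : IsRiemannianImmersion g h φ) {p : M}
    (h0 : h.inner (φ p) (meanCurvature g h φ p) (meanCurvature g h φ p) = 0 ^ 2) :
    IsPseudoumbilicalAt g h φ p := by
  have hH : meanCurvature g h φ p = 0 := by
    by_contra hne
    have := h.pos (φ p) _ hne
    rw [h0] at this
    norm_num at this
  intro v
  apply inner_ext g p
  intro w
  rw [inner_shapeH hφ, meanCurvatureNorm_sq, h0, shapeForm_apply, hH]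
  simp

/-- At `q`, the chart `e` diagonalizes the metric and the shape operator simultaneously, with
principal curvatures `c² ± μ/2`. -/
structure IsDiagonalAt (hφ : IsRiemannianImmersion g h φ) (c : ℝ)
    (e : OpenPartialHomeomorph M (Eu 2)) (q : M) (μ : ℝ) : Prop where
  pos : 0 < μ
  metric : ∀ v w : Tan 2 q, μ * g.inner q v w
    = dChart e q v 0 * dChart e q w 0 + dChart e q v 1 * dChart e q w 1
  dev : ∀ v w : Tan 2 q, 2 * devForm hφ c q v w
    = dChart e q v 0 * dChart e q w 0 - dChart e q v 1 * dChart e q w 1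

variable {hφ : IsRiemannianImmersion g h φ} {c μ : ℝ} {e : OpenPartialHomeomorph M (Eu 2)} {q : M}

lemma IsDiagonalAt.inner_eq (H : IsDiagonalAt hφ c e q μ) (v w : Tan 2 q) :
    g.inner q v w = (1 / μ) * inner ℝ (dChart e q v) (dChart e q w) := by
  have h1 := H.metric v w
  have h2 := H.pos
  rw [PiLp.inner_apply, Fin.sum_univ_two]
  simp only [RCLike.inner_apply, conj_trivial]
  field_simp
  linarith

lemma IsDiagonalAt.shapeForm_eq (H : IsDiagonalAt hφ c e q μ) (v w : Tan 2 q) :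
    shapeForm hφ q v w = (c ^ 2 / μ + 1 / 2) * (dChart e q v 0 * dChart e q w 0)
      + (c ^ 2 / μ - 1 / 2) * (dChart e q v 1 * dChart e q w 1) := by
  have h0 := H.pos
  have h1 := H.metric v w
  have h2 := H.dev v w
  rw [devForm_apply] at h2
  field_simp
  linear_combination μ * h2 + 2 * c ^ 2 * h1

lemma IsDiagonalAt.shapeH_eq (H : IsDiagonalAt hφ c e q μ) (he : e ∈ Atl 2 M) (hq : q ∈ e.source)
    (v : Tan 2 q) :
    shapeH g h φ q v = ((c ^ 2 + μ / 2) * dChart e q v 0) • dChartInv e q (stdVec 0)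
      + ((c ^ 2 - μ / 2) * dChart e q v 1) • dChartInv e q (stdVec 1) := by
  apply inner_ext g q
  intro w
  have h0 := H.pos
  have h1 := H.metric (dChartInv e q (stdVec 0)) w
  have h2 := H.metric (dChartInv e q (stdVec 1)) w
  rw [dChart_dChartInv he hq] at h1 h2
  rw [inner_shapeH hφ, H.shapeForm_eq]
  simp only [map_add, map_smul, add_apply, smul_apply, smul_eq_mul]
  simp only [stdVec_apply, if_true, one_ne_zero, zero_ne_one, if_false] at h1 h2
  field_simp
  linear_combination -((2 * c ^ 2 + μ) * dChart e q v 0) * h1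
    - ((2 * c ^ 2 - μ) * dChart e q v 1) * h2

lemma IsDiagonalAt.shapeH_coord (H : IsDiagonalAt hφ c e q μ) (he : e ∈ Atl 2 M)
    (hq : q ∈ e.source) :
    shapeH g h φ q (dChartInv e q (stdVec 0)) = (c ^ 2 + μ / 2) • dChartInv e q (stdVec 0) ∧
    shapeH g h φ q (dChartInv e q (stdVec 1)) = (c ^ 2 - μ / 2) • dChartInv e q (stdVec 1) := by
  constructor <;> rw [H.shapeH_eq he hq, dChart_dChartInv he hq] <;> simp [stdVec]

omit [IsManifold 𝓘(ℝ, Eu 2) ∞ M] in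
lemma dChartInv_stdVec_ne_zero (he : e ∈ Atl 2 M) (hq : q ∈ e.source) (i : Fin 2) :
    dChartInv e q (stdVec i) ≠ 0 := by
  intro h0
  apply stdVec_ne_zero i
  rw [← dChart_dChartInv he hq (stdVec i), h0, map_zero]

lemma IsDiagonalAt.principalCurvatures_eq (H : IsDiagonalAt hφ c e q μ) (he : e ∈ Atl 2 M)
    (hq : q ∈ e.source) :
    principalCurvatures g h φ q = {c ^ 2 - μ / 2, c ^ 2 + μ / 2} := by
  ext t
  simp only [principalCurvatures, Set.mem_ofPred_eq, Set.mem_insert_iff, Set.mem_singleton_iff]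
  constructor
  · rintro ⟨v, hv, hvt⟩
    have h1 := congrArg (dChart e q) hvt
    rw [H.shapeH_eq he hq] at h1
    simp only [map_add, map_smul, dChart_dChartInv he hq] at h1
    have h10 := congrArg (fun z : Eu 2 => z 0) h1
    have h11 := congrArg (fun z : Eu 2 => z 1) h1
    simp [stdVec] at h10 h11
    have hne : dChart e q v ≠ 0 := fun h0 => hv (dChart_injective he hq (h0.trans (map_zero _).symm))
    rcases h10 with h10 | h10
    · exact Or.inr h10.symm
    rcases h11 with h11 | h11
    · exact Or.inl h11.symm
    exfalso
    apply hne
    rw [eu_two_eq (dChart e q v), h10, h11, zero_smul, zero_smul, add_zero]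
  · rintro (rfl | rfl)
    · exact ⟨_, dChartInv_stdVec_ne_zero he hq 1, (H.shapeH_coord he hq).2⟩
    · exact ⟨_, dChartInv_stdVec_ne_zero he hq 0, (H.shapeH_coord he hq).1⟩

lemma IsDiagonalAt.principalGap_eq (H : IsDiagonalAt hφ c e q μ) (he : e ∈ Atl 2 M)
    (hq : q ∈ e.source) : principalGap g h φ q = μ := by
  have h0 := H.pos
  rw [principalGap, maxPrincipalCurvature, minPrincipalCurvature, H.principalCurvatures_eq he hq,
    csSup_pair, csInf_pair, sup_of_le_right (by linarith), inf_of_le_left (by linarith)]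
  ring

end PrincipalCurvatures

/-! ### The Gauss equation of an isometric immersion. -/

section Gauss

variable {m n : ℕ} {M N : Type*}
  [TopologicalSpace M] [ChartedSpace (Eu m) M] [IsManifold 𝓘(ℝ, Eu m) ∞ M]
  [TopologicalSpace N] [ChartedSpace (Eu n) N] [IsManifold 𝓘(ℝ, Eu n) ∞ N]
  {g : Metric m M} {h : Metric n N} {φ : M → N}

lemma hessAlong_eq_sffForm_add (e : OpenPartialHomeomorph M (Eu m))
    (f : OpenPartialHomeomorph N (Eu n)) (x a b : Eu m) :
    hessAlong (christForm h f) (rep φ e f) x a b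
      = sffForm g h φ e f x a b + fderiv ℝ (rep φ e f) x (christForm g e x a b) := by
  rw [sffForm, sub_add_cancel]

/-- The normal part of ∇_a ∂_b is orthogonal to dψ, so only the Levi-Civita derivative of M
survives. Thus the inner products differentiated in `gauss_along` are intrinsic. -/
lemma inner_hessAlong_fderiv (hφ : IsRiemannianImmersion g h φ) {e : OpenPartialHomeomorph M (Eu m)}
    (he : e ∈ Atl m M) {f : OpenPartialHomeomorph N (Eu n)} (hf : f ∈ Atl n N) {q : M}
    (hq : q ∈ e.source) (hfq : φ q ∈ f.source) (a b d : Eu m) :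
    metricForm h f (f (φ q)) (hessAlong (christForm h f) (rep φ e f) (e q) a b)
      (fderiv ℝ (rep φ e f) (e q) d) = koszul (metricForm g e) (e q) a b d := by
  have hrep : rep φ e f (e q) = f (φ q) := by rw [rep, e.left_inv hq]
  rw [hessAlong_eq_sffForm_add (g := g), map_add, add_apply, sffForm_normal hφ he hf hq hfq, zero_add,
    ← metricForm_christForm g he (e.map_source hq),
    (metricForm_eventuallyEq_pullForm hφ he hf hq hfq).eq_of_nhds, pullForm_apply, hrep]

/-- The Gauss equation, with the intrinsic curvature expressed by Christoffel symbols of the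
first kind. -/
theorem gauss_equation (hφ : IsRiemannianImmersion g h φ) {e : OpenPartialHomeomorph M (Eu m)}
    (he : e ∈ Atl m M) {q : M} (hq : q ∈ e.source) (u v : Eu m) :
    h.inner (φ q) (riemann h (φ q) (dMap φ q (dChartInv e q u)) (dMap φ q (dChartInv e q v))
        (dMap φ q (dChartInv e q v))) (dMap φ q (dChartInv e q u))
      = fderiv ℝ (fun y => koszul (metricForm g e) y v v u) (e q) u
        - fderiv ℝ (fun y => koszul (metricForm g e) y u v u) (e q) v
        - metricForm g e (e q) (christForm g e (e q) v v) (christForm g e (e q) u u)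
        + metricForm g e (e q) (christForm g e (e q) u v) (christForm g e (e q) u v)
        - h.inner (φ q) (secondFF g h φ q (dChartInv e q v) (dChartInv e q v))
            (secondFF g h φ q (dChartInv e q u) (dChartInv e q u))
        + h.inner (φ q) (secondFF g h φ q (dChartInv e q u) (dChartInv e q v))
            (secondFF g h φ q (dChartInv e q u) (dChartInv e q v)) := by
  set f := chartAt (Eu n) (φ q) with hfdef
  have hf : f ∈ Atl n N := chartAt_mem_atl (n := n) (φ q)
  have hfq : φ q ∈ f.source := mem_chart_source (Eu n) (φ q)
  set ψ := rep φ e f with hψdef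
  have hx : e q ∈ e.target := e.map_source hq
  have hψ : ContDiffAt ℝ 3 ψ (e q) :=
    (contDiffAt_rep hφ.smooth he hf hx (by rwa [e.left_inv hq])).of_le ENat.LEInfty.out
  have hrep : ψ (e q) = f (φ q) := by rw [hψdef, rep, e.left_inv hq]
  have hy : ψ (e q) ∈ f.target := by rw [hrep]; exact f.map_source hfq
  have hd : ∀ a, dChart f (φ q) (dMap φ q (dChartInv e q a)) = fderiv ℝ ψ (e q) a :=
    fun a => (fderiv_rep hφ.smooth he hf hq hfq a).symm
  have hkos : ∀ a b d, (fun y => metricForm h f (ψ y) (hessAlong (christForm h f) ψ y a b)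
      (fderiv ℝ ψ y d)) =ᶠ[nhds (e q)] fun y => koszul (metricForm g e) y a b d := by
    intro a b d
    filter_upwards [rep_nhds hφ.smooth.continuous hq hfq] with y hy
    have := inner_hessAlong_fderiv hφ he hf (e.map_target hy.1) hy.2 a b d
    rw [e.right_inv hy.1] at this
    exact this
  have hB : ∀ a b, dChart f (φ q) (secondFF g h φ q (dChartInv e q a) (dChartInv e q b))
      = sffForm g h φ e f (e q) a b := by
    intro a b
    rw [secondFF_eq hφ.smooth he hf hq hfq, dChart_dChartInv hf hfq, dChart_dChartInv he hq,
      dChart_dChartInv he hq]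
  -- Each covariant derivative splits into its normal part B and its tangential part dψ(Γ). The
  -- mixed products vanish, and the tangential product is measured by g.
  have hHH : ∀ a b a' b', metricForm h f (ψ (e q)) (hessAlong (christForm h f) ψ (e q) a b)
      (hessAlong (christForm h f) ψ (e q) a' b')
      = h.inner (φ q) (secondFF g h φ q (dChartInv e q a) (dChartInv e q b))
          (secondFF g h φ q (dChartInv e q a') (dChartInv e q b'))
        + metricForm g e (e q) (christForm g e (e q) a b) (christForm g e (e q) a' b') := by
    intro a b a' b'
    rw [inner_eq_metricForm h hf hfq, hB, hB, hrep,
      (metricForm_eventuallyEq_pullForm hφ he hf hq hfq).eq_of_nhds, pullForm_apply, ← hψdef, hrep,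
      hψdef, hessAlong_eq_sffForm_add (g := g), hessAlong_eq_sffForm_add (g := g)]
    simp only [map_add, add_apply, sffForm_normal hφ he hf hq hfq]
    rw [metricForm_symm h f _ (fderiv ℝ (rep φ e f) (e q) _) (sffForm g h φ e f (e q) a' b'),
      sffForm_normal hφ he hf hq hfq]
    ring
  have h1 := gauss_along hψ (differentiableAt_christForm h hf hy) (differentiableAt_metricForm h hf hy)
    (fun a b => christForm_symm h hf hy a b) (fun a b => metricForm_symm h f _ a b)
    (fun a b d => fderiv_metricForm h hf hy a b d) u v
  rw [(hkos v v u).fderiv_eq, (hkos u v u).fderiv_eq, hHH, hHH] at h1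
  rw [inner_eq_metricForm h hf hfq, riemann, ← hfdef]
  simp only [dChart_dChartInv hf hfq, hd, ← hrep]
  rw [curvatureInChart_eq h hf hy, h1]
  ring

end Gauss

/-! ### Codimension one: the normal line is spanned by H. -/

section Normal

variable {n : ℕ} {N : Type*} [TopologicalSpace N] [ChartedSpace (Eu n) N]
  [IsManifold 𝓘(ℝ, Eu n) ∞ N]

/-- A tangent space of a three-dimensional manifold does not contain four nonzero pairwise
orthogonal vectors. -/
lemma eq_zero_of_ortho (h : Metric n N) (hn : n = 3) (y : N) {x₁ x₂ x₃ w : Tan n y}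
    (h₁ : x₁ ≠ 0) (h₂ : x₂ ≠ 0) (h₃ : x₃ ≠ 0) (h₁₂ : h.inner y x₁ x₂ = 0) (h₁₃ : h.inner y x₃ x₁ = 0)
    (h₂₃ : h.inner y x₃ x₂ = 0) (hw₁ : h.inner y w x₁ = 0) (hw₂ : h.inner y w x₂ = 0)
    (hw₃ : h.inner y w x₃ = 0) : w = 0 := by
  by_contra hw
  have hli : LinearIndependent ℝ ![x₁, x₂, x₃, w] := by
    refine LinearMap.linearIndependent_of_isOrthoᵢ (B := metricL h y) ?_ ?_
    · have h₂₁ := (h.symm y x₂ x₁).trans h₁₂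
      have h₃₁ := (h.symm y x₁ x₃).trans h₁₃
      have h₃₂ := (h.symm y x₂ x₃).trans h₂₃
      have hw₁' := (h.symm y x₁ w).trans hw₁
      have hw₂' := (h.symm y x₂ w).trans hw₂
      have hw₃' := (h.symm y x₃ w).trans hw₃
      intro i j hij
      simp only [metricL_apply]
      fin_cases i <;> fin_cases j <;> first | exact absurd rfl hij | assumption
    · intro i
      rw [metricL_apply]
      fin_cases i
      · exact (h.pos y x₁ h₁).ne'
      · exact (h.pos y x₂ h₂).ne'
      · exact (h.pos y x₃ h₃).ne'
      · exact (h.pos y w hw).ne'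
  have : FiniteDimensional ℝ (Tan n y) := inferInstanceAs (FiniteDimensional ℝ (Eu n))
  have h5 := hli.fintype_card_le_finrank
  have h6 : Module.finrank ℝ (Tan n y) = n := finrank_euclideanSpace_fin (𝕜 := ℝ) (n := n)
  rw [h6, hn] at h5
  simp at h5

variable {M : Type*} [TopologicalSpace M] [ChartedSpace (Eu 2) M] [IsManifold 𝓘(ℝ, Eu 2) ∞ M]
  {g : Metric 2 M} {h : Metric n N} {φ : M → N}

/-- In codimension one, the second fundamental form is determined by its component along `H`. -/
lemma inner_secondFF_secondFF (hφ : IsRiemannianImmersion g h φ) (hn : n = 3) {c : ℝ} (hc0 : c ≠ 0)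
    {q : M} (hc : h.inner (φ q) (meanCurvature g h φ q) (meanCurvature g h φ q) = c ^ 2)
    {X Y : Tan 2 q} (hX : X ≠ 0) (hY : Y ≠ 0) (hXY : g.inner q X Y = 0) (u v u' v' : Tan 2 q) :
    c ^ 2 * h.inner (φ q) (secondFF g h φ q u v) (secondFF g h φ q u' v')
      = shapeForm hφ q u v * shapeForm hφ q u' v' := by
  set H := meanCurvature g h φ q with hH
  have hc2 : c ^ 2 ≠ 0 := pow_ne_zero 2 hc0
  have hdne : ∀ Z : Tan 2 q, Z ≠ 0 → dMap φ q Z ≠ (0 : Tan n (φ q)) := by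
    intro Z hZ h0
    have := g.pos q Z hZ
    rw [← hφ.isometric, h0, map_zero] at this
    exact lt_irrefl _ this
  have hH0 : H ≠ 0 := by
    intro h0
    rw [h0, map_zero] at hc
    exact hc2 hc.symm
  -- The difference B(u, v) - (⟨B(u, v), H⟩/c²) H is orthogonal to dφ X, dφ Y and H, which are
  -- nonzero and pairwise orthogonal in a three-dimensional space.
  have h0 : secondFF g h φ q u v - (shapeForm hφ q u v / c ^ 2) • H = 0 := by
    refine eq_zero_of_ortho h hn (φ q) (hdne X hX) (hdne Y hY) hH0 (by rw [hφ.isometric, hXY])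
      (inner_meanCurvature_dMap hφ q X) (inner_meanCurvature_dMap hφ q Y) ?_ ?_ ?_
    · rw [map_sub, map_smul, sub_apply, smul_apply, inner_secondFF_dMap hφ,
        inner_meanCurvature_dMap hφ q X, smul_zero, sub_zero]
    · rw [map_sub, map_smul, sub_apply, smul_apply, inner_secondFF_dMap hφ,
        inner_meanCurvature_dMap hφ q Y, smul_zero, sub_zero]
    · rw [map_sub, map_smul, sub_apply, smul_apply, hc, ← shapeForm_apply hφ, smul_eq_mul,
        div_mul_cancel₀ _ hc2, sub_self]
  rw [sub_eq_zero.1 h0, map_smul, smul_apply, smul_eq_mul, h.symm, ← shapeForm_apply hφ]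
  field_simp

end Normal

/-! ### Curvature of a conformally flat metric in the plane. -/

section Conformal

lemma inner_eu_two (a b : Eu 2) : inner ℝ a b = a 0 * b 0 + a 1 * b 1 := by
  rw [PiLp.inner_apply, Fin.sum_univ_two]
  simp only [RCLike.inner_apply, conj_trivial]
  ring

lemma laplacian_eu_two (f : Eu 2 → ℝ) (x : Eu 2) :
    Laplacian.laplacian f x = fderiv ℝ (fderiv ℝ f) x (stdVec 0) (stdVec 0)
      + fderiv ℝ (fderiv ℝ f) x (stdVec 1) (stdVec 1) := by
  rw [InnerProductSpace.laplacian_eq_iteratedFDeriv_orthonormalBasis f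
    (EuclideanSpace.basisFun (Fin 2) ℝ)]
  simp only [Fin.sum_univ_two, iteratedFDeriv_two_apply, EuclideanSpace.basisFun_apply]
  rfl

lemma norm_gradient_eu_two (f : Eu 2 → ℝ) (x : Eu 2) :
    ‖gradient f x‖ ^ 2 = fderiv ℝ f x (stdVec 0) ^ 2 + fderiv ℝ f x (stdVec 1) ^ 2 := by
  have h1 : ∀ a, inner ℝ (gradient f x) a = fderiv ℝ f x a := fun a => by
    rw [← toDual_gradient, InnerProductSpace.toDual_apply_apply]
  rw [← h1, ← h1, ← real_inner_self_eq_norm_sq, inner_eu_two, inner_eu_two, inner_eu_two]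
  simp [stdVec_apply]
  ring

variable {G : Eu 2 → Eu 2 →L[ℝ] Eu 2 →L[ℝ] ℝ} {f : Eu 2 → ℝ} {x : Eu 2}

/-- First derivatives of a conformally flat metric. -/
lemma fderiv_conformal (hf : ContDiffAt ℝ 2 f x) (h0 : f x ≠ 0)
    (hG : ∀ᶠ y in nhds x, ∀ a b, G y a b = (f y)⁻¹ * inner ℝ a b) :
    ∀ᶠ y in nhds x, ∀ a b d,
      fderiv ℝ G y a b d = -(f y ^ 2)⁻¹ * fderiv ℝ f y a * inner ℝ b d := by
  have h1 : ∀ᶠ y in nhds x, DifferentiableAt ℝ f y :=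
    (hf.eventually (by simp)).mono fun y hy => hy.differentiableAt (by simp)
  filter_upwards [hG.eventually_nhds, h1, hf.continuousAt.eventually_ne h0] with y hy hd hne a b d
  obtain ⟨B, hB⟩ : ∃ B : Eu 2 →L[ℝ] Eu 2 →L[ℝ] ℝ, ∀ a b, B a b = inner ℝ a b :=
    ⟨innerSL ℝ, fun _ _ => rfl⟩
  have h2 : G =ᶠ[nhds y] fun z => (f z)⁻¹ • B := by
    filter_upwards [hy] with z hz
    ext u v
    rw [hz, smul_apply, smul_apply, hB, smul_eq_mul]
  have h3 : HasFDerivAt (fun z => (f z)⁻¹) ((-(f y ^ 2)⁻¹) • fderiv ℝ f y) y :=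
    (hasDerivAt_inv hne).comp_hasFDerivAt y hd.hasFDerivAt
  have h4 : HasFDerivAt (fun z => (f z)⁻¹ • B) _ y := h3.smul_const B
  rw [h2.fderiv_eq, h4.fderiv, ← hB]
  rfl

lemma koszul_conformal (hf : ContDiffAt ℝ 2 f x) (h0 : f x ≠ 0)
    (hG : ∀ᶠ y in nhds x, ∀ a b, G y a b = (f y)⁻¹ * inner ℝ a b) :
    ∀ᶠ y in nhds x, ∀ a b d, koszul G y a b d = -(1 / 2 : ℝ) * ((f y ^ 2)⁻¹ *
      (fderiv ℝ f y a * inner ℝ b d + fderiv ℝ f y b * inner ℝ a d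
        - fderiv ℝ f y d * inner ℝ a b)) := by
  filter_upwards [fderiv_conformal hf h0 hG] with y hy a b d
  rw [koszul, hy, hy, hy]
  ring

lemma fderiv_inv_sq_mul_fderiv (hf : ContDiffAt ℝ 2 f x) (h0 : f x ≠ 0) (k : ℝ) (u v : Eu 2) :
    fderiv ℝ (fun y => k * ((f y ^ 2)⁻¹ * fderiv ℝ f y v)) x u
      = k * (fderiv ℝ (fderiv ℝ f) x u v / f x ^ 2
        - 2 * fderiv ℝ f x u * fderiv ℝ f x v / f x ^ 3) := by
  have hd : DifferentiableAt ℝ f x := hf.differentiableAt (by simp)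
  have hdd : DifferentiableAt ℝ (fderiv ℝ f) x :=
    (hf.fderiv_right (m := 1) (by norm_num)).differentiableAt (by simp)
  have h1 : HasFDerivAt (fun y => (f y ^ 2)⁻¹)
      ((-((f x ^ 2) ^ 2)⁻¹) • ((2 * f x) • fderiv ℝ f x)) x := by
    have h2 : HasFDerivAt (fun y => f y ^ 2) ((2 * f x) • fderiv ℝ f x) x := by
      have := hd.hasFDerivAt.pow 2
      simpa using this
    exact (hasDerivAt_inv (pow_ne_zero 2 h0)).comp_hasFDerivAt x h2
  have h3 : HasFDerivAt (fun y => fderiv ℝ f y v) ((fderiv ℝ (fderiv ℝ f) x).flip v) x := by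
    have := hdd.hasFDerivAt.clm_apply (hasFDerivAt_const v x)
    simpa using this
  have h4 : HasFDerivAt (fun y => k * ((f y ^ 2)⁻¹ * fderiv ℝ f y v)) _ x :=
    (h1.mul h3).const_mul k
  rw [h4.fderiv]
  simp only [smul_apply, add_apply, smul_eq_mul, ContinuousLinearMap.flip_apply]
  field_simp
  ring

/-- The curvature of the metric `f⁻¹ (dx² + dy²)`. -/
lemma curvature_conformal {Γ : Eu 2 → Eu 2 → Eu 2} (hf : ContDiffAt ℝ 2 f x) (h0 : f x ≠ 0)
    (hG : ∀ᶠ y in nhds x, ∀ a b, G y a b = (f y)⁻¹ * inner ℝ a b)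
    (hΓ : ∀ a b d, G x (Γ a b) d = koszul G x a b d) :
    fderiv ℝ (fun y => koszul G y (stdVec 1) (stdVec 1) (stdVec 0)) x (stdVec 0)
        - fderiv ℝ (fun y => koszul G y (stdVec 0) (stdVec 1) (stdVec 0)) x (stdVec 1)
        - G x (Γ (stdVec 1) (stdVec 1)) (Γ (stdVec 0) (stdVec 0))
        + G x (Γ (stdVec 0) (stdVec 1)) (Γ (stdVec 0) (stdVec 1))
      = Laplacian.laplacian f x / (2 * f x ^ 2) - ‖gradient f x‖ ^ 2 / (2 * f x ^ 3) := by
  have hk := koszul_conformal hf h0 hG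
  have i00 : inner ℝ (stdVec 0 : Eu 2) (stdVec 0) = (1 : ℝ) := by
    rw [inner_eu_two]; simp [stdVec_apply]
  have i11 : inner ℝ (stdVec 1 : Eu 2) (stdVec 1) = (1 : ℝ) := by
    rw [inner_eu_two]; simp [stdVec_apply]
  have i01 : inner ℝ (stdVec 0 : Eu 2) (stdVec 1) = (0 : ℝ) := by
    rw [inner_eu_two]; simp [stdVec_apply]
  have i10 : inner ℝ (stdVec 1 : Eu 2) (stdVec 0) = (0 : ℝ) := by
    rw [inner_eu_two]; simp [stdVec_apply]
  have e1 : (fun y => koszul G y (stdVec 1) (stdVec 1) (stdVec 0)) =ᶠ[nhds x]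
      fun y => (1 / 2 : ℝ) * ((f y ^ 2)⁻¹ * fderiv ℝ f y (stdVec 0)) := by
    filter_upwards [hk] with y hy
    rw [hy, i10, i11]
    ring
  have e2 : (fun y => koszul G y (stdVec 0) (stdVec 1) (stdVec 0)) =ᶠ[nhds x]
      fun y => (-(1 / 2) : ℝ) * ((f y ^ 2)⁻¹ * fderiv ℝ f y (stdVec 1)) := by
    filter_upwards [hk] with y hy
    rw [hy, i10, i00, i01]
    ring
  -- The standard basis is orthogonal with squared length 1/f, so products of Christoffel vectors
  -- expand in their pairings with it, and these are Koszul expressions.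
  have hs : ∀ a b : Eu 2, G x a b = f x * (G x a (stdVec 0) * G x b (stdVec 0)
      + G x a (stdVec 1) * G x b (stdVec 1)) := by
    intro a b
    have hx := hG.self_of_nhds
    simp only [hx, inner_eu_two]
    simp [stdVec_apply]
    field_simp
  rw [e1.fderiv_eq, e2.fderiv_eq, fderiv_inv_sq_mul_fderiv hf h0, fderiv_inv_sq_mul_fderiv hf h0,
    hs (Γ (stdVec 1) (stdVec 1)), hs (Γ (stdVec 0) (stdVec 1)), laplacian_eu_two,
    norm_gradient_eu_two]
  simp only [hΓ, hk.self_of_nhds, i00, i01, i10, i11]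
  field_simp
  ring

end Conformal

/-! ### The equation satisfied by μ, and the main theorem. -/

section GapEquation

variable {n : ℕ} {M N : Type*}
  [TopologicalSpace M] [ChartedSpace (Eu 2) M] [IsManifold 𝓘(ℝ, Eu 2) ∞ M]
  [TopologicalSpace N] [ChartedSpace (Eu n) N] [IsManifold 𝓘(ℝ, Eu n) ∞ N]
  {g : Metric 2 M} {h : Metric n N} {φ : M → N}

/-- The Gauss equation of a CMC surface in a three-manifold, in isothermal line of curvature
coordinates. -/
theorem gap_equation (hφ : IsRiemannianImmersion g h φ) (hn : n = 3) {c : ℝ} (hc0 : c ≠ 0)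
    (hc : ∀ q, h.inner (φ q) (meanCurvature g h φ q) (meanCurvature g h φ q) = c ^ 2)
    {e : OpenPartialHomeomorph M (Eu 2)} (he : e ∈ Atl 2 M) {μ : M → ℝ}
    (hμ : ContMDiffOn 𝓘(ℝ, Eu 2) 𝓘(ℝ, ℝ) ∞ μ e.source)
    (H : ∀ q ∈ e.source, IsDiagonalAt hφ c e q (μ q)) {q : M} (hq : q ∈ e.source) :
    μ q * (-(Laplacian.laplacian (fun x : Eu 2 => μ (e.symm x)) (e q)))
      + ‖gradient (fun x : Eu 2 => μ (e.symm x)) (e q)‖ ^ 2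
      + 2 * μ q * (sectionalCurvature h (φ q) (dMap φ q (dChartInv e q (stdVec 0)))
          (dMap φ q (dChartInv e q (stdVec 1))) + c ^ 2 - μ q ^ 2 / (4 * c ^ 2)) = 0 := by
  set f : Eu 2 → ℝ := fun x => μ (e.symm x) with hfdef
  have hx : e q ∈ e.target := e.map_source hq
  have hfq : f (e q) = μ q := by rw [hfdef]; simp only [e.left_inv hq]
  have hf : ContDiffAt ℝ 2 f (e q) := by
    have h1 : ContMDiffOn 𝓘(ℝ, Eu 2) 𝓘(ℝ, ℝ) ∞ f e.target :=
      hμ.comp (contMDiffOn_symm_of_mem_maximalAtlas he) fun y hy => e.map_target hy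
    exact ((contMDiffOn_iff_contDiffOn.1 h1).contDiffAt (e.open_target.mem_nhds hx)).of_le
      ENat.LEInfty.out
  have hμ0 := (H q hq).pos
  have h0 : f (e q) ≠ 0 := by rw [hfq]; exact hμ0.ne'
  have hG : ∀ᶠ y in nhds (e q), ∀ a b, metricForm g e y a b = (f y)⁻¹ * inner ℝ a b := by
    filter_upwards [e.open_target.mem_nhds hx] with y hy a b
    have hy' := e.map_target hy
    rw [metricForm_apply, metricInChart, (H _ hy').inner_eq, dChart_dChartInv he hy',
      dChart_dChartInv he hy', one_div]
  have hcurv := curvature_conformal (Γ := fun a b => christForm g e (e q) a b) hf h0 hG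
    (fun a b d => metricForm_christForm g he hx a b d)
  have hgauss := gauss_equation hφ he hq (stdVec 0) (stdVec 1)
  set X := dChartInv e q (stdVec 0) with hX
  set Y := dChartInv e q (stdVec 1) with hY
  have dX : dChart e q X = stdVec 0 := dChart_dChartInv he hq _
  have dY : dChart e q Y = stdVec 1 := dChart_dChartInv he hq _
  have gXX : g.inner q X X = 1 / μ q := by
    rw [(H q hq).inner_eq, dX, inner_eu_two]; simp [stdVec_apply]
  have gYY : g.inner q Y Y = 1 / μ q := by
    rw [(H q hq).inner_eq, dY, inner_eu_two]; simp [stdVec_apply]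
  have gXY : g.inner q X Y = 0 := by
    rw [(H q hq).inner_eq, dX, dY, inner_eu_two]; simp [stdVec_apply]
  have sXX : shapeForm hφ q X X = c ^ 2 / μ q + 1 / 2 := by
    rw [(H q hq).shapeForm_eq, dX]; simp [stdVec_apply]
  have sYY : shapeForm hφ q Y Y = c ^ 2 / μ q - 1 / 2 := by
    rw [(H q hq).shapeForm_eq, dY]; simp [stdVec_apply]
  have sXY : shapeForm hφ q X Y = 0 := by
    rw [(H q hq).shapeForm_eq, dX, dY]; simp [stdVec_apply]
  have hX0 : X ≠ 0 := dChartInv_stdVec_ne_zero he hq 0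
  have hY0 : Y ≠ 0 := dChartInv_stdVec_ne_zero he hq 1
  have b1 := inner_secondFF_secondFF hφ hn hc0 (hc q) hX0 hY0 gXY Y Y X X
  have b2 := inner_secondFF_secondFF hφ hn hc0 (hc q) hX0 hY0 gXY X Y X Y
  rw [sXX, sYY] at b1
  rw [sXY] at b2
  -- The denominator |X|²|Y|² - ⟨X, Y⟩² equals 1/μ². Multiplied by μ², the product ⟨B(Y, Y), B(X,
  -- X)⟩ computed below becomes c² - μ²/(4c²), the extrinsic term of the equation.
  rw [sectionalCurvature, hφ.isometric, hφ.isometric, hφ.isometric, gXX, gYY, gXY]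
  rw [hcurv, hfq] at hgauss
  have b2' : h.inner (φ q) (secondFF g h φ q X Y) (secondFF g h φ q X Y) = 0 := by
    have : c ^ 2 ≠ 0 := pow_ne_zero 2 hc0
    simpa [this] using b2
  have b1' : h.inner (φ q) (secondFF g h φ q Y Y) (secondFF g h φ q X X)
      = (c ^ 2 / μ q - 1 / 2) * (c ^ 2 / μ q + 1 / 2) / c ^ 2 := by
    rw [eq_div_iff (pow_ne_zero 2 hc0)]
    linarith
  rw [hgauss, b1', b2']
  field_simp
  ring

end GapEquation

end RiemSub

end

theorem mainTheorem5 {n : ℕ} {M N : Type*}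
    [TopologicalSpace M] [ChartedSpace (Eu 2) M] [IsManifold 𝓘(ℝ, Eu 2) ∞ M]
    [TopologicalSpace N] [ChartedSpace (Eu n) N] [IsManifold 𝓘(ℝ, Eu n) ∞ N]
    (g : RiemSub.Metric 2 M) (h : RiemSub.Metric n N) (φ : M → N)
    (hφ : IsRiemannianImmersion g h φ) (hcmc : IsCMC g h φ) (hbi : IsBiconservative g h φ)
    (p : M) (hp : ¬ IsPseudoumbilicalAt g h φ p) :
    ∃ e ∈ IsManifold.maximalAtlas 𝓘(ℝ, Eu 2) ∞ M, p ∈ e.source ∧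
      IsIsothermal g e ∧ IsLineOfCurvature g h φ e ∧
      -- `μ` is positive and smooth on the domain of the chart
      (∀ q ∈ e.source, 0 < principalGap g h φ q) ∧
      ContMDiffOn 𝓘(ℝ, Eu 2) 𝓘(ℝ, ℝ) ∞ (principalGap g h φ) e.source ∧
      -- the metric is `(1/μ)` times the Euclidean metric of the coordinates
      (∀ q ∈ e.source, ∀ v w : Tan 2 q,
        g.inner q v w =
          (1 / principalGap g h φ q) * inner ℝ (dChart e q v) (dChart e q w)) ∧
      -- `A_H` as a tensor of type `(0,2)`
      (∀ q ∈ e.source, ∀ v w : Tan 2 q,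
        g.inner q (shapeH g h φ q v) w =
          (meanCurvatureNorm g h φ q ^ 2 / principalGap g h φ q + 1 / 2)
              * (dChart e q v 0 * dChart e q w 0)
            + (meanCurvatureNorm g h φ q ^ 2 / principalGap g h φ q - 1 / 2)
              * (dChart e q v 1 * dChart e q w 1)) ∧
      -- `A_H` as a tensor of type `(1,1)`
      (∀ q ∈ e.source, ∀ v : Tan 2 q,
        shapeH g h φ q v =
          ((meanCurvatureNorm g h φ q ^ 2 + principalGap g h φ q / 2) * dChart e q v 0)
              • dChartInv e q (stdVec 0)
            + ((meanCurvatureNorm g h φ q ^ 2 - principalGap g h φ q / 2) * dChart e q v 1)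
              • dChartInv e q (stdVec 1)) ∧
      -- the equation for `μ` if `N` is three-dimensional; here the geometric Laplacian (minus the sum
      -- of the pure second derivatives) is the negative of `Laplacian.laplacian`
      (n = 3 → ∀ q ∈ e.source,
        principalGap g h φ q
              * (-(Laplacian.laplacian (fun x : Eu 2 => principalGap g h φ (e.symm x)) (e q)))
            + ‖gradient (fun x : Eu 2 => principalGap g h φ (e.symm x)) (e q)‖ ^ 2
            + 2 * principalGap g h φ q *
              (sectionalCurvature h (φ q)
                  (dMap φ q (dChartInv e q (stdVec 0))) (dMap φ q (dChartInv e q (stdVec 1)))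
                + meanCurvatureNorm g h φ q ^ 2
                - principalGap g h φ q ^ 2 / (4 * meanCurvatureNorm g h φ q ^ 2)) = 0) := by
  obtain ⟨c, hc'⟩ := hcmc
  have hc : ∀ q, h.inner (φ q) (meanCurvature g h φ q) (meanCurvature g h φ q) = c ^ 2 := fun q => by
    rw [← meanCurvatureNorm_sq, hc']
  obtain ⟨e, he, hpe, μ, hμ, H'⟩ := exists_isothermal_chart hφ hbi hc hp
  have H : ∀ q ∈ e.source, IsDiagonalAt hφ c e q (μ q) := fun q hq =>
    ⟨(H' q hq).1, fun v w => ((H' q hq).2 v w).1, fun v w => ((H' q hq).2 v w).2⟩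
  have hgap : ∀ q ∈ e.source, principalGap g h φ q = μ q := fun q hq =>
    (H q hq).principalGap_eq he hq
  refine ⟨e, he, hpe, ⟨fun q => 1 / μ q, fun q hq => ⟨one_div_pos.2 (H q hq).pos, (H q hq).inner_eq⟩⟩,
    fun q hq => ⟨fun i j hij => ?_, fun i => ?_⟩, fun q hq => ?_, hμ.congr hgap, fun q hq v w => ?_,
    fun q hq v w => ?_, fun q hq v => ?_, fun hn q hq => ?_⟩
  · rw [(H q hq).inner_eq, dChart_dChartInv he hq, dChart_dChartInv he hq, inner_eu_two]
    fin_cases i <;> fin_cases j <;> simp [stdVec_apply] at hij ⊢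
  · fin_cases i
    · exact ⟨_, ((H q hq).shapeH_coord he hq).1⟩
    · exact ⟨_, ((H q hq).shapeH_coord he hq).2⟩
  · rw [hgap q hq]
    exact (H q hq).pos
  · rw [hgap q hq]
    exact (H q hq).inner_eq v w
  · rw [hgap q hq, hc', inner_shapeH hφ]
    exact (H q hq).shapeForm_eq v w
  · rw [hgap q hq, hc']
    exact (H q hq).shapeH_eq he hq v
  · have hc0 : c ≠ 0 := by
      rintro rfl
      exact hp (isPseudoumbilicalAt_of_meanCurvature_eq_zero hφ (hc p))
    -- The functions `principalGap` and μ are known to agree only on the domain of the chart. That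
    -- is enough, since the gradient and the Laplacian at a point depend only on the germ.
    have hrep : (fun x : Eu 2 => principalGap g h φ (e.symm x)) =ᶠ[nhds (e q)]
        fun x => μ (e.symm x) := by
      filter_upwards [e.open_target.mem_nhds (e.map_source hq)] with x hx
      exact hgap _ (e.map_target hx)
    have hgrad : gradient (fun x : Eu 2 => principalGap g h φ (e.symm x)) (e q)
        = gradient (fun x : Eu 2 => μ (e.symm x)) (e q) := by
      rw [gradient, gradient, hrep.fderiv_eq]
    rw [hgrad, (InnerProductSpace.laplacian_congr_nhds hrep).eq_of_nhds, hgap q hq, hc']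
    exact gap_equation hφ hn hc0 hc he hμ H hq
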